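/- **Model.** Let $n\ge 3$, $\mu\in\mathbb R$, $\tau>0$, and let $\varepsilon_1,\dots,\varepsilon_n,e_1,\dots,e_n$ be independent $\mathsf N(0,1)$ variables. Put $\mu_i=\mu+\tau\varepsilon_i$, $X_i=\mu_i+e_i$, $X=(X_1,\dots,X_n)$, $\omega=(1+\tau^2)^{-1}$, and let $\overline X_{(-1)}$, $S_{(-1)}^2$ be the sample mean and the sample variance (divisor $n-2$) of $X_2,\dots,X_n$. Fix $\gamma\in(0,\tfrac12)$. Let $T(X)=(\overline X_{(-1)},S^2_{(-1)})$, $$H(X)=\sqrt{\tfrac{n-1}{n}}\,\frac{X_1-\overline X_{(-1)}}{S_{(-1)}},$$ and, for a real number $h$, $$\tilde\mu=\sqrt{\tfrac{n-1}{n}}\,h\Big(\tfrac{n-2}{h^2+n-2}S_{(-1)}^{-1}-\tfrac{n}{n-1}S_{(-1)}\Big),\qquad \tilde\sigma^2=\max\Big\{n^{-\gamma},\,1-\tfrac{(n-1)(n-2)(n-3-h^2)}{n(n-2+h^2)^2}S_{(-1)}^{-2}\Big\},$$ $$b(T(X),\eta)=(\overline X_{(-1)}-\eta-\tilde\mu)/\tilde\sigma,\qquad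 W_b(\tau)=b(T(X),\mu_1),$$ where $h=H(X)$ in $W_b(\tau)$ and wherever $\tilde\mu,\tilde\sigma$ are evaluated at the random data. Let $\Phi$ be the $\mathsf N(0,1)$ c.d.f., $g$ the density of $\chi^2_{n-1}/(n-1)$, and $$F_{\omega,h}(s)=\int_0^\infty\Phi\left(\frac{s\sqrt{\max\{n^{-\gamma},1-c_1\omega/x\}}-c_2\sqrt\omega\,(\sqrt x-c_3/\sqrt x)}{\sqrt{1-\omega(n-1)/n}}\right)g(x)\,dx,$$ $c_1=\frac{(n-2)(n-3-h^2)}{n(h^2+n-2)}$, $c_2=\frac{(n-1)h}{\sqrt{n(h^2+n-2)}}$, $c_3=\frac{n-2}{n-1}$. Let $\underline F=\inf_{\omega\in(0,1)}F_{\omega,h}$, $\overline F=\sup_{\omega\in(0,1)}F_{\omega,h}$ (pointwise), and $F^{-1}(u)=\inf\{x:F(x)\ge u\}$. Let $F^*_h=\overline F$ where $\overline F<\frac12$, $F^*_h=\underline F$ where $\underline F>\frac12$, and $F^*_h=\frac12$ elsewhere. With $U\sim\mathsf{Unif}(0,1)$, let $\mathcal S_h$ be the convex hull of $\{(F_h^{*})^{-1}(u'):u'\in(0,1),\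 |u'-\frac12|<|U-\frac12|\}$. For data $x$ with $S_{(-1)}>0$ and $h=H(x)$ put $$\mathsf{cpl}_{T(x)|h}(\eta)=1-P\Big(\bigcup_{s\in\mathcal S_h}\{\eta':b(T(x),\eta')=s\}\subseteq\mathbb R\setminus\{\eta\}\Big),\qquad C_\alpha(x)=\{\eta:\mathsf{cpl}_{T(x)|h}(\eta)\ge\alpha\}.$$ **Claim.** For every $n\ge3$: 1. With $\tilde\tau=\sqrt{(\tau^2+1)/(n-1)}$ there are variables $Z\sim\mathsf N(0,1)$ and $M^2_{n-2}\sim\chi^2_{n-2}/(n-2)$ (namely $Z=(\overline X_{(-1)}-\mu)/\tilde\tau$ and $M_{n-2}^2=S_{(-1)}^2/(\tau^2+1)$) such that $\varepsilon_1,e_1,Z,M_{n-2}^2$ are mutually independent, $\overline X_{(-1)}=\mu+\tilde\tau Z$, $S_{(-1)}^2=(\tau^2+1)M_{n-2}^2$, and $$H(X)=W_H:=\frac{\tau\varepsilon_1+e_1-\tilde\tau Z}{\sqrt n\,\tilde\tau M_{n-2}}\sim t_{n-2}.$$ 2. $\overline X_{(-1)}-\mu_1-\tilde\mu$ is integrable,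 and $\mathbb E(\overline X_{(-1)}-\mu_1-\tilde\mu\mid W_H=h)=0$ for almost every $h$. 3. For almost every $h$, the conditional c.d.f. of $W_b(\tau)$ given $W_H=h$ is $F_{\omega,h}$ with $\omega=(1+\tau^2)^{-1}$. 4. For every $h$, $F_h^*$ is a c.d.f., and for each $\omega\in(0,1)$ it bounds $F_{\omega,h}$ in tails: $F_{\omega,h}(z)\le F_h^*(z)$ for $z<F_{\omega,h}^{-1}(\frac12)$ and $F_{\omega,h}(z)\ge F^*_h(z)$ for $z>F_{\omega,h}^{-1}(\frac12)$. 5. For all data $x$ with $S_{(-1)}>0$, with $h=H(x)$, and all $\eta\in\mathbb R$, $$\mathsf{cpl}_{T(x)|h}(\eta)=\min\left\{1,\ 2\Big[1-\underline F\Big(\tfrac{\bar x_{(-1)}-\eta-\tilde\mu}{\tilde\sigma}\Big)\Big],\ 2\overline F\Big(\tfrac{\bar x_{(-1)}-\eta-\tilde\mu}{\tilde\sigma}\Big)\right\},$$ and for every $\alpha\in(0,1)$ $$C_\alpha(x)=\Big[\bar x_{(-1)}-\tilde\mu-\underline F^{-1}(1-\alpha/2)\,\tilde\sigma,\ \ \bar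 x_{(-1)}-\tilde\mu-\overline F^{-1}(\alpha/2)\,\tilde\sigma\Big].$$ 6. For every $\alpha\in(0,1)$, $P(\mu_1\in C_\alpha(X)\mid H(X))\ge1-\alpha$ almost surely. Moreover, for fixed $\mu$, $\tau>0$ and $\gamma$, as $n\to\infty$, $W_b(\tau)\mid\{W_H=h\}\overset{d}{\to}\mathsf N(0,1)$: for almost every $h$ the conditional c.d.f.s of $W_b(\tau)$ given $W_H=h$ converge to $\Phi$ at every point, and for every $h$ the explicit versions $F_{\omega,h}$ with $\omega=(1+\tau^2)^{-1}$ converge to $\Phi$ at every point. -/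

import Mathlib

open MeasureTheory ProbabilityTheory Filter Topology Set

noncomputable section

namespace PartialBayes

/-! ### Distributions -/

/-- The standard normal c.d.f. `Φ`. -/
def Phi (s : ℝ) : ℝ := cdf (gaussianReal 0 1) s

/-- The chi-square distribution with `k` degrees of freedom (shape `k / 2`, rate `1 / 2`). -/
def chiSqMeasure (k : ℝ) : Measure ℝ := gammaMeasure (k / 2) (1 / 2)

/-- The density of `χ²_k / k`, i.e. `x ↦ k f (k x)` with `f` the density of `χ²_k`. -/
def scaledChiSqPDF (k x : ℝ) : ℝ := k * gammaPDFReal (k / 2) (1 / 2) (k * x)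

/-- The density of Student's `t` distribution with `ν` degrees of freedom. -/
def studentTPDF (ν x : ℝ) : ℝ :=
  Real.Gamma ((ν + 1) / 2) / (√(ν * Real.pi) * Real.Gamma (ν / 2)) *
    (1 + x ^ 2 / ν) ^ (-((ν + 1) / 2))

/-- Student's `t` distribution with `ν` degrees of freedom. -/
def studentTMeasure (ν : ℝ) : Measure ℝ :=
  volume.withDensity fun x => ENNReal.ofReal (studentTPDF ν x)

/-- The generalized inverse `F⁻¹(u) = inf {x : F(x) ≥ u}`. -/
def genInv (F : ℝ → ℝ) (u : ℝ) : ℝ := sInf {x | u ≤ F x}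

/-! ### The predictive random set and the plausibility function -/

/-- A random variable with c.d.f. `F` is stochastically bounded in tails by one with c.d.f. `G`:
`F ≤ G` to the left of the median of `F` and `F ≥ G` to the right of it. -/
def StochBoundedInTails (F G : ℝ → ℝ) : Prop :=
  (∀ z, z < genInv F (1 / 2) → F z ≤ G z) ∧ (∀ z, genInv F (1 / 2) < z → G z ≤ F z)

/-- The realization at `U = u` of the predictive random set: the interval spanned by the quantiles
`F⁻¹(u')`, `u' ∈ (0,1)`, `|u' - 1/2| < |u - 1/2|`. -/
def predictiveSet (F : ℝ → ℝ) (u : ℝ) : Set ℝ :=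
  convexHull ℝ {z | ∃ u' ∈ Ioo (0 : ℝ) 1, |u' - 1 / 2| < |u - 1 / 2| ∧ genInv F u' = z}

/-- The plausibility of `η` for the association `b(η) = W`, where `W` is predicted by the
random set built from the c.d.f. `F` and `U ∼ Unif(0,1)`: one minus the probability that
`⋃_{s ∈ S} {η' : b(η') = s}` is contained in the complement of `{η}`. -/
def plausibility (F : ℝ → ℝ) (b : ℝ → ℝ) (η : ℝ) : ℝ :=
  1 - ((volume : Measure ℝ).restrict (Ioo 0 1)).real
    {u | (⋃ s ∈ predictiveSet F u, {η' | b η' = s}) ⊆ Iio η ∪ Ioi η}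

/-! ### Statistics of a data vector `x = (x₁, …, xₙ)` -/

/-- The mean of `x₂, …, xₙ`. -/
def restMean (n : ℕ) (x : ℕ → ℝ) : ℝ := (∑ i ∈ Finset.Icc 2 n, x i) / ((n : ℝ) - 1)

/-- The sample variance `S²` of the `n - 1` numbers `x₂, …, xₙ`. -/
def restVar (n : ℕ) (x : ℕ → ℝ) : ℝ :=
  (∑ i ∈ Finset.Icc 2 n, (x i - restMean n x) ^ 2) / ((n : ℝ) - 2)

/-- The statistic `T(x)`, the mean and the variance of `x₂, …, xₙ`. -/
def statT (n : ℕ) (x : ℕ → ℝ) : ℝ × ℝ := (restMean n x, restVar n x)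

/-- The studentized statistic `H(x)`. -/
def statH (n : ℕ) (x : ℕ → ℝ) : ℝ :=
  √(((n : ℝ) - 1) / n) * ((x 1 - restMean n x) / √(restVar n x))

/-- The centering `μ̃`, as a function of `h` and `S`. -/
def muTilde (n : ℕ) (h S : ℝ) : ℝ :=
  √(((n : ℝ) - 1) / n) * h *
    (((n : ℝ) - 2) / (h ^ 2 + n - 2) * S⁻¹ - (n : ℝ) / ((n : ℝ) - 1) * S)

/-- The squared scale `σ̃²`, as a function of `h` and `S`. -/
def sigmaTildeSq (n : ℕ) (γ h S : ℝ) : ℝ :=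
  max ((n : ℝ) ^ (-γ))
    (1 - ((n : ℝ) - 1) * ((n : ℝ) - 2) * ((n : ℝ) - 3 - h ^ 2) /
      (n * ((n : ℝ) - 2 + h ^ 2) ^ 2) * (S ^ 2)⁻¹)

/-- The scale `σ̃`. -/
def sigmaTilde (n : ℕ) (γ h S : ℝ) : ℝ := √(sigmaTildeSq n γ h S)

/-- `b(t, η) = (x̄ - η - μ̃) / σ̃` for `t = (x̄, S²)`. -/
def bFun (n : ℕ) (γ h : ℝ) (t : ℝ × ℝ) (η : ℝ) : ℝ :=
  (t.1 - η - muTilde n h √t.2) / sigmaTilde n γ h √t.2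

/-! ### The conditional c.d.f. and the interval -/

/-- The explicit conditional c.d.f. at `s`, as a function of `h` and of `w = 1 / (1 + τ²)`. -/
def explicitCDF (n : ℕ) (γ h w s : ℝ) : ℝ :=
  let c₁ : ℝ := ((n : ℝ) - 2) * ((n : ℝ) - 3 - h ^ 2) / (n * (h ^ 2 + n - 2))
  let c₂ : ℝ := ((n : ℝ) - 1) * h / √(n * (h ^ 2 + n - 2))
  let c₃ : ℝ := ((n : ℝ) - 2) / ((n : ℝ) - 1)
  ∫ x in Ioi (0 : ℝ),
    Phi ((s * √(max ((n : ℝ) ^ (-γ)) (1 - c₁ * w / x)) - c₂ * √w * (√x - c₃ / √x)) /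
      √(1 - w * ((n : ℝ) - 1) / n)) * scaledChiSqPDF ((n : ℝ) - 1) x

/-- The lower envelope over `w ∈ (0,1)` of the conditional c.d.f.s. -/
def lowerCDF (n : ℕ) (γ h s : ℝ) : ℝ := ⨅ w : Ioo (0 : ℝ) 1, explicitCDF n γ h w s

/-- The upper envelope over `w ∈ (0,1)` of the conditional c.d.f.s. -/
def upperCDF (n : ℕ) (γ h s : ℝ) : ℝ := ⨆ w : Ioo (0 : ℝ) 1, explicitCDF n γ h w s

/-- The c.d.f. of the bounding variable: the upper envelope to the left of all the
medians of the family, the lower envelope to the right of all of them, and `1/2` in between. -/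
def starCDF (n : ℕ) (γ h z : ℝ) : ℝ :=
  if upperCDF n γ h z < 1 / 2 then upperCDF n γ h z
  else if 1 / 2 < lowerCDF n γ h z then lowerCDF n γ h z
  else 1 / 2

/-- The conditional plausibility function of `μ₁` at `η`, given the data `x` (with `h = H(x)`). -/
def cpl (n : ℕ) (γ : ℝ) (x : ℕ → ℝ) (η : ℝ) : ℝ :=
  plausibility (starCDF n γ (statH n x)) (bFun n γ (statH n x) (statT n x)) η

/-- The interval estimator `C_α(x)`: all values whose plausibility is at least `α`. -/
def plausInterval (n : ℕ) (γ α : ℝ) (x : ℕ → ℝ) : Set ℝ := {η | α ≤ cpl n γ x η}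

/-! ### The model -/

section Model

variable {Ω : Type*}

/-- `ε₁, …, εₙ, e₁, …, eₙ` are independent standard normal random variables. -/
structure IsStdNormalNoise [MeasurableSpace Ω] (n : ℕ) (P : Measure Ω) (ε e : ℕ → Ω → ℝ) :
    Prop where
  measurable_ε : ∀ i ∈ Finset.Icc 1 n, Measurable (ε i)
  measurable_e : ∀ i ∈ Finset.Icc 1 n, Measurable (e i)
  law_ε : ∀ i ∈ Finset.Icc 1 n, HasLaw (ε i) (gaussianReal 0 1) P
  law_e : ∀ i ∈ Finset.Icc 1 n, HasLaw (e i) (gaussianReal 0 1) P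
  indep : iIndepFun
    (Sum.elim (fun i : Finset.Icc 1 n => ε i) (fun i : Finset.Icc 1 n => e i)) P

/-- The individual mean `μ₁ = μ + τ ε₁`. -/
def firstMean (μ τ : ℝ) (ε : ℕ → Ω → ℝ) (o : Ω) : ℝ := μ + τ * ε 1 o

/-- The data `Xᵢ = μ + τ εᵢ + eᵢ`. -/
def obs (μ τ : ℝ) (ε e : ℕ → Ω → ℝ) (o : Ω) : ℕ → ℝ := fun i => μ + τ * ε i o + e i o

/-- `τ̃ = √((τ² + 1) / (n - 1))`. -/
def tauTilde (n : ℕ) (τ : ℝ) : ℝ := √((τ ^ 2 + 1) / ((n : ℝ) - 1))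

/-- The auxiliary variable `Z`: the standardized mean of `τ εᵢ + eᵢ`, `i = 2, …, n`. -/
def auxZ (n : ℕ) (τ : ℝ) (ε e : ℕ → Ω → ℝ) (o : Ω) : ℝ :=
  restMean n (obs 0 τ ε e o) / tauTilde n τ

/-- The auxiliary variable `M²`: the standardized variance of `τ εᵢ + eᵢ`, `i = 2, …, n`. -/
def auxMSq (n : ℕ) (τ : ℝ) (ε e : ℕ → Ω → ℝ) (o : Ω) : ℝ :=
  restVar n (obs 0 τ ε e o) / (τ ^ 2 + 1)

/-- The auxiliary variable `W_H`. -/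
def auxWH (n : ℕ) (τ : ℝ) (ε e : ℕ → Ω → ℝ) (o : Ω) : ℝ :=
  (τ * ε 1 o + e 1 o - tauTilde n τ * auxZ n τ ε e o) /
    (√(n : ℝ) * tauTilde n τ * √(auxMSq n τ ε e o))

/-- The centered difference: the mean of `X₂, …, Xₙ`, minus `μ₁`, minus `μ̃` at `h = H(X)`. -/
def centeredDiff (n : ℕ) (μ τ : ℝ) (ε e : ℕ → Ω → ℝ) (o : Ω) : ℝ :=
  restMean n (obs μ τ ε e o) - firstMean μ τ ε o -
    muTilde n (statH n (obs μ τ ε e o)) √(restVar n (obs μ τ ε e o))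

/-- `W_b(τ) = b(T(X), μ₁)`, with `h = H(X)`. -/
def auxWb (n : ℕ) (γ μ τ : ℝ) (ε e : ℕ → Ω → ℝ) (o : Ω) : ℝ :=
  bFun n γ (statH n (obs μ τ ε e o)) (statT n (obs μ τ ε e o)) (firstMean μ τ ε o)

end Model

end PartialBayes

end

open PartialBayes

/-!
Write `N` for the standardized difference of `X₁` and the mean of `X₂, …, Xₙ`, `M²` for the
standardized variance of `X₂, …, Xₙ`, and `R` for the residual of the regression of
`X̄₍₋₁₎ - μ₁` on that difference. All of them are functions of one standard Gaussian vector, so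
orthogonality of coefficients makes `N`, `M²`, `R` independent (`iIndepFun_aux_regression`), and
`ε₁, e₁, Z, M²` as well (`iIndepFun_aux`). The chi-square law of the sum of squared deviations
comes from dividing characteristic functions in `∑ uᵢ² = (sum of squared deviations) + (mean term)`.

The key step is a change of variables. Conditionally on `W_H = N / M` the pair `(N, M)` is
determined by `Y = ((n - 2) M² + N²) / (n - 1)`, and `Y` is independent of `W_H` with law
`χ²_{n-1} / (n - 1)`, while `W_H` is Student distributed. Hence `W_H`, `Y`, `R` are independent
(`map_auxWH_auxY_auxR`), and the centered difference and `W_b` are explicit functions of the triple.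
Conditioning on `W_H = h` therefore just freezes the first argument
(`condDistrib_ae_eq_map_of_indep`). Integrating out the Gaussian `R` leaves the mixture of normal
c.d.f.s `F_{ω,h}`, and the conditional mean vanishes because the centering `μ̃` is built from
`(n - 1) 𝔼 √Y = (n - 2) 𝔼 (1 / √Y)`.

The functions `F_{ω,h}`, `ω ∈ (0, 1)`, form a uniform family (`IsUniformFamily`): they are uniformly
Lipschitz, with uniform strict growth and uniform tails. Their pointwise infimum and supremum are
therefore continuous strictly increasing c.d.f.s again. For such a pair of envelopes the bounding
c.d.f. and the plausibility can be computed by hand (`plausibility_starOf`), the plausibility region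
is an interval between two quantiles, and it covers with conditional probability at least `1 - α`
because the true conditional c.d.f. lies between the envelopes.

The limit `n → ∞` is Chebyshev's inequality for `Y`, which has mean `1` and variance `2 / (n - 1)`.
-/

namespace PartialBayes

/-! ### Envelopes of continuous distribution functions and the predictive random set -/

/-- `F` is a continuous, strictly increasing function with limits `0` at `-∞` and `1` at `∞`. -/
structure IsStrictCDF (F : ℝ → ℝ) : Prop where
  continuous : Continuous F
  strictMono : StrictMono F
  tendsto_atBot : Tendsto F atBot (𝓝 0)
  tendsto_atTop : Tendsto F atTop (𝓝 1)

/-- The quantile function is the lower adjoint of a continuous distribution function. -/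
lemma genInv_le_iff {F : ℝ → ℝ} (hc : Continuous F) (hm : Monotone F)
    (h0 : Tendsto F atBot (𝓝 0)) (h1 : Tendsto F atTop (𝓝 1)) {u : ℝ} (hu : u ∈ Ioo (0 : ℝ) 1)
    (b : ℝ) : genInv F u ≤ b ↔ u ≤ F b := by
  have hne : {x | u ≤ F x}.Nonempty := (h1.eventually (Ici_mem_nhds hu.2)).exists
  have hbdd : BddBelow {x | u ≤ F x} := by
    obtain ⟨y, hy⟩ := (h0.eventually (Iio_mem_nhds hu.1)).exists
    refine ⟨y, fun x hx => ?_⟩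
    by_contra! h
    exact absurd (hm h.le) (not_le.mpr (lt_of_lt_of_le hy hx))
  have hmem : u ≤ F (genInv F u) :=
    (isClosed_le continuous_const hc).csInf_mem hne hbdd
  exact ⟨fun h => hmem.trans (hm h), fun h => csInf_le hbdd h⟩

namespace IsStrictCDF

variable {F : ℝ → ℝ}

lemma genInv_le_iff (hF : IsStrictCDF F) {u : ℝ} (hu : u ∈ Ioo (0 : ℝ) 1) (b : ℝ) :
    genInv F u ≤ b ↔ u ≤ F b :=
  PartialBayes.genInv_le_iff hF.continuous hF.strictMono.monotone hF.tendsto_atBot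
    hF.tendsto_atTop hu b

lemma exists_eq (hF : IsStrictCDF F) {u : ℝ} (hu : u ∈ Ioo (0 : ℝ) 1) : ∃ x, F x = u := by
  obtain ⟨a, ha⟩ := (hF.tendsto_atBot.eventually (Iio_mem_nhds hu.1)).exists
  obtain ⟨b, hb⟩ := (hF.tendsto_atTop.eventually (Ioi_mem_nhds hu.2)).exists
  exact mem_range_of_exists_le_of_exists_ge hF.continuous ⟨a, le_of_lt ha⟩ ⟨b, le_of_lt hb⟩

lemma apply_genInv (hF : IsStrictCDF F) {u : ℝ} (hu : u ∈ Ioo (0 : ℝ) 1) :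
    F (genInv F u) = u := by
  obtain ⟨x, hx⟩ := hF.exists_eq hu
  refine le_antisymm ?_ ((hF.genInv_le_iff hu _).1 le_rfl)
  calc F (genInv F u) ≤ F x := hF.strictMono.monotone ((hF.genInv_le_iff hu _).2 hx.ge)
    _ = u := hx

lemma le_genInv_iff (hF : IsStrictCDF F) {u : ℝ} (hu : u ∈ Ioo (0 : ℝ) 1) (b : ℝ) :
    b ≤ genInv F u ↔ F b ≤ u := by
  rw [← hF.strictMono.le_iff_le, hF.apply_genInv hu]

lemma pos (hF : IsStrictCDF F) (x : ℝ) : 0 < F x :=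
  lt_of_le_of_lt (hF.strictMono.monotone.le_of_tendsto hF.tendsto_atBot (x - 1))
    (hF.strictMono (by linarith))

lemma lt_one (hF : IsStrictCDF F) (x : ℝ) : F x < 1 :=
  lt_of_lt_of_le (hF.strictMono (by linarith))
    (hF.strictMono.monotone.ge_of_tendsto hF.tendsto_atTop (x + 1))

end IsStrictCDF

/-- The function equal to `U` where `U < 1/2`, to `L` where `L > 1/2`, and to `1/2` elsewhere. -/
noncomputable def starOf (L U : ℝ → ℝ) (z : ℝ) : ℝ :=
  if U z < 1 / 2 then U z else if 1 / 2 < L z then L z else 1 / 2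

section Star

variable {L U : ℝ → ℝ}

lemma starOf_eq_max (hLU : ∀ z, L z ≤ U z) : starOf L U = fun z => max (min (U z) (1 / 2)) (L z) := by
  funext z
  have := hLU z
  unfold starOf
  split_ifs with h1 h2
  · rw [min_eq_left h1.le, max_eq_left this]
  · rw [min_eq_right (not_lt.mp h1), max_eq_right h2.le]
  · rw [min_eq_right (not_lt.mp h1), max_eq_left (not_lt.mp h2)]

lemma continuous_starOf (hL : IsStrictCDF L) (hU : IsStrictCDF U) (hLU : ∀ z, L z ≤ U z) :
    Continuous (starOf L U) := by
  rw [starOf_eq_max hLU]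
  exact (hU.continuous.min continuous_const).max hL.continuous

lemma monotone_starOf (hL : IsStrictCDF L) (hU : IsStrictCDF U) (hLU : ∀ z, L z ≤ U z) :
    Monotone (starOf L U) := by
  rw [starOf_eq_max hLU]
  exact (hU.strictMono.monotone.min monotone_const).max hL.strictMono.monotone

lemma tendsto_starOf_atBot (hL : IsStrictCDF L) (hU : IsStrictCDF U) (hLU : ∀ z, L z ≤ U z) :
    Tendsto (starOf L U) atBot (𝓝 0) := by
  rw [starOf_eq_max hLU]
  have := (hU.tendsto_atBot.min (tendsto_const_nhds (x := (1 / 2 : ℝ)))).max hL.tendsto_atBot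
  norm_num at this ⊢
  exact this

lemma tendsto_starOf_atTop (hL : IsStrictCDF L) (hU : IsStrictCDF U) (hLU : ∀ z, L z ≤ U z) :
    Tendsto (starOf L U) atTop (𝓝 1) := by
  rw [starOf_eq_max hLU]
  have := (hU.tendsto_atTop.min (tendsto_const_nhds (x := (1 / 2 : ℝ)))).max hL.tendsto_atTop
  norm_num at this ⊢
  exact this

lemma exists_measure_cdf_eq_starOf (hL : IsStrictCDF L) (hU : IsStrictCDF U)
    (hLU : ∀ z, L z ≤ U z) :
    ∃ ν : Measure ℝ, IsProbabilityMeasure ν ∧ ∀ z, cdf ν z = starOf L U z := by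
  let f : StieltjesFunction ℝ :=
    { toFun := starOf L U
      mono' := monotone_starOf hL hU hLU
      right_continuous' := fun x => (continuous_starOf hL hU hLU).continuousWithinAt }
  have h0 : Tendsto f atBot (𝓝 0) := tendsto_starOf_atBot hL hU hLU
  have h1 : Tendsto f atTop (𝓝 1) := tendsto_starOf_atTop hL hU hLU
  refine ⟨f.measure, f.isProbabilityMeasure h0 h1, fun z => ?_⟩
  rw [cdf_measure_stieltjesFunction f h0 h1]

lemma stochBoundedInTails_starOf {F : ℝ → ℝ} (hF : IsStrictCDF F) (hLF : ∀ z, L z ≤ F z)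
    (hFU : ∀ z, F z ≤ U z) : StochBoundedInTails F (starOf L U) := by
  have hhalf : (1 / 2 : ℝ) ∈ Ioo (0 : ℝ) 1 := by norm_num
  constructor
  · intro z hz
    -- left of the median of `F` the lower envelope is below `1/2`, so `starOf` is above `F`
    have h1 : F z < 1 / 2 := by
      by_contra! h
      exact absurd ((hF.genInv_le_iff hhalf z).2 h) (not_le.mpr hz)
    have := hLF z
    unfold starOf
    split_ifs <;> linarith [hFU z]
  · intro z hz
    have h1 : 1 / 2 ≤ F z := (hF.genInv_le_iff hhalf z).1 hz.le
    unfold starOf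
    split_ifs <;> linarith [hFU z, hLF z]

lemma exists_le_of_mem_convexHull {Q : Set ℝ} {b : ℝ} (h : b ∈ convexHull ℝ Q) :
    ∃ q ∈ Q, q ≤ b := by
  by_contra! hq
  exact lt_irrefl b (convexHull_min (fun q hq' => hq q hq') (convex_Ioi b) h)

lemma exists_ge_of_mem_convexHull {Q : Set ℝ} {b : ℝ} (h : b ∈ convexHull ℝ Q) :
    ∃ q ∈ Q, b ≤ q := by
  by_contra! hq
  exact lt_irrefl b (convexHull_min (fun q hq' => hq q hq') (convex_Iio b) h)

/-- A point `b` is covered by the predictive set at `u` exactly when `u` is far enough from `1/2`;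
the critical distance depends on `b` only through the two envelopes. -/
lemma mem_predictiveSet_starOf_iff (hL : IsStrictCDF L) (hU : IsStrictCDF U)
    (hLU : ∀ z, L z ≤ U z) {u : ℝ} (hu : u ∈ Ioo (0 : ℝ) 1) (b : ℝ) :
    b ∈ predictiveSet (starOf L U) u ↔
      1 / 2 - min (U b) (min (1 - L b) (1 / 2)) < |u - 1 / 2| := by
  have hG := continuous_starOf hL hU hLU
  have hgi : ∀ {v : ℝ}, v ∈ Ioo (0 : ℝ) 1 → ∀ z, genInv (starOf L U) v ≤ z ↔ v ≤ starOf L U z :=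
    fun hv z => genInv_le_iff hG (monotone_starOf hL hU hLU)
      (tendsto_starOf_atBot hL hU hLU) (tendsto_starOf_atTop hL hU hLU) hv z
  have hGmax : ∀ z, starOf L U z = max (min (U z) (1 / 2)) (L z) := fun z => by
    rw [starOf_eq_max hLU]
  set r := |u - 1 / 2| with hr
  have hr2 : r < 1 / 2 := by
    rw [hr, abs_lt]
    constructor <;> linarith [hu.1, hu.2]
  have hUpos := hU.pos b
  have hL1 := hL.lt_one b
  have hLUb := hLU b
  have hGb := hGmax b
  have key : 1 / 2 - min (U b) (min (1 - L b) (1 / 2)) < r ↔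
      0 < r ∧ 1 / 2 - r < U b ∧ L b < 1 / 2 + r := by
    rw [sub_lt_comm, lt_min_iff, lt_min_iff]
    constructor
    · rintro ⟨h1, h2, h3⟩; refine ⟨?_, ?_, ?_⟩ <;> linarith
    · rintro ⟨h1, h2, h3⟩; refine ⟨?_, ?_, ?_⟩ <;> linarith
  rw [key]
  constructor
  · intro hb
    obtain ⟨_, ⟨v, hv, hvr, rfl⟩, hvb⟩ := exists_le_of_mem_convexHull hb
    obtain ⟨_, ⟨v', hv', hvr', rfl⟩, hvb'⟩ := exists_ge_of_mem_convexHull hb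
    have hr0 : 0 < r := lt_of_le_of_lt (abs_nonneg _) hvr
    rw [← hr] at hvr hvr'
    rw [hgi hv] at hvb
    rw [abs_lt] at hvr hvr'
    refine ⟨hr0, ?_, ?_⟩
    · have : starOf L U b ≤ U b := by
        rw [hGb]; exact max_le (min_le_left _ _) hLUb
      linarith
    · by_contra! hcon
      obtain ⟨x, hx⟩ := hL.exists_eq hv'
      have hxb : x < b := by
        rw [← hL.strictMono.lt_iff_lt, hx]; linarith
      have : genInv (starOf L U) v' ≤ x := by
        rw [hgi hv', hGmax x, ← hx]; exact le_max_right _ _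
      linarith
  · rintro ⟨hr0, h1, h2⟩
    -- a quantile to the left of `b`
    have hleft : ∃ q ∈ {z | ∃ u' ∈ Ioo (0 : ℝ) 1, |u' - 1 / 2| < r ∧
        genInv (starOf L U) u' = z}, q ≤ b := by
      have hmem : min (U b) (1 / 2) ∈ Ioo (0 : ℝ) 1 :=
        ⟨lt_min hUpos (by norm_num), lt_of_le_of_lt (min_le_right _ _) (by norm_num)⟩
      refine ⟨_, ⟨min (U b) (1 / 2), hmem, ?_, rfl⟩, ?_⟩
      · rw [abs_lt]
        constructor
        · have := lt_min h1 (show 1 / 2 - r < 1 / 2 by linarith); linarith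
        · have := min_le_right (U b) (1 / 2); linarith
      · rw [hgi hmem, hGb]; exact le_max_left _ _
    -- a quantile to the right of `b`
    have hright : ∃ q ∈ {z | ∃ u' ∈ Ioo (0 : ℝ) 1, |u' - 1 / 2| < r ∧
        genInv (starOf L U) u' = z}, b ≤ q := by
      by_cases hLb : 1 / 2 < L b
      · have hmem : L b ∈ Ioo (0 : ℝ) 1 := ⟨hL.pos b, hL1⟩
        refine ⟨_, ⟨L b, hmem, ?_, rfl⟩, ?_⟩
        · rw [abs_lt]; constructor <;> linarith
        · by_contra! hcon
          have h3 := (hgi hmem _).1 le_rfl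
          rw [hGmax] at h3
          have h4 := hL.strictMono hcon
          have h5 := min_le_right (U (genInv (starOf L U) (L b))) (1 / 2)
          rcases le_max_iff.1 h3 with h | h <;> linarith
      · have hmem : 1 / 2 + r / 2 ∈ Ioo (0 : ℝ) 1 := ⟨by linarith, by linarith⟩
        refine ⟨_, ⟨1 / 2 + r / 2, hmem, ?_, rfl⟩, ?_⟩
        · rw [abs_lt]; constructor <;> linarith
        · by_contra! hcon
          have h3 := (hgi hmem b).1 hcon.le
          have h5 := min_le_right (U b) (1 / 2)
          rw [hGb] at h3
          rcases le_max_iff.1 h3 with h | h <;> linarith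
    obtain ⟨q, hq, hqb⟩ := hleft
    obtain ⟨q', hq', hqb'⟩ := hright
    refine segment_subset_convexHull (𝕜 := ℝ) hq hq' ?_
    rw [segment_eq_Icc (hqb.trans hqb')]
    exact ⟨hqb, hqb'⟩

/-- The distance of a uniform variable to `1/2` exceeds `1/2 - p` with probability `2p`. -/
lemma measureReal_abs_sub_half_le {p : ℝ} (hp0 : 0 < p) (hp : p ≤ 1 / 2) :
    ((volume : Measure ℝ).restrict (Ioo 0 1)).real {u | |u - 1 / 2| ≤ 1 / 2 - p} = 1 - 2 * p := by
  have : {u : ℝ | |u - 1 / 2| ≤ 1 / 2 - p} = Icc p (1 - p) := by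
    ext u; rw [mem_Icc]; change |u - 1 / 2| ≤ 1 / 2 - p ↔ _; rw [abs_le]
    constructor <;> rintro ⟨h1, h2⟩ <;> constructor <;> linarith
  rw [this, measureReal_restrict_apply measurableSet_Icc, inter_eq_left.2, Real.volume_real_Icc_of_le]
  · ring
  · linarith
  · intro u hu; exact ⟨by linarith [hu.1], by linarith [hu.2]⟩

/-- Uniform variables closer to `1/2` than a critical distance give predictive sets missing `b`,
so the plausibility is twice the smaller tail. -/
lemma plausibility_starOf (hL : IsStrictCDF L) (hU : IsStrictCDF U) (hLU : ∀ z, L z ≤ U z)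
    (b : ℝ → ℝ) (η : ℝ) :
    plausibility (starOf L U) b η = min 1 (min (2 * (1 - L (b η))) (2 * U (b η))) := by
  set p := min (U (b η)) (min (1 - L (b η)) (1 / 2)) with hp
  have hset : ((volume : Measure ℝ).restrict (Ioo 0 1)).real
      {u | (⋃ s ∈ predictiveSet (starOf L U) u, {η' | b η' = s}) ⊆ Iio η ∪ Ioi η} =
      ((volume : Measure ℝ).restrict (Ioo 0 1)).real {u | |u - 1 / 2| ≤ 1 / 2 - p} := by
    apply measureReal_congr
    filter_upwards [ae_restrict_mem measurableSet_Ioo] with u hu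
    have h1 : ((⋃ s ∈ predictiveSet (starOf L U) u, {η' | b η' = s}) ⊆ Iio η ∪ Ioi η) ↔
        b η ∉ predictiveSet (starOf L U) u := by
      constructor
      · intro h hb
        have : η ∈ Iio η ∪ Ioi η := h (mem_iUnion₂.2 ⟨b η, hb, rfl⟩)
        simp at this
      · intro hb η' hη'
        obtain ⟨s, hs, rfl⟩ := mem_iUnion₂.1 hη'
        rcases lt_trichotomy η' η with h | h | h
        · exact Or.inl h
        · exact absurd (h ▸ hs) hb
        · exact Or.inr h
    rw [mem_predictiveSet_starOf_iff hL hU hLU hu, not_lt] at h1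
    exact propext h1
  have hp0 : 0 < p := lt_min (hU.pos _) (lt_min (by linarith [hL.lt_one (b η)]) (by norm_num))
  have hp2 : p ≤ 1 / 2 := (min_le_right _ _).trans (min_le_right _ _)
  rw [plausibility, hset, measureReal_abs_sub_half_le hp0 hp2, hp]
  rcases le_total (U (b η)) (1 - L (b η)) with h1 | h1 <;>
  rcases le_total (U (b η)) (1 / 2) with h2 | h2 <;>
  rcases le_total (1 - L (b η)) (1 / 2) with h3 | h3 <;>
  grind

end Star

/-- A family of functions with values in `[0,1]` which is uniformly Lipschitz, increases uniformly
between any two points, and has uniform tails. -/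
structure IsUniformFamily {ι : Type*} (F : ι → ℝ → ℝ) : Prop where
  mem_Icc : ∀ i s, F i s ∈ Icc (0 : ℝ) 1
  lipschitz : ∃ C : ℝ, ∀ i s t, s ≤ t → F i t ≤ F i s + C * (t - s)
  increase : ∀ s t, s < t → ∃ δ > 0, ∀ i, F i s + δ ≤ F i t
  lower_tail : ∃ B : ℝ → ℝ, Tendsto B atBot (𝓝 0) ∧ ∀ s ≤ 0, ∀ i, F i s ≤ B s
  upper_tail : ∃ B : ℝ → ℝ, Tendsto B atTop (𝓝 1) ∧ ∀ s, 0 ≤ s → ∀ i, B s ≤ F i s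

namespace IsUniformFamily

variable {ι : Type*} {F : ι → ℝ → ℝ}

/-- A one-member uniform family consists of a continuous strictly increasing distribution
function. -/
lemma isStrictCDF_of_unique {G : ℝ → ℝ} (h : IsUniformFamily fun _ : Unit => G) :
    IsStrictCDF G := by
  have hmono : StrictMono G := fun s t hst => by
    obtain ⟨δ, hδ, hG⟩ := h.increase s t hst
    linarith [hG ()]
  refine ⟨?_, hmono, ?_, ?_⟩
  · obtain ⟨C, hC⟩ := h.lipschitz
    have : LipschitzWith C.toNNReal G := by
      refine LipschitzWith.of_le_add_mul _ fun x y => ?_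
      rw [Real.dist_eq]
      have hCC : C ≤ C.toNNReal := Real.le_coe_toNNReal C
      rcases le_total y x with hyx | hxy
      · calc G x ≤ G y + C * (x - y) := hC () y x hyx
          _ ≤ _ := by
            rw [abs_of_nonneg (sub_nonneg.2 hyx)]
            gcongr
      · have : 0 ≤ (C.toNNReal : ℝ) * |x - y| := by positivity
        linarith [hmono.monotone hxy]
    exact this.continuous
  · obtain ⟨B, hB, hGB⟩ := h.lower_tail
    exact tendsto_of_tendsto_of_tendsto_of_le_of_le' tendsto_const_nhds hB
      (Eventually.of_forall fun s => (h.mem_Icc () s).1)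
      ((eventually_le_atBot 0).mono fun s hs => hGB s hs ())
  · obtain ⟨B, hB, hGB⟩ := h.upper_tail
    exact tendsto_of_tendsto_of_tendsto_of_le_of_le' hB tendsto_const_nhds
      ((eventually_ge_atTop 0).mono fun s hs => hGB s hs ())
      (Eventually.of_forall fun s => (h.mem_Icc () s).2)

lemma isStrictCDF (h : IsUniformFamily F) (i : ι) : IsStrictCDF (F i) := by
  refine isStrictCDF_of_unique ⟨fun _ => h.mem_Icc i, ?_, ?_, ?_, ?_⟩
  · obtain ⟨C, hC⟩ := h.lipschitz
    exact ⟨C, fun _ => hC i⟩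
  · intro s t hst
    obtain ⟨δ, hδ, hF⟩ := h.increase s t hst
    exact ⟨δ, hδ, fun _ => hF i⟩
  · obtain ⟨B, hB, hF⟩ := h.lower_tail
    exact ⟨B, hB, fun s hs _ => hF s hs i⟩
  · obtain ⟨B, hB, hF⟩ := h.upper_tail
    exact ⟨B, hB, fun s hs _ => hF s hs i⟩

lemma bddBelow (h : IsUniformFamily F) (s : ℝ) : BddBelow (range fun i => F i s) :=
  ⟨0, by rintro _ ⟨i, rfl⟩; exact (h.mem_Icc i s).1⟩

lemma bddAbove (h : IsUniformFamily F) (s : ℝ) : BddAbove (range fun i => F i s) :=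
  ⟨1, by rintro _ ⟨i, rfl⟩; exact (h.mem_Icc i s).2⟩

/-- The uniformity passes the Lipschitz bound, the strict growth and the tails on to the infimum,
which is therefore a continuous strictly increasing distribution function. -/
lemma isStrictCDF_iInf [Nonempty ι] (h : IsUniformFamily F) :
    IsStrictCDF fun s => ⨅ i, F i s := by
  have hle : ∀ i s, ⨅ i, F i s ≤ F i s := fun i s => ciInf_le (h.bddBelow s) i
  obtain ⟨i₀⟩ := ‹Nonempty ι›
  have : Nonempty ι := ⟨i₀⟩
  refine isStrictCDF_of_unique ⟨fun _ s => ⟨le_ciInf fun i => (h.mem_Icc i s).1,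
    (hle i₀ s).trans (h.mem_Icc i₀ s).2⟩, ?_, ?_, ?_, ?_⟩
  · obtain ⟨C, hC⟩ := h.lipschitz
    refine ⟨C, fun _ s t hst => ?_⟩
    rw [← sub_le_iff_le_add]
    refine le_ciInf fun i => ?_
    linarith [hC i s t hst, hle i t]
  · intro s t hst
    obtain ⟨δ, hδ, hF⟩ := h.increase s t hst
    exact ⟨δ, hδ, fun _ => le_ciInf fun i => by linarith [hF i, hle i s]⟩
  · obtain ⟨B, hB, hF⟩ := h.lower_tail
    exact ⟨B, hB, fun s hs _ => (hle i₀ s).trans (hF s hs i₀)⟩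
  · obtain ⟨B, hB, hF⟩ := h.upper_tail
    exact ⟨B, hB, fun s hs _ => le_ciInf fun i => hF s hs i⟩

lemma isStrictCDF_iSup [Nonempty ι] (h : IsUniformFamily F) :
    IsStrictCDF fun s => ⨆ i, F i s := by
  have hle : ∀ i s, F i s ≤ ⨆ i, F i s := fun i s => le_ciSup (h.bddAbove s) i
  obtain ⟨i₀⟩ := ‹Nonempty ι›
  have : Nonempty ι := ⟨i₀⟩
  refine isStrictCDF_of_unique ⟨fun _ s => ⟨(h.mem_Icc i₀ s).1.trans (hle i₀ s),
    ciSup_le fun i => (h.mem_Icc i s).2⟩, ?_, ?_, ?_, ?_⟩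
  · obtain ⟨C, hC⟩ := h.lipschitz
    refine ⟨C, fun _ s t hst => ciSup_le fun i => ?_⟩
    linarith [hC i s t hst, hle i s]
  · intro s t hst
    obtain ⟨δ, hδ, hF⟩ := h.increase s t hst
    refine ⟨δ, hδ, fun _ => ?_⟩
    rw [← le_sub_iff_add_le]
    exact ciSup_le fun i => by linarith [hF i, hle i t]
  · obtain ⟨B, hB, hF⟩ := h.lower_tail
    exact ⟨B, hB, fun s hs _ => ciSup_le fun i => hF s hs i⟩
  · obtain ⟨B, hB, hF⟩ := h.upper_tail
    exact ⟨B, hB, fun s hs _ => (hF s hs i₀).trans (hle i₀ s)⟩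

end IsUniformFamily

/-! ### Gamma distributions -/

lemma lintegral_eq_mul_lintegral_comp_mul {a : ℝ} (ha : 0 < a) {f : ℝ → ENNReal}
    (hf : Measurable f) : ∫⁻ x, f x = ENNReal.ofReal a * ∫⁻ x, f (a * x) := by
  conv_lhs => rw [← Real.smul_map_volume_mul_left ha.ne', lintegral_smul_measure,
    lintegral_map hf (by fun_prop), abs_of_pos ha]
  rfl

lemma measurable_gammaPDF (a r : ℝ) : Measurable (gammaPDF a r) :=
  (measurable_gammaPDFReal a r).ennreal_ofReal

lemma ae_pos_gammaMeasure (a r : ℝ) : ∀ᵐ x ∂(gammaMeasure a r), 0 < x := by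
  rw [gammaMeasure, ae_withDensity_iff (measurable_gammaPDF a r)]
  filter_upwards [Measure.ae_ne volume (0 : ℝ)] with x hx0 hx
  by_contra! h
  exact hx (gammaPDF_of_neg (lt_of_le_of_ne h hx0))

lemma integral_gammaMeasure {E : Type*} [NormedAddCommGroup E] [NormedSpace ℝ E] {a r : ℝ}
    (ha : 0 < a) (hr : 0 < r) (f : ℝ → E) :
    ∫ x, f x ∂(gammaMeasure a r) = ∫ x in Ioi (0 : ℝ), gammaPDFReal a r x • f x := by
  rw [gammaMeasure, integral_withDensity_eq_integral_toReal_smul (measurable_gammaPDF a r)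
    (ae_of_all _ fun x => ENNReal.ofReal_lt_top)]
  have : ∀ x, (gammaPDF a r x).toReal = gammaPDFReal a r x := fun x =>
    ENNReal.toReal_ofReal (gammaPDFReal_nonneg ha hr x)
  simp_rw [this]
  rw [← integral_Ici_eq_integral_Ioi, setIntegral_eq_integral_of_forall_compl_eq_zero]
  intro x hx
  simp [gammaPDFReal, show ¬ 0 ≤ x from hx]

lemma integrable_gammaMeasure_iff {a r : ℝ} (ha : 0 < a) (hr : 0 < r) (f : ℝ → ℝ) :
    Integrable f (gammaMeasure a r) ↔ Integrable fun x => gammaPDFReal a r x * f x := by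
  rw [gammaMeasure, integrable_withDensity_iff_integrable_smul' (measurable_gammaPDF a r)
    (ae_of_all _ fun x => ENNReal.ofReal_lt_top)]
  have : ∀ x, (gammaPDF a r x).toReal = gammaPDFReal a r x := fun x =>
    ENNReal.toReal_ofReal (gammaPDFReal_nonneg ha hr x)
  simp_rw [this, smul_eq_mul]

/-- Multiplying a gamma density by a power gives a multiple of a gamma density with another
shape. -/
lemma gammaPDFReal_mul_rpow {a r s x : ℝ} (ha : 0 < a) (hr : 0 < r) (hs : 0 < a + s)
    (hx : 0 < x) : gammaPDFReal a r x * x ^ s =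
      Real.Gamma (a + s) / (Real.Gamma a * r ^ s) * gammaPDFReal (a + s) r x := by
  have h1 := (Real.Gamma_pos_of_pos ha).ne'
  have h2 := (Real.Gamma_pos_of_pos hs).ne'
  have h3 := (Real.rpow_pos_of_pos hr s).ne'
  simp only [gammaPDFReal, hx.le, if_true]
  rw [show a + s - 1 = (a - 1) + s by ring, Real.rpow_add hx, Real.rpow_add hr]
  field_simp

lemma integrable_gammaPDFReal {a r : ℝ} (ha : 0 < a) (hr : 0 < r) :
    Integrable (gammaPDFReal a r) := by
  have := isProbabilityMeasure_gammaMeasure ha hr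
  simpa using (integrable_gammaMeasure_iff ha hr fun _ => 1).1 (integrable_const 1)

lemma integral_gammaPDFReal {a r : ℝ} (ha : 0 < a) (hr : 0 < r) :
    ∫ x in Ioi (0 : ℝ), gammaPDFReal a r x = 1 := by
  have := isProbabilityMeasure_gammaMeasure ha hr
  have h := integral_gammaMeasure ha hr fun _ => (1 : ℝ)
  simpa using h.symm

lemma integrable_rpow_gammaMeasure {a r s : ℝ} (ha : 0 < a) (hr : 0 < r) (hs : 0 < a + s) :
    Integrable (fun x => x ^ s) (gammaMeasure a r) := by
  rw [integrable_gammaMeasure_iff ha hr]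
  refine ((integrable_gammaPDFReal hs hr).const_mul
    (Real.Gamma (a + s) / (Real.Gamma a * r ^ s))).congr ?_
  filter_upwards [Measure.ae_ne volume (0 : ℝ)] with x hx0
  rcases lt_or_gt_of_ne hx0 with hx | hx
  · simp [gammaPDFReal, not_le.2 hx]
  · rw [gammaPDFReal_mul_rpow ha hr hs hx]

lemma integral_rpow_gammaMeasure {a r s : ℝ} (ha : 0 < a) (hr : 0 < r) (hs : 0 < a + s) :
    ∫ x, x ^ s ∂(gammaMeasure a r) = Real.Gamma (a + s) / (Real.Gamma a * r ^ s) := by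
  rw [integral_gammaMeasure ha hr, setIntegral_congr_fun measurableSet_Ioi
    (g := fun x => Real.Gamma (a + s) / (Real.Gamma a * r ^ s) * gammaPDFReal (a + s) r x)
    (fun x hx => by simpa using gammaPDFReal_mul_rpow ha hr hs hx),
    integral_const_mul, integral_gammaPDFReal hs hr, mul_one]

lemma scaledChiSqPDF_eq {k : ℝ} (hk : 0 < k) (x : ℝ) :
    scaledChiSqPDF k x = gammaPDFReal (k / 2) (k / 2) x := by
  unfold scaledChiSqPDF gammaPDFReal
  rcases lt_trichotomy x 0 with hx | rfl | hx
  · rw [if_neg (not_le.2 (mul_neg_of_pos_of_neg hk hx)), if_neg (not_le.2 hx), mul_zero]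
  · simp only [mul_zero, le_refl, if_true]
    by_cases h : k / 2 - 1 = 0
    · have h2 : k = 2 := by linarith
      subst h2; norm_num
    · rw [Real.zero_rpow h]; simp
  · rw [if_pos (mul_pos hk hx).le, if_pos hx.le, Real.mul_rpow hk.le hx.le,
      show k / 2 = k * (1 / 2) by ring, Real.mul_rpow (x := k) hk.le (by norm_num),
      show k ^ (k * (1 / 2)) = k ^ (k * (1 / 2) - 1) * k by
        rw [Real.rpow_sub_one hk.ne']; field_simp]
    rw [show 1 / 2 * (k * x) = k * (1 / 2) * x by ring]
    ring

/-- The distribution `χ²_k / k`. -/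
noncomputable abbrev scaledChiSq (k : ℝ) : Measure ℝ := gammaMeasure (k / 2) (k / 2)

lemma isProbabilityMeasure_scaledChiSq {k : ℝ} (hk : 0 < k) :
    IsProbabilityMeasure (scaledChiSq k) :=
  isProbabilityMeasure_gammaMeasure (by positivity) (by positivity)

lemma integrable_sqrt_scaledChiSq {k : ℝ} (hk : 0 < k) :
    Integrable (fun x => √x) (scaledChiSq k) := by
  simp_rw [Real.sqrt_eq_rpow]
  exact integrable_rpow_gammaMeasure (by positivity) (by positivity) (by positivity)

lemma integrable_inv_sqrt_scaledChiSq {k : ℝ} (hk : 1 < k) :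
    Integrable (fun x => (√x)⁻¹) (scaledChiSq k) := by
  refine (integrable_rpow_gammaMeasure (a := k / 2) (r := k / 2) (s := -(1 / 2)) (by linarith)
    (by linarith) (by linarith)).congr ?_
  filter_upwards [ae_pos_gammaMeasure (k / 2) (k / 2)] with x hx
  rw [Real.rpow_neg hx.le, Real.sqrt_eq_rpow]

/-- The moments of order `1/2` and `-1/2` are proportional by the recursion of the Gamma
function. -/
lemma integral_sqrt_scaledChiSq {k : ℝ} (hk : 1 < k) :
    ∫ x, √x ∂(scaledChiSq k) = (k - 1) / k * ∫ x, (√x)⁻¹ ∂(scaledChiSq k) := by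
  have h1 : ∫ x, (√x)⁻¹ ∂(scaledChiSq k) = ∫ x, x ^ (-(1 / 2) : ℝ) ∂(scaledChiSq k) := by
    apply integral_congr_ae
    filter_upwards [ae_pos_gammaMeasure (k / 2) (k / 2)] with x hx
    rw [Real.rpow_neg hx.le, Real.sqrt_eq_rpow]
  simp_rw [h1, Real.sqrt_eq_rpow]
  have hk2 : 0 < k / 2 := by linarith
  have hk3 : k / 2 + -(1 / 2) ≠ 0 := by linarith
  rw [integral_rpow_gammaMeasure hk2 hk2 (by linarith),
    integral_rpow_gammaMeasure hk2 hk2 (by linarith),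
    show k / 2 + 1 / 2 = (k / 2 + -(1 / 2)) + 1 by ring, Real.Gamma_add_one hk3,
    Real.rpow_neg hk2.le]
  have h2 := (Real.Gamma_pos_of_pos hk2).ne'
  have h3 := (Real.rpow_pos_of_pos hk2 (1 / 2)).ne'
  have h4 : (k / 2) ^ (1 / 2 : ℝ) * (k / 2) ^ (1 / 2 : ℝ) = k / 2 := by
    rw [← Real.rpow_add hk2]; norm_num
  have hk0 : k ≠ 0 := by linarith
  field_simp
  rw [pow_two, h4]
  ring

lemma integrable_sub_one_sq_scaledChiSq {k : ℝ} (hk : 0 < k) :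
    Integrable (fun x => (x - 1) ^ 2) (scaledChiSq k) := by
  have hk2 : 0 < k / 2 := by linarith
  have := isProbabilityMeasure_scaledChiSq hk
  have h1 : Integrable (fun x : ℝ => x ^ (1 : ℝ)) (scaledChiSq k) :=
    integrable_rpow_gammaMeasure hk2 hk2 (by linarith)
  have h2 : Integrable (fun x : ℝ => x ^ (2 : ℝ)) (scaledChiSq k) :=
    integrable_rpow_gammaMeasure hk2 hk2 (by linarith)
  simp_rw [Real.rpow_one] at h1
  simp_rw [Real.rpow_two] at h2
  refine ((h2.sub (h1.const_mul 2)).add (integrable_const 1)).congr (ae_of_all _ fun x => ?_)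
  simp only [Pi.add_apply, Pi.sub_apply]
  ring

lemma integral_sub_one_sq_scaledChiSq {k : ℝ} (hk : 0 < k) :
    ∫ x, (x - 1) ^ 2 ∂(scaledChiSq k) = 2 / k := by
  have hk2 : 0 < k / 2 := by linarith
  have := isProbabilityMeasure_scaledChiSq hk
  have h1 : Integrable (fun x : ℝ => x ^ (1 : ℝ)) (scaledChiSq k) :=
    integrable_rpow_gammaMeasure hk2 hk2 (by linarith)
  have h2 : Integrable (fun x : ℝ => x ^ (2 : ℝ)) (scaledChiSq k) :=
    integrable_rpow_gammaMeasure hk2 hk2 (by linarith)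
  have e1 := integral_rpow_gammaMeasure hk2 hk2 (show 0 < k / 2 + 1 by linarith)
  have e2 := integral_rpow_gammaMeasure hk2 hk2 (show 0 < k / 2 + 2 by linarith)
  have : ∀ x : ℝ, (x - 1) ^ 2 = x ^ (2 : ℝ) - 2 * x ^ (1 : ℝ) + 1 := fun x => by
    rw [Real.rpow_two, Real.rpow_one]; ring
  simp_rw [this]
  have hsub : Integrable (fun x : ℝ => x ^ (2 : ℝ) - 2 * x ^ (1 : ℝ)) (scaledChiSq k) :=
    h2.sub (h1.const_mul 2)
  rw [integral_add hsub (integrable_const 1),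
    integral_sub h2 (h1.const_mul 2), integral_const_mul, e1, e2, integral_const]
  have h3 := (Real.Gamma_pos_of_pos hk2).ne'
  rw [show k / 2 + 2 = (k / 2 + 1) + 1 by ring, Real.Gamma_add_one (by linarith),
    Real.Gamma_add_one (by linarith), Real.rpow_two, Real.rpow_one]
  have hk0 : k ≠ 0 := by linarith
  simp only [probReal_univ, smul_eq_mul]
  field_simp
  ring

/-! ### The joint law of the ratio and the sum of squares -/

lemma studentTPDF_nonneg {K : ℝ} (hK : 0 < K) (x : ℝ) : 0 ≤ studentTPDF K x := by
  unfold studentTPDF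
  have h1 := Real.Gamma_pos_of_pos (show 0 < (K + 1) / 2 by linarith)
  have h2 := Real.Gamma_pos_of_pos (show 0 < K / 2 by linarith)
  positivity

lemma studentTPDF_pos {K : ℝ} (hK : 0 < K) (x : ℝ) : 0 < studentTPDF K x := by
  unfold studentTPDF
  have h1 := Real.Gamma_pos_of_pos (show 0 < (K + 1) / 2 by linarith)
  have h2 := Real.Gamma_pos_of_pos (show 0 < K / 2 by linarith)
  have := Real.pi_pos
  positivity

lemma measurable_studentTPDF (K : ℝ) : Measurable (studentTPDF K) := by
  unfold studentTPDF
  fun_prop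

lemma volume_absolutelyContinuous_studentTMeasure {K : ℝ} (hK : 0 < K) :
    (volume : Measure ℝ) ≪ studentTMeasure K :=
  withDensity_absolutelyContinuous' (measurable_studentTPDF K).ennreal_ofReal.aemeasurable
    (ae_of_all _ fun x => (ENNReal.ofReal_pos.2 (studentTPDF_pos hK x)).ne')

instance sFinite_studentTMeasure (K : ℝ) : SFinite (studentTMeasure K) := by
  unfold studentTMeasure; infer_instance

instance sFinite_gammaMeasure (a r : ℝ) : SFinite (gammaMeasure a r) := by
  unfold gammaMeasure; infer_instance

/-- The identity of densities behind the independence of the Student ratio `h` and the rescaled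
sum of squares `y`, with the two Jacobians. -/
lemma density_ratio_identity {K h y : ℝ} (hK : 0 < K) (hy : 0 < y) :
    (K + 1) * K / (K + h ^ 2) * gammaPDFReal (K / 2) (1 / 2) ((K + 1) * K / (K + h ^ 2) * y) *
      (√((K + 1) * K / (K + h ^ 2) * y / K) *
        gaussianPDFReal 0 1 (√((K + 1) * K / (K + h ^ 2) * y / K) * h)) =
    studentTPDF K h * gammaPDFReal ((K + 1) / 2) ((K + 1) / 2) y := by
  have hKh : 0 < K + h ^ 2 := by positivity
  set a := (K + 1) * K / (K + h ^ 2) with ha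
  have ha0 : 0 < a := by positivity
  have hay : 0 < a * y := by positivity
  have hg1 := (Real.Gamma_pos_of_pos (show 0 < (K + 1) / 2 by linarith)).ne'
  have hg2 := (Real.Gamma_pos_of_pos (show 0 < K / 2 by linarith)).ne'
  simp only [gammaPDFReal, gaussianPDFReal, studentTPDF, hay.le, hy.le, if_true, NNReal.coe_one,
    mul_one, sub_zero]
  rw [mul_pow, Real.sq_sqrt (by positivity)]
  -- the exponential factors
  have hexp : Real.exp (-(1 / 2 * (a * y))) * Real.exp (-(a * y / K * h ^ 2) / 2) =
      Real.exp (-((K + 1) / 2 * y)) := by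
    rw [← Real.exp_add]
    congr 1
    rw [ha]; field_simp; ring
  -- the powers
  have hpow : a * (a * y) ^ (K / 2 - 1) * √(a * y / K) =
      a ^ ((K + 1) / 2) * y ^ ((K + 1) / 2 - 1) * (√K)⁻¹ := by
    rw [Real.sqrt_div hay.le, Real.sqrt_eq_rpow (a * y), Real.mul_rpow ha0.le hy.le,
      Real.mul_rpow ha0.le hy.le]
    rw [show (K + 1) / 2 - 1 = (K / 2 - 1) + 1 / 2 by ring, Real.rpow_add hy,
      show (K + 1) / 2 = 1 + (K / 2 - 1) + 1 / 2 by ring, Real.rpow_add ha0, Real.rpow_add ha0,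
      Real.rpow_one]
    ring
  have hapow : a ^ ((K + 1) / 2) =
      ((K + 1) / 2) ^ ((K + 1) / 2) * 2 ^ ((K + 1) / 2) * (1 + h ^ 2 / K) ^ (-((K + 1) / 2)) := by
    rw [← Real.mul_rpow (by positivity) (by norm_num), Real.rpow_neg (by positivity),
      ← Real.inv_rpow (by positivity), ← Real.mul_rpow (by positivity) (by positivity)]
    congr 1
    rw [ha]; field_simp
  have hconst : (√(2 * Real.pi))⁻¹ * (1 / 2 : ℝ) ^ (K / 2) * 2 ^ ((K + 1) / 2) = (√Real.pi)⁻¹ := by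
    rw [Real.sqrt_mul (by norm_num), show (K + 1) / 2 = K / 2 + 1 / 2 by ring,
      Real.rpow_add (by norm_num), ← Real.sqrt_eq_rpow, one_div, Real.inv_rpow (by norm_num)]
    have : (2 : ℝ) ^ (K / 2) ≠ 0 := (Real.rpow_pos_of_pos (by norm_num) _).ne'
    have h2 : √(2 : ℝ) ≠ 0 := by positivity
    field_simp
  have hsK : √(K * Real.pi) = √K * √Real.pi := Real.sqrt_mul hK.le _
  calc _ = (a * (a * y) ^ (K / 2 - 1) * √(a * y / K)) *
        (Real.exp (-(1 / 2 * (a * y))) * Real.exp (-(a * y / K * h ^ 2) / 2)) *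
        ((√(2 * Real.pi))⁻¹ * (1 / 2 : ℝ) ^ (K / 2)) / Real.Gamma (K / 2) := by ring
    _ = ((√(2 * Real.pi))⁻¹ * (1 / 2 : ℝ) ^ (K / 2) * 2 ^ ((K + 1) / 2)) *
        ((K + 1) / 2) ^ ((K + 1) / 2) * (1 + h ^ 2 / K) ^ (-((K + 1) / 2)) *
        y ^ ((K + 1) / 2 - 1) * (√K)⁻¹ * Real.exp (-((K + 1) / 2 * y)) / Real.Gamma (K / 2) := by
      rw [hexp, hpow, hapow]; ring
    _ = _ := by
      rw [hconst, hsK]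
      have hK0 : √K ≠ 0 := by positivity
      field_simp

/-- For independent `N ∼ N(0,1)` and `Q ∼ χ²_K`, the ratio `N / √(Q / K)` has the `t_K`
distribution and is independent of `(Q + N²) / (K + 1) ∼ χ²_{K+1} / (K + 1)`. -/
lemma map_ratio_sumSq {K : ℝ} (hK : 0 < K) :
    ((gaussianReal 0 1).prod (gammaMeasure (K / 2) (1 / 2))).map
      (fun q : ℝ × ℝ => (q.1 / √(q.2 / K), (q.2 + q.1 ^ 2) / (K + 1))) =
    (studentTMeasure K).prod (scaledChiSq (K + 1)) := by
  refine Measure.ext_of_lintegral _ fun f hf => ?_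
  rw [lintegral_map hf (by fun_prop), lintegral_prod_symm _ (by fun_prop),
    lintegral_prod _ (by fun_prop), studentTMeasure, scaledChiSq, gammaMeasure, gammaMeasure,
    gaussianReal_of_var_ne_zero _ (by norm_num)]
  have hG := measurable_gammaPDF (K / 2) (1 / 2)
  have hG' := measurable_gammaPDF ((K + 1) / 2) ((K + 1) / 2)
  have hS := (measurable_studentTPDF K).ennreal_ofReal
  have hN := measurable_gaussianPDF 0 1
  rw [lintegral_withDensity_eq_lintegral_mul _ hG (by fun_prop),
    lintegral_withDensity_eq_lintegral_mul _ hS (by fun_prop)]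
  -- substitute `x = h √(q / K)` for fixed `q`
  have h1 : ∀ᵐ q : ℝ, (gammaPDF (K / 2) (1 / 2) *
      fun q : ℝ => ∫⁻ x, f (x / √(q / K), (q + x ^ 2) / (K + 1))
        ∂(volume.withDensity (gaussianPDF 0 1))) q =
      ∫⁻ h, gammaPDF (K / 2) (1 / 2) q * (ENNReal.ofReal √(q / K) *
        (gaussianPDF 0 1 (√(q / K) * h) * f (h, (q + q / K * h ^ 2) / (K + 1)))) := by
    filter_upwards [Measure.ae_ne volume (0 : ℝ)] with q hq0
    rcases lt_or_gt_of_ne hq0 with hq | hq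
    · simp [gammaPDF_of_neg hq]
    · have hs : 0 < √(q / K) := by positivity
      rw [Pi.mul_apply, lintegral_withDensity_eq_lintegral_mul _ hN (by fun_prop),
        lintegral_eq_mul_lintegral_comp_mul hs (by fun_prop),
        lintegral_const_mul _ (by fun_prop), lintegral_const_mul _ (by fun_prop)]
      congr 2
      refine lintegral_congr fun h => ?_
      rw [Pi.mul_apply, mul_div_cancel_left₀ _ hs.ne', mul_pow, Real.sq_sqrt (by positivity)]
  rw [lintegral_congr_ae h1, lintegral_lintegral_swap (by fun_prop)]
  refine lintegral_congr fun h => ?_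
  -- substitute `q = (K + 1) K / (K + h²) y` for fixed `h`
  have hKh : 0 < K + h ^ 2 := by positivity
  rw [Pi.mul_apply, lintegral_withDensity_eq_lintegral_mul _ hG' (by fun_prop),
    lintegral_eq_mul_lintegral_comp_mul (a := (K + 1) * K / (K + h ^ 2)) (by positivity)
      (by fun_prop),
    ← lintegral_const_mul _ (by fun_prop), ← lintegral_const_mul _ (by fun_prop)]
  refine lintegral_congr_ae ?_
  filter_upwards [Measure.ae_ne volume (0 : ℝ)] with y hy0
  rcases lt_or_gt_of_ne hy0 with hy | hy
  · have : (K + 1) * K / (K + h ^ 2) * y < 0 := mul_neg_of_pos_of_neg (by positivity) hy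
    simp [gammaPDF_of_neg hy, gammaPDF_of_neg this]
  · have hid := density_ratio_identity (h := h) hK hy
    have harg : ((K + 1) * K / (K + h ^ 2) * y + (K + 1) * K / (K + h ^ 2) * y / K * h ^ 2) /
        (K + 1) = y := by field_simp
    have hnn := gammaPDFReal_nonneg (show 0 < K / 2 by linarith) (show (0 : ℝ) < 1 / 2 by norm_num)
      ((K + 1) * K / (K + h ^ 2) * y)
    have hgn := gaussianPDFReal_nonneg 0 1 (√((K + 1) * K / (K + h ^ 2) * y / K) * h)
    rw [harg, Pi.mul_apply, gammaPDF, gammaPDF, gaussianPDF, ← mul_assoc, ← mul_assoc, ← mul_assoc,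
      ← mul_assoc, ← ENNReal.ofReal_mul (by positivity), ← ENNReal.ofReal_mul (by positivity),
      ← ENNReal.ofReal_mul (by positivity), ← ENNReal.ofReal_mul (studentTPDF_nonneg hK h),
      mul_assoc (_ * gammaPDFReal _ _ _), hid]

/-! ### Chi-square laws through characteristic functions -/

lemma map_mul_scaledChiSq {k : ℝ} (hk : 0 < k) :
    (scaledChiSq k).map (fun x => k * x) = chiSqMeasure k := by
  refine Measure.ext_of_lintegral _ fun f hf => ?_
  have hG := measurable_gammaPDF (k / 2) (1 / 2)
  have hG' := measurable_gammaPDF (k / 2) (k / 2)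
  rw [lintegral_map hf (by fun_prop), chiSqMeasure, scaledChiSq, gammaMeasure, gammaMeasure,
    lintegral_withDensity_eq_lintegral_mul _ hG' (by fun_prop),
    lintegral_withDensity_eq_lintegral_mul _ hG hf,
    lintegral_eq_mul_lintegral_comp_mul hk (hG.mul hf), ← lintegral_const_mul _ (by fun_prop)]
  refine lintegral_congr fun x => ?_
  rw [Pi.mul_apply, Pi.mul_apply, gammaPDF, gammaPDF, ← scaledChiSqPDF_eq hk, scaledChiSqPDF,
    ENNReal.ofReal_mul hk.le, mul_assoc]

lemma isProbabilityMeasure_chiSqMeasure {k : ℝ} (hk : 0 < k) :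
    IsProbabilityMeasure (chiSqMeasure k) :=
  isProbabilityMeasure_gammaMeasure (by positivity) (by norm_num)

/-- Adding the square of an independent standard normal variable adds one degree of freedom. -/
lemma map_add_sq_chiSqMeasure {k : ℝ} (hk : 0 < k) :
    ((gaussianReal 0 1).prod (chiSqMeasure k)).map (fun q : ℝ × ℝ => q.2 + q.1 ^ 2) =
      chiSqMeasure (k + 1) := by
  have hk1 : 0 < k + 1 := by linarith
  have := isProbabilityMeasure_gammaMeasure (a := (k + 1) / 2) (r := (k + 1) / 2)
    (by positivity) (by positivity)
  have h := congrArg (fun m => Measure.map (fun x : ℝ × ℝ => (k + 1) * x.2) m)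
    (map_ratio_sumSq hk)
  rw [Measure.map_map (by fun_prop) (by fun_prop)] at h
  have h2 : ((studentTMeasure k).prod (scaledChiSq (k + 1))).map
      (fun x : ℝ × ℝ => (k + 1) * x.2) = chiSqMeasure (k + 1) := by
    have h3 : (fun x : ℝ × ℝ => (k + 1) * x.2) = (fun x => (k + 1) * x) ∘ Prod.snd := rfl
    have h4 : studentTMeasure k univ = 1 := by
      have h5 := congrArg (fun m => m univ) (map_ratio_sumSq hk)
      have := isProbabilityMeasure_gammaMeasure (a := k / 2) (r := 1 / 2)
        (by positivity) (by norm_num)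
      have h6 := isProbabilityMeasure_scaledChiSq hk1
      rw [Measure.map_apply (by fun_prop) .univ, preimage_univ, measure_univ,
        ← univ_prod_univ, Measure.prod_prod, h6.measure_univ, mul_one] at h5
      exact h5.symm
    rw [h3, ← Measure.map_map (by fun_prop) (by fun_prop), Measure.map_snd_prod, h4, one_smul,
      map_mul_scaledChiSq hk1]
  rw [← h2, ← h]
  refine congrArg (fun g => Measure.map g _) ?_
  funext q
  simp only [Function.comp_apply]
  field_simp

/-- The law of the square of a standard normal variable. -/
noncomputable abbrev sqNormal : Measure ℝ := (gaussianReal 0 1).map (fun x => x ^ 2)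

lemma re_half_sub_mul_I (t : ℝ) : 0 < ((1 / 2 : ℂ) - t * Complex.I).re := by simp

lemma charFun_sqNormal (t : ℝ) : charFun sqNormal t =
    ((√(2 * Real.pi))⁻¹ : ℝ) * (Real.pi / ((1 / 2 : ℂ) - t * Complex.I)) ^ (1 / 2 : ℂ) := by
  rw [charFun_apply_real, integral_map (by fun_prop) (by fun_prop),
    integral_gaussianReal_eq_integral_smul (by norm_num),
    ← integral_gaussian_complex (re_half_sub_mul_I t), ← integral_const_mul]
  refine integral_congr_ae (ae_of_all _ fun x => ?_)
  simp only [gaussianPDFReal, Complex.real_smul]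
  push_cast
  rw [mul_assoc, ← Complex.exp_add]
  simp only [mul_one, sub_zero]
  congr 2
  ring

lemma charFun_sqNormal_ne_zero (t : ℝ) : charFun sqNormal t ≠ 0 := by
  have hb0 : ((1 / 2 : ℂ) - t * Complex.I) ≠ 0 := fun h0 => by
    have := re_half_sub_mul_I t
    rw [h0] at this
    simp at this
  rw [charFun_sqNormal]
  refine mul_ne_zero ?_ ?_
  · exact_mod_cast (inv_pos.2 (Real.sqrt_pos.2 Real.two_pi_pos)).ne'
  · rw [Ne, Complex.cpow_eq_zero_iff, not_and_or]
    exact Or.inl (div_ne_zero (by exact_mod_cast Real.pi_ne_zero) hb0)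

/-- The `χ²_1` distribution is the law of a squared standard normal variable: substitute `y = x²`
in the integral of the characteristic function. -/
lemma charFun_chiSqMeasure_one : charFun (chiSqMeasure 1) = charFun sqNormal := by
  ext t
  rw [charFun_sqNormal, charFun_apply_real, chiSqMeasure,
    integral_gammaMeasure (by norm_num) (by norm_num), ← integral_comp_rpow_Ioi _ two_ne_zero]
  have h := integral_gaussian_complex_Ioi (re_half_sub_mul_I t)
  rw [← mul_div_cancel₀ (((Real.pi : ℂ) / ((1 / 2 : ℂ) - t * Complex.I)) ^ (1 / 2 : ℂ))
    (two_ne_zero (α := ℂ)), ← h, ← mul_assoc, ← integral_const_mul]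
  refine setIntegral_congr_fun measurableSet_Ioi fun x (hx : 0 < x) => ?_
  have hx2 : 0 ≤ x ^ 2 := by positivity
  have hpow : (x ^ 2) ^ (1 / 2 - 1 : ℝ) = x⁻¹ := by
    rw [← Real.rpow_two, ← Real.rpow_mul hx.le, ← Real.rpow_neg_one]
    norm_num
  have hc : (1 / 2 : ℝ) ^ (1 / 2 : ℝ) / √Real.pi = (√(2 * Real.pi))⁻¹ := by
    rw [← Real.sqrt_eq_rpow, Real.sqrt_mul (by norm_num), Real.sqrt_div (by norm_num)]
    rw [Real.sqrt_one]; field_simp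
  simp only [Real.rpow_two, gammaPDFReal, hx2, if_true, Real.Gamma_one_half_eq, hpow, hc,
    Complex.real_smul]
  rw [show (2 : ℝ) - 1 = 1 by norm_num, Real.rpow_one, abs_two]
  push_cast
  have hx0 : (x : ℂ) ≠ 0 := by exact_mod_cast hx.ne'
  have hexp : Complex.exp (-(1 / 2 * (x : ℂ) ^ 2)) * Complex.exp (t * x ^ 2 * Complex.I) =
      Complex.exp (-(1 / 2 - t * Complex.I) * x ^ 2) := by
    rw [← Complex.exp_add]
    congr 1
    ring
  rw [← hexp]
  field_simp

lemma charFun_chiSqMeasure_succ {k : ℝ} (hk : 0 < k) :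
    charFun (chiSqMeasure (k + 1)) = charFun (chiSqMeasure k) * charFun sqNormal := by
  have := isProbabilityMeasure_chiSqMeasure hk
  have hind : IndepFun (fun q : ℝ × ℝ => q.2) (fun q : ℝ × ℝ => q.1 ^ 2)
      ((gaussianReal 0 1).prod (chiSqMeasure k)) :=
    (indepFun_prod (X := fun x : ℝ => x ^ 2) (Y := fun x : ℝ => x) (by fun_prop)
      (by fun_prop)).symm
  rw [← map_add_sq_chiSqMeasure hk, hind.charFun_map_fun_add_eq_mul (by fun_prop) (by fun_prop)]
  congr 2
  · rw [Measure.map_snd_prod, measure_univ, one_smul]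
  · rw [← Function.comp_def (fun x : ℝ => x ^ 2) Prod.fst,
      ← Measure.map_map (by fun_prop) (by fun_prop), Measure.map_fst_prod, measure_univ, one_smul]

lemma charFun_chiSqMeasure (m : ℕ) :
    charFun (chiSqMeasure (m + 1 : ℕ)) = charFun sqNormal ^ (m + 1) := by
  induction m with
  | zero => simpa using charFun_chiSqMeasure_one
  | succ m ih =>
    rw [pow_succ, ← ih]
    push_cast
    exact charFun_chiSqMeasure_succ (by positivity)

/-- The sum of the squares of `m` independent standard normal variables has the characteristic
function of `χ²_m`. -/
lemma charFun_map_sum_sq {Ω κ : Type*} [MeasurableSpace Ω] {P : Measure Ω} [Fintype κ]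
    {Y : κ → Ω → ℝ} (hY : ∀ k, HasLaw (Y k) (gaussianReal 0 1) P) (hind : iIndepFun Y P) :
    charFun (P.map fun o => ∑ k, Y k o ^ 2) = charFun sqNormal ^ Fintype.card κ := by
  have hind2 : iIndepFun (fun k o => Y k o ^ 2) P :=
    hind.comp (fun _ x => x ^ 2) (fun _ => by fun_prop)
  rw [hind2.charFun_map_fun_sum_eq_prod (fun k => (hY k).aemeasurable.pow_const 2)]
  have : ∀ k, charFun (P.map fun o => Y k o ^ 2) = charFun sqNormal := fun k => by
    rw [sqNormal, ← (hY k).map_eq, AEMeasurable.map_map_of_aemeasurable (by fun_prop)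
      (hY k).aemeasurable]
    rfl
  simp [this]

/-- If `Z ∼ N(0,1)` is independent of `Q` and `Z² + Q` has the characteristic function of
`χ²_{m+2}`, then `Q ∼ χ²_{m+1}`. -/
lemma hasLaw_chiSqMeasure_of_charFun_add {Ω : Type*} [MeasurableSpace Ω] {P : Measure Ω}
    [IsProbabilityMeasure P] {Z Q : Ω → ℝ} {m : ℕ} (hZ : HasLaw Z (gaussianReal 0 1) P)
    (hQ : AEMeasurable Q P) (hind : IndepFun Z Q P)
    (hsum : charFun (P.map fun o => Z o ^ 2 + Q o) = charFun sqNormal ^ (m + 2)) :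
    HasLaw Q (chiSqMeasure (m + 1 : ℕ)) P := by
  refine ⟨hQ, ?_⟩
  have := Measure.isProbabilityMeasure_map hQ
  have := isProbabilityMeasure_chiSqMeasure (show (0 : ℝ) < (m + 1 : ℕ) by positivity)
  have hind2 : IndepFun (fun o => Z o ^ 2) Q P :=
    hind.comp (φ := fun x => x ^ 2) (ψ := fun x => x) (by fun_prop) (by fun_prop)
  have hZ2 : P.map (fun o => Z o ^ 2) = sqNormal := by
    rw [sqNormal, ← hZ.map_eq, AEMeasurable.map_map_of_aemeasurable (by fun_prop) hZ.aemeasurable]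
    rfl
  rw [hind2.charFun_map_fun_add_eq_mul (hZ.aemeasurable.pow_const 2) hQ, hZ2] at hsum
  refine Measure.ext_of_charFun ?_
  ext t
  have h := congrFun hsum t
  rw [charFun_chiSqMeasure]
  refine mul_left_cancel₀ (charFun_sqNormal_ne_zero t) ?_
  rw [Pi.mul_apply] at h
  rw [h, Pi.pow_apply, Pi.pow_apply, pow_succ']

/-! ### Linear combinations of independent standard normal variables -/

/-- The variables `ξ j` are independent and standard normal. -/
structure IsIIDNormal {Ω J : Type*} [MeasurableSpace Ω] (ξ : J → Ω → ℝ) (P : Measure Ω) :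
    Prop where
  law : ∀ j, HasLaw (ξ j) (gaussianReal 0 1) P
  indep : iIndepFun ξ P

lemma IsIIDNormal.memLp_two {Ω J : Type*} [MeasurableSpace Ω] {ξ : J → Ω → ℝ} {P : Measure Ω}
    (h : IsIIDNormal ξ P) (j : J) : MemLp (ξ j) 2 P :=
  (h.law j).hasGaussianLaw.memLp_two

section LinComb

variable {Ω J : Type*} [Fintype J]

/-- The linear combination of the variables `ξ j` with coefficient vector `a`. -/
noncomputable def linComb (ξ : J → Ω → ℝ) (a : J → ℝ) (o : Ω) : ℝ := ∑ j, a j * ξ j o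

lemma linComb_add (ξ : J → Ω → ℝ) (a b : J → ℝ) (o : Ω) :
    linComb ξ (a + b) o = linComb ξ a o + linComb ξ b o := by
  simp [linComb, add_mul, Finset.sum_add_distrib]

lemma linComb_sub (ξ : J → Ω → ℝ) (a b : J → ℝ) (o : Ω) :
    linComb ξ (a - b) o = linComb ξ a o - linComb ξ b o := by
  simp [linComb, sub_mul, Finset.sum_sub_distrib]

lemma linComb_smul (ξ : J → Ω → ℝ) (c : ℝ) (a : J → ℝ) (o : Ω) :
    linComb ξ (c • a) o = c * linComb ξ a o := by
  simp [linComb, Finset.mul_sum, mul_assoc]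

lemma linComb_sum {κ : Type*} (s : Finset κ) (ξ : J → Ω → ℝ) (a : κ → J → ℝ) (o : Ω) :
    linComb ξ (∑ k ∈ s, a k) o = ∑ k ∈ s, linComb ξ (a k) o := by
  simp only [linComb, Finset.sum_apply, Finset.sum_mul]
  exact Finset.sum_comm

lemma linComb_single [DecidableEq J] (ξ : J → Ω → ℝ) (j : J) (o : Ω) :
    linComb ξ (Pi.single j 1) o = ξ j o := by
  simp [linComb, Pi.single_apply]

namespace IsIIDNormal

variable [MeasurableSpace Ω] {ξ : J → Ω → ℝ} {P : Measure Ω}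

lemma aemeasurable_linComb (h : IsIIDNormal ξ P) (a : J → ℝ) :
    AEMeasurable (linComb ξ a) P := by
  unfold linComb
  exact Finset.aemeasurable_fun_sum _ fun j _ => (h.law j).aemeasurable.const_mul _

lemma covariance_linComb (h : IsIIDNormal ξ P) (a b : J → ℝ) :
    cov[linComb ξ a, linComb ξ b; P] = a ⬝ᵥ b := by
  classical
  have := h.indep.isProbabilityMeasure
  have hcov : ∀ i j, cov[ξ i, ξ j; P] = if i = j then 1 else 0 := by
    intro i j
    split_ifs with hij
    · subst hij
      rw [covariance_self (h.law i).aemeasurable, (h.law i).variance_eq, variance_id_gaussianReal]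
      rfl
    · exact (h.indep.indepFun hij).covariance_eq_zero (h.memLp_two i) (h.memLp_two j)
  have h1 : ∀ c : J → ℝ, ∀ j, MemLp (fun o => c j * ξ j o) 2 P := fun c j =>
    (h.memLp_two j).const_mul _
  unfold linComb
  rw [covariance_fun_sum_fun_sum (h1 a) (h1 b)]
  simp only [covariance_const_mul_left, covariance_const_mul_right, hcov, dotProduct, mul_ite,
    mul_one, mul_zero, Finset.sum_ite_eq, Finset.mem_univ, if_true]
  exact Finset.sum_congr rfl fun _ _ => mul_comm _ _

lemma hasGaussianLaw_linComb (h : IsIIDNormal ξ P) {ι κ : Type*} [Fintype ι] [Fintype κ]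
    (A : ι → κ → J → ℝ) : HasGaussianLaw (fun o i k => linComb ξ (A i k) o) P := by
  have h1 : HasGaussianLaw (fun o j => ξ j o) P :=
    h.indep.hasGaussianLaw fun j => (h.law j).hasGaussianLaw
  let L : (J → ℝ) →L[ℝ] (ι → κ → ℝ) := ContinuousLinearMap.pi fun i =>
    ContinuousLinearMap.pi fun k => ∑ j, A i k j • ContinuousLinearMap.proj (R := ℝ) j
  have h2 := h1.map_fun L
  convert! h2 using 4 with o i k
  simp [L, linComb]

/-- Families of linear combinations with mutually orthogonal coefficients are independent. -/
lemma iIndepFun_linComb (h : IsIIDNormal ξ P) {ι κ : Type*} [Fintype ι] [Fintype κ]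
    (A : ι → κ → J → ℝ) (hA : ∀ i i', i ≠ i' → ∀ k l, A i k ⬝ᵥ A i' l = 0) :
    iIndepFun (fun i o k => linComb ξ (A i k) o) P :=
  HasGaussianLaw.iIndepFun_of_covariance_eval (X := fun i k => linComb ξ (A i k))
    (h.hasGaussianLaw_linComb A) fun i i' hii k l => by
      rw [h.covariance_linComb, hA i i' hii k l]

lemma hasLaw_linComb (h : IsIIDNormal ξ P) (a : J → ℝ) :
    HasLaw (linComb ξ a) (gaussianReal 0 (a ⬝ᵥ a).toNNReal) P := by
  have hG : HasGaussianLaw (linComb ξ a) P :=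
    ((h.hasGaussianLaw_linComb fun (_ _ : Unit) => a).eval ()).eval ()
  refine ⟨hG.aemeasurable, ?_⟩
  rw [hG.map_eq_gaussianReal, ← covariance_self hG.aemeasurable, h.covariance_linComb]
  congr 1
  unfold linComb
  rw [integral_finsetSum _ fun j _ => ((h.law j).hasGaussianLaw.integrable).const_mul _]
  refine Finset.sum_eq_zero fun j _ => ?_
  rw [integral_const_mul, (h.law j).integral_eq, integral_id_gaussianReal, mul_zero]

end IsIIDNormal

/-! ### Sample mean and sample variance -/

section Sample

variable {κ : Type*} [Fintype κ]

/-- The coefficients of the standardized sample mean of the variables with coefficients `u k`. -/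
noncomputable def meanCoef (u : κ → J → ℝ) : J → ℝ := (√(Fintype.card κ : ℝ))⁻¹ • ∑ k, u k

/-- The coefficients of the deviation of the `k`-th variable from the sample mean. -/
noncomputable def devCoef (u : κ → J → ℝ) (k : κ) : J → ℝ :=
  u k - (Fintype.card κ : ℝ)⁻¹ • ∑ l, u l

/-- The sum of the squared deviations from the sample mean. -/
noncomputable def sumSqDev (ξ : J → Ω → ℝ) (u : κ → J → ℝ) (o : Ω) : ℝ :=
  ∑ k, linComb ξ (devCoef u k) o ^ 2

variable {u : κ → J → ℝ}

lemma sum_dotProduct_of_orthonormal [DecidableEq κ]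
    (hu : ∀ k l, u k ⬝ᵥ u l = if k = l then 1 else 0) (k : κ) : (∑ l, u l) ⬝ᵥ u k = 1 := by
  rw [sum_dotProduct]
  simp [hu]

lemma sum_dotProduct_sum_of_orthonormal [DecidableEq κ]
    (hu : ∀ k l, u k ⬝ᵥ u l = if k = l then 1 else 0) :
    (∑ l, u l) ⬝ᵥ (∑ l, u l) = Fintype.card κ := by
  rw [dotProduct_sum]
  simp [sum_dotProduct_of_orthonormal hu]

lemma meanCoef_dotProduct_self [DecidableEq κ] [Nonempty κ]
    (hu : ∀ k l, u k ⬝ᵥ u l = if k = l then 1 else 0) : meanCoef u ⬝ᵥ meanCoef u = 1 := by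
  have hc : (0 : ℝ) < Fintype.card κ := by exact_mod_cast Fintype.card_pos
  rw [meanCoef, smul_dotProduct, dotProduct_smul, sum_dotProduct_sum_of_orthonormal hu,
    smul_eq_mul, smul_eq_mul, ← mul_assoc, ← mul_inv, Real.mul_self_sqrt hc.le,
    inv_mul_cancel₀ hc.ne']

lemma meanCoef_dotProduct_devCoef [DecidableEq κ] [Nonempty κ]
    (hu : ∀ k l, u k ⬝ᵥ u l = if k = l then 1 else 0) (k : κ) :
    meanCoef u ⬝ᵥ devCoef u k = 0 := by
  have hc : (Fintype.card κ : ℝ) ≠ 0 := by exact_mod_cast Fintype.card_ne_zero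
  rw [meanCoef, devCoef, smul_dotProduct, dotProduct_sub, dotProduct_smul,
    sum_dotProduct_sum_of_orthonormal hu, sum_dotProduct_of_orthonormal hu, smul_eq_mul,
    smul_eq_mul, inv_mul_cancel₀ hc, sub_self, mul_zero]

/-- Decomposition of the sum of squares into the parts of the mean and of the deviations. -/
lemma meanCoef_sq_add_sumSqDev [Nonempty κ] (ξ : J → Ω → ℝ) (u : κ → J → ℝ) (o : Ω) :
    linComb ξ (meanCoef u) o ^ 2 + sumSqDev ξ u o = ∑ k, linComb ξ (u k) o ^ 2 := by
  have hc : (0 : ℝ) < Fintype.card κ := by exact_mod_cast Fintype.card_pos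
  simp only [sumSqDev, meanCoef, devCoef, linComb_smul, linComb_sub, linComb_sum, sub_sq,
    Finset.sum_add_distrib, Finset.sum_sub_distrib, Finset.sum_const, ← Finset.sum_mul,
    ← Finset.mul_sum, Finset.card_univ, nsmul_eq_mul, mul_pow, inv_pow, Real.sq_sqrt hc.le]
  field_simp
  ring

variable [MeasurableSpace Ω] {ξ : J → Ω → ℝ} {P : Measure Ω}

/-- Linear combinations with mutually orthogonal coefficients, all of them orthogonal to the
deviations of the variables with coefficients `u k`, are independent, jointly with the sum of the
squared deviations (at the index `none`). -/
lemma IsIIDNormal.iIndepFun_option_sumSqDev (h : IsIIDNormal ξ P) [Nonempty κ] {ι : Type*}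
    [Fintype ι] (a : ι → J → ℝ) (ha : ∀ i i', i ≠ i' → a i ⬝ᵥ a i' = 0)
    (had : ∀ i k, a i ⬝ᵥ devCoef u k = 0) :
    iIndepFun (fun i : Option ι => i.elim (sumSqDev ξ u) fun i => linComb ξ (a i)) P := by
  obtain ⟨k₀⟩ := ‹Nonempty κ›
  have h1 := h.iIndepFun_linComb (ι := Option ι) (κ := κ)
    (fun i k => i.elim (devCoef u k) a) (by
      rintro (_ | i) (_ | i') hii k l
      · exact absurd rfl hii
      · simpa [dotProduct_comm] using had i' k
      · simpa using had i l
      · exact ha i i' fun h => hii (by rw [h]))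
  have h2 := h1.comp (fun i y => i.elim (∑ k, y k ^ 2) fun _ => y k₀) (by
    rintro (_ | i)
    · simp only [Option.elim]; fun_prop
    · simp only [Option.elim]; fun_prop)
  convert! h2 using 1
  funext i o
  rcases i with _ | i
  · rfl
  · rfl

/-- The sum of the squared deviations of `m + 2` independent standard normal variables from their
mean is `χ²_{m+1}` distributed: adding the independent square of the standardized mean gives a sum
of `m + 2` independent squares. -/
lemma IsIIDNormal.hasLaw_sumSqDev (h : IsIIDNormal ξ P) [DecidableEq κ]
    (hu : ∀ k l, u k ⬝ᵥ u l = if k = l then 1 else 0) {m : ℕ} (hm : Fintype.card κ = m + 2) :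
    HasLaw (sumSqDev ξ u) (chiSqMeasure (m + 1 : ℕ)) P := by
  have : Nonempty κ := Fintype.card_pos_iff.1 (by omega)
  have := h.indep.isProbabilityMeasure
  have hZ := h.hasLaw_linComb (meanCoef u)
  rw [meanCoef_dotProduct_self hu, Real.toNNReal_one] at hZ
  have hind := (h.iIndepFun_option_sumSqDev (u := u) (fun _ : Unit => meanCoef u)
    (fun _ _ h => absurd rfl h) fun _ k => meanCoef_dotProduct_devCoef hu k).indepFun
      (i := some ()) (j := none) (by simp)
  have hmeas : AEMeasurable (sumSqDev ξ u) P :=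
    Finset.aemeasurable_fun_sum _ fun k _ => (h.aemeasurable_linComb _).pow_const 2
  refine hasLaw_chiSqMeasure_of_charFun_add hZ hmeas hind ?_
  simp_rw [meanCoef_sq_add_sumSqDev]
  rw [← hm]
  refine charFun_map_sum_sq (Y := fun k => linComb ξ (u k)) (fun k => ?_) ?_
  · have := h.hasLaw_linComb (u k)
    rwa [hu, if_pos rfl, Real.toNNReal_one] at this
  · have h1 := h.iIndepFun_linComb (ι := κ) (κ := Unit) (fun k _ => u k)
      fun k l hkl _ _ => by rw [hu, if_neg hkl]
    exact h1.comp (fun _ y => y ()) fun _ => by fun_prop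

end Sample

end LinComb

/-! ### The auxiliary variables of the model -/

section ModelLaws

variable {Ω : Type*} {n : ℕ}

/-- The family `ε₁, …, εₙ, e₁, …, eₙ`. -/
def noise (n : ℕ) (ε e : ℕ → Ω → ℝ) : Finset.Icc 1 n ⊕ Finset.Icc 1 n → Ω → ℝ :=
  Sum.elim (fun i => ε i) (fun i => e i)

lemma IsStdNormalNoise.isIIDNormal [MeasurableSpace Ω] {P : Measure Ω} {ε e : ℕ → Ω → ℝ}
    (h : IsStdNormalNoise n P ε e) : IsIIDNormal (noise n ε e) P where
  law := by
    rintro (i | i)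
    · exact h.law_ε i i.2
    · exact h.law_e i i.2
  indep := h.indep

/-- An index among `2, …, n`, as an index among `1, …, n`. -/
def restIdx (k : Finset.Icc 2 n) : Finset.Icc 1 n :=
  ⟨k, by have := Finset.mem_Icc.1 k.2; exact Finset.mem_Icc.2 ⟨by omega, this.2⟩⟩

/-- The coefficients of the standardized variable `(τ ε_k + e_k) / √(τ² + 1)`, for `2 ≤ k ≤ n`. -/
noncomputable def restCoef (n : ℕ) (τ : ℝ) (k : Finset.Icc 2 n) :
    Finset.Icc 1 n ⊕ Finset.Icc 1 n → ℝ :=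
  (√(τ ^ 2 + 1))⁻¹ • (τ • Pi.single (Sum.inl (restIdx k)) 1 + Pi.single (Sum.inr (restIdx k)) 1)

lemma linComb_restCoef (τ : ℝ) (ε e : ℕ → Ω → ℝ) (k : Finset.Icc 2 n) (o : Ω) :
    linComb (noise n ε e) (restCoef n τ k) o = (√(τ ^ 2 + 1))⁻¹ * (τ * ε k o + e k o) := by
  rw [restCoef, linComb_smul, linComb_add, linComb_smul, linComb_single, linComb_single]
  rfl

lemma restCoef_orthonormal (τ : ℝ) (k l : Finset.Icc 2 n) :
    restCoef n τ k ⬝ᵥ restCoef n τ l = if k = l then 1 else 0 := by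
  have hv : 0 < τ ^ 2 + 1 := by positivity
  have hinj : restIdx k = restIdx l ↔ k = l :=
    ⟨fun h => Subtype.ext (show (k : ℕ) = l from congrArg (fun i : Finset.Icc 1 n => (i : ℕ)) h),
      fun h => by rw [h]⟩
  rw [restCoef, restCoef, smul_dotProduct, dotProduct_smul, add_dotProduct, smul_dotProduct,
    single_dotProduct, single_dotProduct]
  simp only [Pi.add_apply, Pi.smul_apply, Pi.single_apply, Sum.inl.injEq, Sum.inr.injEq, hinj,
    reduceCtorEq, if_false, smul_eq_mul]
  split_ifs
  · have : (√(τ ^ 2 + 1))⁻¹ * (√(τ ^ 2 + 1))⁻¹ = (τ ^ 2 + 1)⁻¹ := by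
      rw [← mul_inv, Real.mul_self_sqrt hv.le]
    rw [← mul_assoc, this]
    field_simp
    ring
  · simp

lemma card_rest (hn : 3 ≤ n) : Fintype.card (Finset.Icc 2 n) = (n - 3) + 2 := by
  rw [Fintype.card_coe, Nat.card_Icc]; omega

lemma cast_card_rest (hn : 3 ≤ n) : (Fintype.card (Finset.Icc 2 n) : ℝ) = n - 1 := by
  rw [card_rest hn]; push_cast [hn]; ring

lemma nonempty_rest (hn : 3 ≤ n) : Nonempty (Finset.Icc 2 n) :=
  ⟨⟨2, Finset.mem_Icc.2 ⟨le_rfl, by omega⟩⟩⟩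

lemma sum_rest (f : ℕ → ℝ) : ∑ k : Finset.Icc 2 n, f k = ∑ i ∈ Finset.Icc 2 n, f i :=
  Finset.sum_coe_sort _ _

lemma three_le_cast (hn : 3 ≤ n) : (3 : ℝ) ≤ n := by exact_mod_cast hn

lemma tauTilde_pos (hn : 3 ≤ n) (τ : ℝ) : 0 < tauTilde n τ := by
  have := three_le_cast hn
  exact Real.sqrt_pos.2 (div_pos (by positivity) (by linarith))

lemma auxZ_eq_linComb (hn : 3 ≤ n) (τ : ℝ) (ε e : ℕ → Ω → ℝ) :
    auxZ n τ ε e = linComb (noise n ε e) (meanCoef (restCoef n τ)) := by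
  have h3 := three_le_cast hn
  have hm : (0 : ℝ) < n - 1 := by linarith
  have hv : 0 < τ ^ 2 + 1 := by positivity
  funext o
  simp only [auxZ, tauTilde, restMean, obs, meanCoef, linComb_smul, linComb_sum, linComb_restCoef,
    cast_card_rest hn, zero_add]
  rw [← Finset.mul_sum, sum_rest fun i => τ * ε i o + e i o, Real.sqrt_div hv.le]
  have h1 : √((n : ℝ) - 1) ≠ 0 := (Real.sqrt_pos.2 hm).ne'
  have h2 : √(τ ^ 2 + 1) ≠ 0 := (Real.sqrt_pos.2 hv).ne'
  have h4 : √((n : ℝ) - 1) ^ 2 = n - 1 := Real.sq_sqrt hm.le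
  field_simp
  rw [h4]

lemma auxMSq_eq_sumSqDev (hn : 3 ≤ n) (τ : ℝ) (ε e : ℕ → Ω → ℝ) (o : Ω) :
    ((n : ℝ) - 2) * auxMSq n τ ε e o = sumSqDev (noise n ε e) (restCoef n τ) o := by
  have h3 := three_le_cast hn
  have hm : (n : ℝ) - 1 ≠ 0 := by linarith
  have hm2 : (n : ℝ) - 2 ≠ 0 := by linarith
  have hv : 0 < τ ^ 2 + 1 := by positivity
  simp only [auxMSq, restVar, sumSqDev, devCoef, linComb_sub, linComb_smul, linComb_sum,
    linComb_restCoef, cast_card_rest hn, ← Finset.mul_sum]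
  rw [sum_rest fun i => τ * ε i o + e i o,
    sum_rest fun k => ((√(τ ^ 2 + 1))⁻¹ * (τ * ε k o + e k o) - ((n : ℝ) - 1)⁻¹ *
      ((√(τ ^ 2 + 1))⁻¹ * ∑ i ∈ Finset.Icc 2 n, (τ * ε i o + e i o))) ^ 2,
    div_div, mul_div_assoc', mul_div_mul_left _ _ hm2, Finset.sum_div]
  refine Finset.sum_congr rfl fun k _ => ?_
  simp only [restMean, obs, zero_add]
  rw [← Real.sq_sqrt hv.le, div_eq_mul_inv, ← inv_pow, ← mul_pow, Real.sqrt_sq (Real.sqrt_nonneg _)]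
  congr 1
  ring

lemma restMean_obs (hn : 3 ≤ n) (μ τ : ℝ) (ε e : ℕ → Ω → ℝ) (o : Ω) :
    restMean n (obs μ τ ε e o) = μ + restMean n (obs 0 τ ε e o) := by
  have h3 := three_le_cast hn
  have hm : (n : ℝ) - 1 ≠ 0 := by linarith
  simp only [restMean, obs, zero_add, add_assoc, Finset.sum_add_distrib, Finset.sum_const,
    Nat.card_Icc, nsmul_eq_mul]
  rw [show ((n + 1 - 2 : ℕ) : ℝ) = n - 1 by
    rw [show n + 1 - 2 = n - 1 by omega]; push_cast [show 1 ≤ n by omega]; ring]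
  field_simp

lemma restVar_obs (hn : 3 ≤ n) (μ τ : ℝ) (ε e : ℕ → Ω → ℝ) (o : Ω) :
    restVar n (obs μ τ ε e o) = restVar n (obs 0 τ ε e o) := by
  simp only [restVar, restMean_obs hn μ]
  congr 1
  refine Finset.sum_congr rfl fun k _ => ?_
  simp only [obs]
  ring

lemma restMean_obs_eq (hn : 3 ≤ n) (μ τ : ℝ) (ε e : ℕ → Ω → ℝ) (o : Ω) :
    restMean n (obs μ τ ε e o) = μ + tauTilde n τ * auxZ n τ ε e o := by
  rw [restMean_obs hn, auxZ, mul_div_cancel₀ _ (tauTilde_pos hn τ).ne']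

lemma restVar_obs_eq (hn : 3 ≤ n) (μ τ : ℝ) (ε e : ℕ → Ω → ℝ) (o : Ω) :
    restVar n (obs μ τ ε e o) = (τ ^ 2 + 1) * auxMSq n τ ε e o := by
  rw [restVar_obs hn, auxMSq, mul_div_cancel₀ _ (by positivity)]

lemma statH_obs_eq (hn : 3 ≤ n) (μ τ : ℝ) (ε e : ℕ → Ω → ℝ) (o : Ω) :
    statH n (obs μ τ ε e o) = auxWH n τ ε e o := by
  have h3 := three_le_cast hn
  have hm : (0 : ℝ) < n - 1 := by linarith
  have hv : 0 < τ ^ 2 + 1 := by positivity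
  have hn0 : (0 : ℝ) < n := by linarith
  have hx : obs μ τ ε e o 1 = μ + τ * ε 1 o + e 1 o := rfl
  rw [statH, auxWH, restVar_obs_eq hn, restMean_obs_eq hn, hx, Real.sqrt_mul hv.le,
    show μ + τ * ε 1 o + e 1 o - (μ + tauTilde n τ * auxZ n τ ε e o) =
      τ * ε 1 o + e 1 o - tauTilde n τ * auxZ n τ ε e o by ring]
  generalize τ * ε 1 o + e 1 o - tauTilde n τ * auxZ n τ ε e o = d
  rw [tauTilde, Real.sqrt_div hm.le, Real.sqrt_div hv.le]
  have h1 : √((n : ℝ) - 1) ≠ 0 := (Real.sqrt_pos.2 hm).ne'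
  have h2 : √(τ ^ 2 + 1) ≠ 0 := (Real.sqrt_pos.2 hv).ne'
  have h4 : √(n : ℝ) ≠ 0 := (Real.sqrt_pos.2 hn0).ne'
  rcases eq_or_ne √(auxMSq n τ ε e o) 0 with h | h
  -- both sides vanish when `S = 0`, by the convention on division by zero
  · simp [h]
  · field_simp

/-- The variance `(τ² + 1) n / (n - 1)` of `X₁` minus the mean of `X₂, …, Xₙ`. -/
noncomputable def diffVar (n : ℕ) (τ : ℝ) : ℝ := (τ ^ 2 + 1) * n / (n - 1)

/-- The standardized difference of `X₁` and the mean of `X₂, …, Xₙ`. -/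
noncomputable def auxN (n : ℕ) (τ : ℝ) (ε e : ℕ → Ω → ℝ) (o : Ω) : ℝ :=
  (τ * ε 1 o + e 1 o - tauTilde n τ * auxZ n τ ε e o) / √(diffVar n τ)

/-- The residual of the linear regression of the mean of `X₂, …, Xₙ` minus `μ₁` on `X₁` minus that
mean. -/
noncomputable def auxR (n : ℕ) (τ : ℝ) (ε e : ℕ → Ω → ℝ) (o : Ω) : ℝ :=
  (diffVar n τ)⁻¹ * (tauTilde n τ * auxZ n τ ε e o - τ * ε 1 o) + (1 - (diffVar n τ)⁻¹) * e 1 o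

lemma diffVar_eq (hn : 3 ≤ n) (τ : ℝ) : diffVar n τ = τ ^ 2 + 1 + tauTilde n τ ^ 2 := by
  have h3 := three_le_cast hn
  have hm : (n : ℝ) - 1 ≠ 0 := by linarith
  rw [diffVar, tauTilde, Real.sq_sqrt (div_nonneg (by positivity) (by linarith))]
  field_simp
  ring

lemma one_lt_diffVar (hn : 3 ≤ n) (τ : ℝ) : 1 < diffVar n τ := by
  rw [diffVar_eq hn]
  have := tauTilde_pos hn τ
  have := sq_nonneg τ
  have : 0 < tauTilde n τ ^ 2 := by positivity
  linarith

lemma one_mem_Icc (hn : 3 ≤ n) : 1 ∈ Finset.Icc 1 n := Finset.mem_Icc.2 ⟨le_rfl, by omega⟩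

/-- The coefficients of `ε₁`, `e₁` and `Z`. -/
noncomputable def baseCoef (hn : 3 ≤ n) (τ : ℝ) :
    Fin 3 → Finset.Icc 1 n ⊕ Finset.Icc 1 n → ℝ :=
  ![Pi.single (Sum.inl ⟨1, one_mem_Icc hn⟩) 1, Pi.single (Sum.inr ⟨1, one_mem_Icc hn⟩) 1,
    meanCoef (restCoef n τ)]

lemma restIdx_ne_one (hn : 3 ≤ n) (k : Finset.Icc 2 n) : restIdx k ≠ ⟨1, one_mem_Icc hn⟩ := by
  intro h
  have h1 : (k : ℕ) = 1 := congrArg Subtype.val h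
  have := (Finset.mem_Icc.1 k.2).1
  omega

lemma restCoef_inl_one (hn : 3 ≤ n) (τ : ℝ) (k : Finset.Icc 2 n) :
    restCoef n τ k (Sum.inl ⟨1, one_mem_Icc hn⟩) = 0 := by
  simp [restCoef, (restIdx_ne_one hn k).symm]

lemma restCoef_inr_one (hn : 3 ≤ n) (τ : ℝ) (k : Finset.Icc 2 n) :
    restCoef n τ k (Sum.inr ⟨1, one_mem_Icc hn⟩) = 0 := by
  simp [restCoef, (restIdx_ne_one hn k).symm]

lemma baseCoef_orthonormal (hn : 3 ≤ n) (τ : ℝ) (i j : Fin 3) :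
    baseCoef hn τ i ⬝ᵥ baseCoef hn τ j = if i = j then 1 else 0 := by
  have := nonempty_rest hn
  have h22 := meanCoef_dotProduct_self (restCoef_orthonormal (n := n) τ)
  have h02 : meanCoef (restCoef n τ) (Sum.inl ⟨1, one_mem_Icc hn⟩) = 0 := by
    simp [meanCoef, restCoef_inl_one hn]
  have h12 : meanCoef (restCoef n τ) (Sum.inr ⟨1, one_mem_Icc hn⟩) = 0 := by
    simp [meanCoef, restCoef_inr_one hn]
  fin_cases i <;> fin_cases j <;> simp [baseCoef, h22, h02, h12]

lemma baseCoef_dotProduct_devCoef (hn : 3 ≤ n) (τ : ℝ) (i : Fin 3) (k : Finset.Icc 2 n) :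
    baseCoef hn τ i ⬝ᵥ devCoef (restCoef n τ) k = 0 := by
  have := nonempty_rest hn
  fin_cases i
  · simp [baseCoef, devCoef, restCoef_inl_one hn]
  · simp [baseCoef, devCoef, restCoef_inr_one hn]
  · simpa [baseCoef] using meanCoef_dotProduct_devCoef (restCoef_orthonormal (n := n) τ) k

lemma linComb_sum_baseCoef (hn : 3 ≤ n) (τ : ℝ) (ε e : ℕ → Ω → ℝ) (c : Fin 3 → ℝ) (o : Ω) :
    linComb (noise n ε e) (∑ i, c i • baseCoef hn τ i) o =
      c 0 * ε 1 o + c 1 * e 1 o + c 2 * auxZ n τ ε e o := by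
  rw [auxZ_eq_linComb hn, Fin.sum_univ_three, linComb_add, linComb_add, linComb_smul, linComb_smul,
    linComb_smul]
  simp only [baseCoef, Matrix.cons_val_zero, Matrix.cons_val_one, Matrix.cons_val]
  rw [linComb_single, linComb_single]
  rfl

lemma sum_baseCoef_dotProduct (hn : 3 ≤ n) (τ : ℝ) (c d : Fin 3 → ℝ) :
    (∑ i, c i • baseCoef hn τ i) ⬝ᵥ (∑ i, d i • baseCoef hn τ i) =
      c 0 * d 0 + c 1 * d 1 + c 2 * d 2 := by
  simp [baseCoef_orthonormal, Fin.sum_univ_three]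
  ring

lemma sum_baseCoef_dotProduct_devCoef (hn : 3 ≤ n) (τ : ℝ) (c : Fin 3 → ℝ) (k : Finset.Icc 2 n) :
    (∑ i, c i • baseCoef hn τ i) ⬝ᵥ devCoef (restCoef n τ) k = 0 := by
  simp [sum_dotProduct, baseCoef_dotProduct_devCoef]

lemma auxN_eq (τ : ℝ) (ε e : ℕ → Ω → ℝ) (o : Ω) : auxN n τ ε e o =
    τ / √(diffVar n τ) * ε 1 o + 1 / √(diffVar n τ) * e 1 o +
      -tauTilde n τ / √(diffVar n τ) * auxZ n τ ε e o := by
  rw [auxN]; ring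

lemma auxR_eq (τ : ℝ) (ε e : ℕ → Ω → ℝ) (o : Ω) : auxR n τ ε e o =
    -(τ * (diffVar n τ)⁻¹) * ε 1 o + (1 - (diffVar n τ)⁻¹) * e 1 o +
      (diffVar n τ)⁻¹ * tauTilde n τ * auxZ n τ ε e o := by
  rw [auxR]; ring

variable [MeasurableSpace Ω] {P : Measure Ω} {ε e : ℕ → Ω → ℝ}

lemma hasLaw_auxZ (h : IsStdNormalNoise n P ε e) (hn : 3 ≤ n) (τ : ℝ) :
    HasLaw (auxZ n τ ε e) (gaussianReal 0 1) P := by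
  have := nonempty_rest hn
  have h1 := h.isIIDNormal.hasLaw_linComb (meanCoef (restCoef n τ))
  rwa [meanCoef_dotProduct_self (restCoef_orthonormal τ), Real.toNNReal_one,
    ← auxZ_eq_linComb hn] at h1

lemma hasLaw_auxMSq (h : IsStdNormalNoise n P ε e) (hn : 3 ≤ n) (τ : ℝ) :
    HasLaw (fun o => ((n : ℝ) - 2) * auxMSq n τ ε e o) (chiSqMeasure ((n : ℝ) - 2)) P := by
  have h1 := h.isIIDNormal.hasLaw_sumSqDev (restCoef_orthonormal τ) (card_rest hn)
  have h2 : ((n - 3 + 1 : ℕ) : ℝ) = n - 2 := by push_cast [hn]; ring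
  rw [h2] at h1
  exact h1.congr (ae_of_all _ fun o => auxMSq_eq_sumSqDev hn τ ε e o)

/-- Linear combinations of `ε₁, e₁, Z` with orthogonal coefficients are independent, jointly with
`M²`. -/
lemma iIndepFun_option_auxMSq (h : IsStdNormalNoise n P ε e) (hn : 3 ≤ n) (τ : ℝ) {ι : Type*}
    [Fintype ι] (c : ι → Fin 3 → ℝ)
    (hc : ∀ i j, i ≠ j → c i 0 * c j 0 + c i 1 * c j 1 + c i 2 * c j 2 = 0) :
    iIndepFun (fun i : Option ι => i.elim (auxMSq n τ ε e)
      fun i o => c i 0 * ε 1 o + c i 1 * e 1 o + c i 2 * auxZ n τ ε e o) P := by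
  have := nonempty_rest hn
  have h3 := three_le_cast hn
  have hm2 : (n : ℝ) - 2 ≠ 0 := by linarith
  have h1 := h.isIIDNormal.iIndepFun_option_sumSqDev (u := restCoef n τ)
    (fun i => ∑ j, c i j • baseCoef hn τ j)
    (fun i j hij => by rw [sum_baseCoef_dotProduct, hc i j hij])
    (fun i k => sum_baseCoef_dotProduct_devCoef hn τ (c i) k)
  have h2 := h1.comp (fun i y => i.elim (y / ((n : ℝ) - 2)) fun _ => y) (by
    rintro (_ | i)
    · simp only [Option.elim]; fun_prop
    · simp only [Option.elim]; fun_prop)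
  convert! h2 using 1
  funext i o
  rcases i with _ | i
  · simp only [Option.elim, Function.comp_apply]
    rw [← auxMSq_eq_sumSqDev hn, mul_div_cancel_left₀ _ hm2]
  · simp only [Option.elim, Function.comp_apply]
    rw [linComb_sum_baseCoef]

lemma iIndepFun_aux (h : IsStdNormalNoise n P ε e) (hn : 3 ≤ n) (τ : ℝ) :
    iIndepFun ![ε 1, e 1, auxZ n τ ε e, auxMSq n τ ε e] P := by
  have h1 := iIndepFun_option_auxMSq h hn τ (ι := Fin 3) (fun i => Pi.single i 1)
    (fun i j hij => by fin_cases i <;> fin_cases j <;> simp at hij ⊢)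
  have h2 := h1.precomp (g := (![some 0, some 1, some 2, none] : Fin 4 → Option (Fin 3)))
    (by decide)
  convert! h2 using 1
  funext i o
  fin_cases i <;> simp

lemma hasLaw_linComb_aux (h : IsStdNormalNoise n P ε e) (hn : 3 ≤ n) (τ : ℝ) (c : Fin 3 → ℝ) :
    HasLaw (fun o => c 0 * ε 1 o + c 1 * e 1 o + c 2 * auxZ n τ ε e o)
      (gaussianReal 0 (c 0 * c 0 + c 1 * c 1 + c 2 * c 2).toNNReal) P := by
  have h1 := h.isIIDNormal.hasLaw_linComb (∑ i, c i • baseCoef hn τ i)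
  rw [sum_baseCoef_dotProduct] at h1
  exact h1.congr (ae_of_all _ fun o => (linComb_sum_baseCoef hn τ ε e c o).symm)

lemma hasLaw_auxN (h : IsStdNormalNoise n P ε e) (hn : 3 ≤ n) (τ : ℝ) :
    HasLaw (auxN n τ ε e) (gaussianReal 0 1) P := by
  have hV := one_lt_diffVar hn τ
  have h1 := hasLaw_linComb_aux h hn τ
    ![τ / √(diffVar n τ), 1 / √(diffVar n τ), -tauTilde n τ / √(diffVar n τ)]
  simp only [Matrix.cons_val_zero, Matrix.cons_val_one, Matrix.cons_val, ← auxN_eq] at h1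
  have h2 : τ / √(diffVar n τ) * (τ / √(diffVar n τ)) + 1 / √(diffVar n τ) * (1 / √(diffVar n τ)) +
      -tauTilde n τ / √(diffVar n τ) * (-tauTilde n τ / √(diffVar n τ)) = 1 := by
    rw [div_mul_div_comm, div_mul_div_comm, div_mul_div_comm, Real.mul_self_sqrt (by linarith),
      ← add_div, ← add_div, div_eq_one_iff_eq (by linarith), diffVar_eq hn]
    ring
  rwa [h2, Real.toNNReal_one] at h1

lemma hasLaw_auxR (h : IsStdNormalNoise n P ε e) (hn : 3 ≤ n) (τ : ℝ) :
    HasLaw (auxR n τ ε e) (gaussianReal 0 (1 - (diffVar n τ)⁻¹).toNNReal) P := by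
  have hV := one_lt_diffVar hn τ
  have hV0 : diffVar n τ ≠ 0 := by linarith
  have h1 := hasLaw_linComb_aux h hn τ
    ![-(τ * (diffVar n τ)⁻¹), 1 - (diffVar n τ)⁻¹, (diffVar n τ)⁻¹ * tauTilde n τ]
  simp only [Matrix.cons_val_zero, Matrix.cons_val_one, Matrix.cons_val, ← auxR_eq] at h1
  convert! h1 using 3
  have h2 : tauTilde n τ ^ 2 = diffVar n τ - τ ^ 2 - 1 := by rw [diffVar_eq hn]; ring
  rw [show (diffVar n τ)⁻¹ * tauTilde n τ * ((diffVar n τ)⁻¹ * tauTilde n τ) =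
    (diffVar n τ)⁻¹ ^ 2 * tauTilde n τ ^ 2 by ring, h2]
  field_simp
  ring

/-- The residual `R` is uncorrelated with `N` by the choice of the regression coefficient, and both
are linear combinations of `ε₁, e₁, Z`, which are independent of `M²`. -/
lemma iIndepFun_aux_regression (h : IsStdNormalNoise n P ε e) (hn : 3 ≤ n) (τ : ℝ) :
    iIndepFun ![auxN n τ ε e, auxMSq n τ ε e, auxR n τ ε e] P := by
  have hV := one_lt_diffVar hn τ
  have hV0 : diffVar n τ ≠ 0 := by linarith
  have horth : τ / √(diffVar n τ) * -(τ * (diffVar n τ)⁻¹) +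
      1 / √(diffVar n τ) * (1 - (diffVar n τ)⁻¹) +
      -tauTilde n τ / √(diffVar n τ) * ((diffVar n τ)⁻¹ * tauTilde n τ) = 0 := by
    have h2 : tauTilde n τ ^ 2 = diffVar n τ - τ ^ 2 - 1 := by rw [diffVar_eq hn]; ring
    have h3 : √(diffVar n τ) ≠ 0 := (Real.sqrt_pos.2 (by linarith)).ne'
    field_simp
    rw [h2]
    ring
  have h1 := iIndepFun_option_auxMSq h hn τ (ι := Fin 2)
    ![![τ / √(diffVar n τ), 1 / √(diffVar n τ), -tauTilde n τ / √(diffVar n τ)],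
      ![-(τ * (diffVar n τ)⁻¹), 1 - (diffVar n τ)⁻¹, (diffVar n τ)⁻¹ * tauTilde n τ]]
    (fun i j hij => by
      fin_cases i <;> fin_cases j
      · simp at hij
      · simpa using horth
      · simp only [Fin.zero_eta, Fin.mk_one, Matrix.cons_val_zero, Matrix.cons_val_one,
          Matrix.cons_val]
        linarith
      · simp at hij)
  have h2 := h1.precomp (g := (![some 0, none, some 1] : Fin 3 → Option (Fin 2))) (by decide)
  convert! h2 using 1
  funext i o
  fin_cases i
  · simp [auxN_eq]
  · simp
  · simp [auxR_eq]

end ModelLaws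

/-! ### The joint law of `H`, the rescaled sum of squares and the regression residual -/

section Representation

/-- The constant `c₁` of the explicit conditional c.d.f. -/
noncomputable def coefOne (n : ℕ) (h : ℝ) : ℝ :=
  ((n : ℝ) - 2) * ((n : ℝ) - 3 - h ^ 2) / (n * (h ^ 2 + n - 2))

/-- The constant `c₂` of the explicit conditional c.d.f. -/
noncomputable def coefTwo (n : ℕ) (h : ℝ) : ℝ := ((n : ℝ) - 1) * h / √(n * (h ^ 2 + n - 2))

/-- The constant `c₃` of the explicit conditional c.d.f. -/
noncomputable def coefThree (n : ℕ) : ℝ := ((n : ℝ) - 2) / ((n : ℝ) - 1)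

/-- The conditional bias of the centered difference, as a function of `h`, of `w = 1 / (1 + τ²)`
and of the rescaled sum of squares `y`. -/
noncomputable def condShift (n : ℕ) (h w y : ℝ) : ℝ :=
  coefTwo n h * √w * (√y - coefThree n / √y)

/-- The scale `σ̃`, as a function of `h`, of `w = 1 / (1 + τ²)` and of the rescaled sum of
squares `y`. -/
noncomputable def condScale (n : ℕ) (γ h w y : ℝ) : ℝ :=
  √(max ((n : ℝ) ^ (-γ)) (1 - coefOne n h * w / y))

/-- The explicit c.d.f. as an average over the rescaled sum of squares `y ∼ χ²_{n-1} / (n - 1)`. -/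
lemma explicitCDF_eq {n : ℕ} (hn : 3 ≤ n) (γ h w s : ℝ) : explicitCDF n γ h w s =
    ∫ y, Phi ((s * condScale n γ h w y - condShift n h w y) / √(1 - w * ((n : ℝ) - 1) / n))
      ∂(scaledChiSq ((n : ℝ) - 1)) := by
  have h3 := three_le_cast hn
  have hp : (0 : ℝ) < n - 1 := by linarith
  rw [integral_gammaMeasure (by linarith) (by linarith)]
  simp only [explicitCDF, scaledChiSqPDF_eq hp, smul_eq_mul, condScale, condShift, coefOne,
    coefTwo, coefThree]
  simp_rw [mul_comm (gammaPDFReal _ _ _)]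

variable {Ω : Type*} {n : ℕ}

/-- The rescaled sum of squares `((n - 2) M² + N²) / (n - 1)`. -/
noncomputable def auxY (n : ℕ) (τ : ℝ) (ε e : ℕ → Ω → ℝ) (o : Ω) : ℝ :=
  (((n : ℝ) - 2) * auxMSq n τ ε e o + auxN n τ ε e o ^ 2) / ((n : ℝ) - 1)

lemma sqrt_diffVar (hn : 3 ≤ n) (τ : ℝ) : √(diffVar n τ) = √(n : ℝ) * tauTilde n τ := by
  have h3 := three_le_cast hn
  rw [tauTilde, ← Real.sqrt_mul (by linarith), diffVar]
  congr 1
  ring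

lemma auxWH_eq (hn : 3 ≤ n) (τ : ℝ) (ε e : ℕ → Ω → ℝ) (o : Ω) :
    auxWH n τ ε e o = auxN n τ ε e o / √(auxMSq n τ ε e o) := by
  rw [auxWH, auxN, sqrt_diffVar hn, div_div]

/-- The bias of the centered difference in terms of `h`, `w = 1 / v` and `y`. -/
lemma neg_mul_sub_muTilde_eq_condShift (hn : 3 ≤ n) {v M : ℝ} (hv : 0 < v) (hM : 0 < M) (h : ℝ) :
    -((1 - (v * n / (n - 1))⁻¹) * √(v * n / (n - 1)) * (h * M)) - muTilde n h (√v * M) =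
      condShift n h v⁻¹ (M ^ 2 * ((n : ℝ) - 2 + h ^ 2) / (n - 1)) := by
  have h3 := three_le_cast hn
  have hn0 : (0 : ℝ) < n := by linarith
  have hp : (0 : ℝ) < n - 1 := by linarith
  have hK : (0 : ℝ) < h ^ 2 + n - 2 := by nlinarith [sq_nonneg h]
  have hK' : (n : ℝ) - 2 + h ^ 2 = h ^ 2 + n - 2 := by ring
  rw [muTilde, condShift, coefTwo, coefThree, hK', Real.sqrt_div hp.le,
    Real.sqrt_div (mul_pos hv hn0).le, Real.sqrt_mul hv.le, Real.sqrt_inv, Real.sqrt_mul hn0.le,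
    Real.sqrt_div (by positivity), Real.sqrt_mul (by positivity), Real.sqrt_sq hM.le]
  obtain ⟨a, ha, hav⟩ : ∃ a : ℝ, 0 < a ∧ (n : ℝ) = a ^ 2 :=
    ⟨√n, Real.sqrt_pos.2 hn0, (Real.sq_sqrt hn0.le).symm⟩
  obtain ⟨b, hb, hbv⟩ : ∃ b : ℝ, 0 < b ∧ (n : ℝ) - 1 = b ^ 2 :=
    ⟨√(n - 1), Real.sqrt_pos.2 hp, (Real.sq_sqrt hp.le).symm⟩
  obtain ⟨c, hc, hcv⟩ : ∃ c : ℝ, 0 < c ∧ v = c ^ 2 :=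
    ⟨√v, Real.sqrt_pos.2 hv, (Real.sq_sqrt hv.le).symm⟩
  obtain ⟨d, hd, hdv⟩ : ∃ d : ℝ, 0 < d ∧ h ^ 2 + n - 2 = d ^ 2 :=
    ⟨√(h ^ 2 + n - 2), Real.sqrt_pos.2 hK, (Real.sq_sqrt hK.le).symm⟩
  -- in terms of the square roots `a, b, c, d` the claim is an identity of rational functions
  generalize (n : ℝ) - 2 = K
  rw [hbv, hdv, hcv, hav, Real.sqrt_sq ha.le, Real.sqrt_sq hb.le, Real.sqrt_sq hc.le,
    Real.sqrt_sq hd.le]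
  field_simp
  ring

lemma sigmaTilde_eq_condScale (hn : 3 ≤ n) {v M : ℝ} (hv : 0 < v) (hM : 0 < M) (γ h : ℝ) :
    sigmaTilde n γ h (√v * M) =
      condScale n γ h v⁻¹ (M ^ 2 * ((n : ℝ) - 2 + h ^ 2) / (n - 1)) := by
  have h3 := three_le_cast hn
  have hn0 : (0 : ℝ) < n := by linarith
  have hp : (n : ℝ) - 1 ≠ 0 := by linarith
  have hK : (0 : ℝ) < h ^ 2 + n - 2 := by nlinarith [sq_nonneg h]
  have hK' : (n : ℝ) - 2 + h ^ 2 = h ^ 2 + n - 2 := by ring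
  rw [sigmaTilde, sigmaTildeSq, condScale, coefOne, hK', mul_pow, Real.sq_sqrt hv.le]
  congr 3
  field_simp

lemma auxY_eq (hn : 3 ≤ n) {τ : ℝ} {ε e : ℕ → Ω → ℝ} {o : Ω} (hM : 0 < auxMSq n τ ε e o) :
    auxY n τ ε e o =
      √(auxMSq n τ ε e o) ^ 2 * ((n : ℝ) - 2 + auxWH n τ ε e o ^ 2) / (n - 1) := by
  rw [auxWH_eq hn, auxY, div_pow, Real.sq_sqrt hM.le]
  field_simp

lemma centeredDiff_eq (hn : 3 ≤ n) (μ : ℝ) {τ : ℝ} {ε e : ℕ → Ω → ℝ} {o : Ω}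
    (hM : 0 < auxMSq n τ ε e o) : centeredDiff n μ τ ε e o =
      condShift n (auxWH n τ ε e o) (1 + τ ^ 2)⁻¹ (auxY n τ ε e o) + auxR n τ ε e o := by
  have hv : 0 < 1 + τ ^ 2 := by positivity
  have hV := one_lt_diffVar hn τ
  have hsV : √(diffVar n τ) ≠ 0 := (Real.sqrt_pos.2 (by linarith)).ne'
  have hVeq : (1 + τ ^ 2) * n / (n - 1) = diffVar n τ := by rw [diffVar]; ring
  have h1 := neg_mul_sub_muTilde_eq_condShift hn hv (Real.sqrt_pos.2 hM) (auxWH n τ ε e o)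
  have hN : auxWH n τ ε e o * √(auxMSq n τ ε e o) = auxN n τ ε e o := by
    rw [auxWH_eq hn, div_mul_cancel₀ _ (Real.sqrt_pos.2 hM).ne']
  rw [hVeq, hN] at h1
  rw [auxY_eq hn hM, ← h1, centeredDiff, statH_obs_eq hn, restVar_obs_eq hn, restMean_obs_eq hn,
    firstMean, Real.sqrt_mul (by positivity), add_comm (τ ^ 2) 1, auxN, auxR, mul_assoc,
    mul_div_cancel₀ _ hsV]
  ring

lemma auxWb_eq (hn : 3 ≤ n) (γ μ : ℝ) {τ : ℝ} {ε e : ℕ → Ω → ℝ} {o : Ω}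
    (hM : 0 < auxMSq n τ ε e o) : auxWb n γ μ τ ε e o =
      (condShift n (auxWH n τ ε e o) (1 + τ ^ 2)⁻¹ (auxY n τ ε e o) + auxR n τ ε e o) /
        condScale n γ (auxWH n τ ε e o) (1 + τ ^ 2)⁻¹ (auxY n τ ε e o) := by
  have hv : 0 < 1 + τ ^ 2 := by positivity
  rw [← centeredDiff_eq hn μ hM, auxY_eq hn hM,
    ← sigmaTilde_eq_condScale hn hv (Real.sqrt_pos.2 hM), auxWb, bFun, centeredDiff, statT,
    statH_obs_eq hn, restVar_obs_eq hn, Real.sqrt_mul (by positivity), add_comm (τ ^ 2) 1]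

variable [MeasurableSpace Ω] {P : Measure Ω} {ε e : ℕ → Ω → ℝ}

lemma aemeasurable_auxMSq (h : IsStdNormalNoise n P ε e) (hn : 3 ≤ n) (τ : ℝ) :
    AEMeasurable (auxMSq n τ ε e) P := by
  have h3 := three_le_cast hn
  have hm2 : (n : ℝ) - 2 ≠ 0 := by linarith
  have h1 := (hasLaw_auxMSq h hn τ).aemeasurable.const_mul ((n : ℝ) - 2)⁻¹
  simpa only [inv_mul_cancel_left₀ hm2] using h1

lemma ae_auxMSq_pos (h : IsStdNormalNoise n P ε e) (hn : 3 ≤ n) (τ : ℝ) :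
    ∀ᵐ o ∂P, 0 < auxMSq n τ ε e o := by
  have h3 := three_le_cast hn
  have hQ := hasLaw_auxMSq h hn τ
  have h1 := ae_pos_gammaMeasure (((n : ℝ) - 2) / 2) (1 / 2)
  rw [← chiSqMeasure, ← hQ.map_eq] at h1
  filter_upwards [ae_of_ae_map hQ.aemeasurable h1] with o ho
  exact pos_of_mul_pos_right ho (by linarith)

/-- `H`, the rescaled sum of squares and the regression residual are independent. -/
lemma map_auxWH_auxY_auxR (h : IsStdNormalNoise n P ε e) (hn : 3 ≤ n) (τ : ℝ) :
    P.map (fun o => (auxWH n τ ε e o, (auxY n τ ε e o, auxR n τ ε e o))) =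
      (studentTMeasure ((n : ℝ) - 2)).prod ((scaledChiSq ((n : ℝ) - 1)).prod
        (gaussianReal 0 (1 - (diffVar n τ)⁻¹).toNNReal)) := by
  have h3 := three_le_cast hn
  have hK : (0 : ℝ) < n - 2 := by linarith
  have := h.indep.isProbabilityMeasure
  have hN := hasLaw_auxN h hn τ
  have hQ := hasLaw_auxMSq h hn τ
  have hR := hasLaw_auxR h hn τ
  have hM := aemeasurable_auxMSq h hn τ
  have hind := iIndepFun_aux_regression h hn τ
  have hNM : IndepFun (auxN n τ ε e) (auxMSq n τ ε e) P := hind.indepFun (i := 0) (j := 1) (by simp)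
  have hNMR : IndepFun (fun o => (auxN n τ ε e o, auxMSq n τ ε e o)) (auxR n τ ε e) P :=
    hind.indepFun_prodMk₀ (fun i => by fin_cases i <;> simp [hN.aemeasurable, hM, hR.aemeasurable])
      0 1 2 (by simp) (by simp)
  have hNQ : P.map (fun o => (auxN n τ ε e o, ((n : ℝ) - 2) * auxMSq n τ ε e o)) =
      (gaussianReal 0 1).prod (chiSqMeasure ((n : ℝ) - 2)) := by
    have h1 : IndepFun (auxN n τ ε e) (fun o => ((n : ℝ) - 2) * auxMSq n τ ε e o) P :=
      hNM.comp (φ := fun x => x) (ψ := fun x => ((n : ℝ) - 2) * x) (by fun_prop) (by fun_prop)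
    rw [(indepFun_iff_map_prod_eq_prod_map_map hN.aemeasurable hQ.aemeasurable).1 h1, hN.map_eq,
      hQ.map_eq]
  have hHY : P.map (fun o => (auxWH n τ ε e o, auxY n τ ε e o)) =
      (studentTMeasure ((n : ℝ) - 2)).prod (scaledChiSq ((n : ℝ) - 1)) := by
    have h1 := map_ratio_sumSq hK
    rw [show (n : ℝ) - 2 + 1 = n - 1 by ring, ← chiSqMeasure, ← hNQ,
      AEMeasurable.map_map_of_aemeasurable (by fun_prop)
        (hN.aemeasurable.prodMk hQ.aemeasurable)] at h1
    rw [← h1]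
    congr 1
    funext o
    simp only [Function.comp_apply, auxWH_eq hn, auxY, mul_div_cancel_left₀ _ hK.ne']
  have hHYm : AEMeasurable (fun o => (auxWH n τ ε e o, auxY n τ ε e o)) P := by
    have h1 : (fun o => (auxWH n τ ε e o, auxY n τ ε e o)) =
        (fun q : ℝ × ℝ => (q.1 / √q.2, (((n : ℝ) - 2) * q.2 + q.1 ^ 2) / ((n : ℝ) - 1))) ∘
          fun o => (auxN n τ ε e o, auxMSq n τ ε e o) := by
      funext o; simp only [Function.comp_apply, auxWH_eq hn, auxY]
    rw [h1]
    exact Measurable.comp_aemeasurable (by fun_prop) (hN.aemeasurable.prodMk hM)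
  have hHYR : IndepFun (fun o => (auxWH n τ ε e o, auxY n τ ε e o)) (auxR n τ ε e) P := by
    have h1 := hNMR.comp
      (φ := fun q : ℝ × ℝ => (q.1 / √q.2, (((n : ℝ) - 2) * q.2 + q.1 ^ 2) / ((n : ℝ) - 1)))
      (ψ := fun x => x) (by fun_prop) (by fun_prop)
    convert! h1 using 1
    funext o; simp only [Function.comp_apply, auxWH_eq hn, auxY]
  have hjoint := (indepFun_iff_map_prod_eq_prod_map_map hHYm hR.aemeasurable).1 hHYR
  rw [hHY, hR.map_eq] at hjoint
  have := isProbabilityMeasure_scaledChiSq (show (0 : ℝ) < n - 1 by linarith)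
  rw [← Measure.prodAssoc_prod, ← hjoint, AEMeasurable.map_map_of_aemeasurable (by fun_prop)
    (hHYm.prodMk hR.aemeasurable)]
  rfl

lemma aemeasurable_auxWH (h : IsStdNormalNoise n P ε e) (hn : 3 ≤ n) (τ : ℝ) :
    AEMeasurable (auxWH n τ ε e) P := by
  have h1 : auxWH n τ ε e = fun o => auxN n τ ε e o / √(auxMSq n τ ε e o) := by
    funext o; exact auxWH_eq hn τ ε e o
  rw [h1]
  exact (hasLaw_auxN h hn τ).aemeasurable.div (aemeasurable_auxMSq h hn τ).sqrt

lemma aemeasurable_auxY (h : IsStdNormalNoise n P ε e) (hn : 3 ≤ n) (τ : ℝ) :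
    AEMeasurable (auxY n τ ε e) P :=
  ((aemeasurable_auxMSq h hn τ).const_mul _ |>.add
    ((hasLaw_auxN h hn τ).aemeasurable.pow_const 2)).div_const _

lemma hasLaw_auxWH (h : IsStdNormalNoise n P ε e) (hn : 3 ≤ n) (τ : ℝ) :
    HasLaw (auxWH n τ ε e) (studentTMeasure ((n : ℝ) - 2)) P := by
  have h3 := three_le_cast hn
  have hm := aemeasurable_auxWH h hn τ
  refine ⟨hm, ?_⟩
  have hmY := aemeasurable_auxY h hn τ
  have hmR := (hasLaw_auxR h hn τ).aemeasurable
  have h1 := congrArg (fun m => m.map Prod.fst) (map_auxWH_auxY_auxR h hn τ)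
  have := isProbabilityMeasure_scaledChiSq (show (0 : ℝ) < n - 1 by linarith)
  simp only [Measure.map_fst_prod, measure_univ, one_smul] at h1
  rw [← h1, AEMeasurable.map_map_of_aemeasurable (by fun_prop) (hm.prodMk (hmY.prodMk hmR))]
  rfl

/-- A property holding for almost every `h` with respect to the law of `W_H` holds for Lebesgue
almost every `h`. -/
lemma ae_volume_of_ae_map_auxWH (h : IsStdNormalNoise n P ε e) (hn : 3 ≤ n) (τ : ℝ) {p : ℝ → Prop}
    (hp : ∀ᵐ x ∂(P.map (auxWH n τ ε e)), p x) : ∀ᵐ x : ℝ, p x := by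
  have h3 := three_le_cast hn
  rw [(hasLaw_auxWH h hn τ).map_eq] at hp
  exact (volume_absolutelyContinuous_studentTMeasure (by linarith)).ae_le hp

end Representation

/-! ### Conditional distributions of functions of independent variables -/

/-- If `X` is independent of `V ∼ ν`, then the conditional law of `Ψ(X, V)` given `X = x` is the
law of `Ψ(x, V)`. -/
lemma condDistrib_ae_eq_map_of_indep {Ω 𝓥 : Type*} [MeasurableSpace Ω] [MeasurableSpace 𝓥]
    {P : Measure Ω} [IsFiniteMeasure P] {X W : Ω → ℝ} {V : Ω → 𝓥} {ρ : Measure ℝ} [SFinite ρ]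
    {ν : Measure 𝓥} [IsProbabilityMeasure ν] (hX : AEMeasurable X P) (hV : AEMeasurable V P)
    (hXV : P.map (fun o => (X o, V o)) = ρ.prod ν) {Ψ : ℝ × 𝓥 → ℝ} (hΨ : Measurable Ψ)
    (hW : W =ᵐ[P] fun o => Ψ (X o, V o)) :
    ∀ᵐ x ∂(P.map X), condDistrib W X P x = ν.map fun v => Ψ (x, v) := by
  have hWm : AEMeasurable (fun o => Ψ (X o, V o)) P := hΨ.comp_aemeasurable (hX.prodMk hV)
  have hXlaw : P.map X = ρ := by
    have h1 := congrArg (fun m => m.map Prod.fst) hXV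
    simp only [Measure.map_fst_prod, measure_univ, one_smul] at h1
    rw [← h1, AEMeasurable.map_map_of_aemeasurable (by fun_prop) (hX.prodMk hV)]
    rfl
  let κ : Kernel ℝ ℝ := (Kernel.id ×ₖ Kernel.const ℝ ν).map Ψ
  have hκ : ∀ x, κ x = ν.map fun v => Ψ (x, v) := fun x => by
    rw [Kernel.map_apply _ hΨ, Kernel.prod_apply, Kernel.id_apply, Kernel.const_apply,
      Measure.dirac_prod, Measure.map_map hΨ (by fun_prop)]
    rfl
  have : IsMarkovKernel κ := Kernel.IsMarkovKernel.map _ hΨ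
  rw [condDistrib_congr_left hW]
  have h1 : condDistrib (fun o => Ψ (X o, V o)) X P =ᵐ[P.map X] κ := by
    refine condDistrib_ae_eq_of_measure_eq_compProd X hWm ?_
    have h2 : P.map (fun o => (X o, Ψ (X o, V o))) =
        (ρ.prod ν).map fun q => (q.1, Ψ q) := by
      rw [← hXV, AEMeasurable.map_map_of_aemeasurable (by fun_prop) (hX.prodMk hV)]
      rfl
    rw [h2, hXlaw]
    refine Measure.ext_of_lintegral _ fun f hf => ?_
    rw [lintegral_map hf (by fun_prop), lintegral_prod _ (by fun_prop),
      Measure.lintegral_compProd hf]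
    refine lintegral_congr fun x => ?_
    rw [hκ, lintegral_map (by fun_prop) (by fun_prop)]
  filter_upwards [h1] with x hx
  rw [hx, hκ]

/-! ### The standard normal distribution function -/

lemma Phi_mem_Icc (x : ℝ) : Phi x ∈ Icc (0 : ℝ) 1 := ⟨cdf_nonneg _ _, cdf_le_one _ _⟩

lemma monotone_Phi : Monotone Phi := monotone_cdf _

lemma tendsto_Phi_atBot : Tendsto Phi atBot (𝓝 0) := tendsto_cdf_atBot _

lemma tendsto_Phi_atTop : Tendsto Phi atTop (𝓝 1) := tendsto_cdf_atTop _

lemma measurable_Phi : Measurable Phi := monotone_Phi.measurable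

lemma norm_Phi_le_one (x : ℝ) : ‖Phi x‖ ≤ 1 := by
  rw [Real.norm_eq_abs, abs_of_nonneg (Phi_mem_Icc x).1]; exact (Phi_mem_Icc x).2

lemma Phi_sub_Phi {a b : ℝ} (hab : a ≤ b) :
    Phi b - Phi a = ∫ x in Ioc a b, gaussianPDFReal 0 1 x := by
  have h1 : (gaussianReal 0 1).real (Ioc a b) = Phi b - Phi a := by
    have h2 := measureReal_sdiff (μ := gaussianReal 0 1) (Iic_subset_Iic.2 hab) measurableSet_Iic
    rw [Iic_sdiff_Iic] at h2
    rw [h2, Phi, Phi, cdf_eq_real, cdf_eq_real]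
  rw [← h1, measureReal_def, gaussianReal_apply_eq_integral _ (by norm_num), ENNReal.toReal_ofReal]
  exact integral_nonneg fun x => gaussianPDFReal_nonneg _ _ _

lemma gaussianPDFReal_le_one (x : ℝ) : gaussianPDFReal 0 1 x ≤ 1 := by
  rw [gaussianPDFReal]
  have h1 : (√(2 * Real.pi * (1 : NNReal)))⁻¹ ≤ 1 := by
    apply inv_le_one_of_one_le₀
    rw [Real.one_le_sqrt]
    simp only [NNReal.coe_one, mul_one]
    linarith [Real.pi_gt_three]
  have h2 : Real.exp (-(x - 0) ^ 2 / (2 * (1 : NNReal))) ≤ 1 := by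
    rw [Real.exp_le_one_iff]
    simp only [NNReal.coe_one, mul_one, sub_zero]
    have := sq_nonneg x
    linarith
  exact mul_le_one₀ h1 (Real.exp_pos _).le h2

lemma gaussianPDFReal_anti_abs {x y : ℝ} (h : |x| ≤ y) :
    gaussianPDFReal 0 1 y ≤ gaussianPDFReal 0 1 x := by
  rw [gaussianPDFReal, gaussianPDFReal]
  have : x ^ 2 ≤ y ^ 2 := by rw [← sq_abs]; exact pow_le_pow_left₀ (abs_nonneg _) h 2
  simp only [NNReal.coe_one, mul_one, sub_zero]
  gcongr

lemma Phi_le_add {a b : ℝ} (hab : a ≤ b) : Phi b ≤ Phi a + (b - a) := by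
  have h1 : ∫ x in Ioc a b, gaussianPDFReal 0 1 x ≤ ∫ _ in Ioc a b, (1 : ℝ) :=
    setIntegral_mono (integrable_gaussianPDFReal 0 1).integrableOn (by simp)
      gaussianPDFReal_le_one
  rw [← Phi_sub_Phi hab] at h1
  simp [hab] at h1
  linarith

/-- A lower bound for the increments of `Phi`, uniform over bounded starting points. -/
lemma Phi_add_le {x δ A : ℝ} (hx : |x| ≤ A) (hδ : 0 ≤ δ) :
    Phi x + δ * gaussianPDFReal 0 1 (A + δ) ≤ Phi (x + δ) := by
  have h1 : ∫ _ in Ioc x (x + δ), gaussianPDFReal 0 1 (A + δ) ≤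
      ∫ y in Ioc x (x + δ), gaussianPDFReal 0 1 y := by
    refine setIntegral_mono_on (by simp) (integrable_gaussianPDFReal 0 1).integrableOn
      measurableSet_Ioc fun y hy => gaussianPDFReal_anti_abs ?_
    rw [abs_le] at hx ⊢
    constructor <;> linarith [hy.1, hy.2, hx.1, hx.2]
  rw [← Phi_sub_Phi (by linarith)] at h1
  simp [hδ] at h1
  linarith

lemma continuous_Phi : Continuous Phi := by
  have : LipschitzWith 1 Phi := by
    refine LipschitzWith.of_le_add fun x y => ?_
    rw [Real.dist_eq]
    rcases le_total y x with h | h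
    · rw [abs_of_nonneg (sub_nonneg.2 h)]; exact Phi_le_add h
    · linarith [monotone_Phi h, abs_nonneg (x - y)]
  exact this.continuous

lemma cdf_gaussianReal_eq_Phi {v : ℝ} (hv : 0 < v) (t : ℝ) :
    (gaussianReal 0 v.toNNReal).real (Iic t) = Phi (t / √v) := by
  have h1 : (gaussianReal 0 1).map (fun x => √v * x) = gaussianReal 0 v.toNNReal := by
    rw [gaussianReal_map_const_mul, mul_zero, mul_one]
    congr 1
    ext
    simp [Real.sq_sqrt hv.le, hv.le]
  have h2 : 0 < √v := Real.sqrt_pos.2 hv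
  rw [← h1, map_measureReal_apply (by fun_prop) measurableSet_Iic, Phi, cdf_eq_real]
  congr 1
  ext x
  simp only [mem_preimage, mem_Iic, le_div_iff₀ h2, mul_comm]

/-! ### Mixtures of normal distribution functions -/

/-- Mixtures over `y` of the normal distribution functions `s ↦ Φ(a_i(y) s - b_i(y))` form a uniform
family when the slopes are bounded below by a positive constant, and slopes and shifts are
dominated by integrable functions. -/
lemma isUniformFamily_mixture {ι : Type*} {ν : Measure ℝ} [IsProbabilityMeasure ν]
    {a b : ι → ℝ → ℝ} {U B : ℝ → ℝ} {κ : ℝ} (hκ : 0 < κ) (ha : ∀ i, Measurable (a i))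
    (hb : ∀ i, Measurable (b i)) (hU : Integrable U ν) (hB : Integrable B ν)
    (hbound : ∀ i, ∀ᵐ y ∂ν, κ ≤ a i y ∧ a i y ≤ U y ∧ |b i y| ≤ B y) :
    IsUniformFamily fun i s => ∫ y, Phi (s * a i y - b i y) ∂ν := by
  have hint : ∀ {g : ℝ → ℝ}, AEMeasurable g ν → Integrable (fun y => Phi (g y)) ν := fun hg =>
    Integrable.of_bound (measurable_Phi.comp_aemeasurable hg).aestronglyMeasurable 1
      (ae_of_all _ fun y => norm_Phi_le_one _)
  have hmeas : ∀ i s, AEMeasurable (fun y => s * a i y - b i y) ν := fun i s =>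
    (((ha i).const_mul s).sub (hb i)).aemeasurable
  have hBm : AEMeasurable B ν := hB.aemeasurable
  have hUm : AEMeasurable U ν := hU.aemeasurable
  -- the tail bounds come from the smallest slope `κ` and the largest shift `B y`
  refine ⟨fun i s => ⟨integral_nonneg fun y => (Phi_mem_Icc _).1, ?_⟩, ⟨∫ y, U y ∂ν, ?_⟩, ?_,
    ⟨fun s => ∫ y, Phi (κ * s + B y) ∂ν, ?_, ?_⟩, ⟨fun s => ∫ y, Phi (κ * s - B y) ∂ν, ?_, ?_⟩⟩
  · calc ∫ y, Phi (s * a i y - b i y) ∂ν ≤ ∫ _, (1 : ℝ) ∂ν :=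
          integral_mono (hint (hmeas i s)) (integrable_const 1) fun y => (Phi_mem_Icc _).2
      _ = 1 := by simp
  · intro i s t hst
    rw [mul_comm, ← integral_const_mul,
      ← integral_add (hint (hmeas i s)) (hU.const_mul (t - s))]
    refine integral_mono_ae (hint (hmeas i t)) ((hint (hmeas i s)).add (hU.const_mul _)) ?_
    filter_upwards [hbound i] with y hy
    have h0 : 0 ≤ t - s := by linarith
    have h1 : (t - s) * a i y ≤ (t - s) * U y := mul_le_mul_of_nonneg_left hy.2.1 h0
    have h2 : 0 ≤ (t - s) * a i y := mul_nonneg h0 (hκ.le.trans hy.1)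
    have h3 := Phi_le_add (show s * a i y - b i y ≤ t * a i y - b i y by linarith)
    linarith
  · intro s t hst
    have hδ : 0 < (t - s) * κ := mul_pos (by linarith) hκ
    set f : ℝ → ℝ := fun y =>
      (t - s) * κ * gaussianPDFReal 0 1 (|s| * U y + B y + (t - s) * κ) with hf
    have hfpos : ∀ y, 0 < f y := fun y => mul_pos hδ (gaussianPDFReal_pos _ _ _ (by norm_num))
    have hfm : AEMeasurable f ν := ((measurable_gaussianPDFReal 0 1).comp_aemeasurable
      (((hUm.const_mul _).add hBm).add_const _)).const_mul _
    have hfint : Integrable f ν := by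
      refine Integrable.of_bound hfm.aestronglyMeasurable ((t - s) * κ) (ae_of_all _ fun y => ?_)
      rw [Real.norm_eq_abs, abs_of_pos (hfpos y)]
      exact mul_le_of_le_one_right hδ.le (gaussianPDFReal_le_one _)
    refine ⟨∫ y, f y ∂ν, ?_, fun i => ?_⟩
    · rw [gt_iff_lt, integral_pos_iff_support_of_nonneg (fun y => (hfpos y).le) hfint]
      have : Function.support f = univ := by
        ext y; simp [(hfpos y).ne']
      simp [this]
    · rw [← integral_add (hint (hmeas i s)) hfint]
      refine integral_mono_ae ((hint (hmeas i s)).add hfint) (hint (hmeas i t)) ?_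
      filter_upwards [hbound i] with y hy
      have h0 : 0 ≤ t - s := by linarith
      have ha0 : 0 ≤ a i y := hκ.le.trans hy.1
      have hA : |s * a i y - b i y| ≤ |s| * U y + B y := by
        calc |s * a i y - b i y| ≤ |s * a i y| + |b i y| := abs_sub _ _
          _ = |s| * a i y + |b i y| := by rw [abs_mul, abs_of_nonneg ha0]
          _ ≤ _ := add_le_add (mul_le_mul_of_nonneg_left hy.2.1 (abs_nonneg _)) hy.2.2
      refine (Phi_add_le hA hδ.le).trans (monotone_Phi ?_)
      have := mul_le_mul_of_nonneg_left hy.1 h0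
      linarith
  · have h1 := tendsto_integral_filter_of_dominated_convergence (μ := ν) (l := atBot)
      (F := fun (s : ℝ) y => Phi (κ * s + B y)) (f := fun _ => 0) (fun _ => (1 : ℝ))
      (Eventually.of_forall fun s =>
        (hint (hBm.const_add (κ * s))).aestronglyMeasurable)
      (Eventually.of_forall fun s => ae_of_all _ fun y => norm_Phi_le_one _) (integrable_const 1)
      (ae_of_all _ fun y => tendsto_Phi_atBot.comp
        (tendsto_atBot_add_const_right _ _ (tendsto_id.const_mul_atBot hκ)))
    simpa using h1
  · intro s hs i
    refine integral_mono_ae (hint (hmeas i s)) (hint (hBm.const_add (κ * s))) ?_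
    filter_upwards [hbound i] with y hy
    refine monotone_Phi ?_
    have h1 := mul_le_mul_of_nonpos_left hy.1 hs
    have h2 := (abs_le.1 hy.2.2).1
    linarith
  · have h1 := tendsto_integral_filter_of_dominated_convergence (μ := ν) (l := atTop)
      (F := fun (s : ℝ) y => Phi (κ * s - B y)) (f := fun _ => 1) (fun _ => (1 : ℝ))
      (Eventually.of_forall fun s =>
        (hint (hBm.const_sub (κ * s))).aestronglyMeasurable)
      (Eventually.of_forall fun s => ae_of_all _ fun y => norm_Phi_le_one _) (integrable_const 1)
      (ae_of_all _ fun y => tendsto_Phi_atTop.comp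
        (tendsto_atTop_add_const_right _ (-B y) (tendsto_id.const_mul_atTop hκ)))
    simpa using h1
  · intro s hs i
    refine integral_mono_ae (hint (hBm.const_sub (κ * s))) (hint (hmeas i s)) ?_
    filter_upwards [hbound i] with y hy
    refine monotone_Phi ?_
    have h1 := mul_le_mul_of_nonneg_left hy.1 hs
    have h2 := (abs_le.1 hy.2.2).2
    linarith

/-! ### The explicit conditional distribution functions -/

section Explicit

variable {n : ℕ}

lemma measurable_condShift (n : ℕ) (h w : ℝ) : Measurable (condShift n h w) := by
  unfold condShift; fun_prop

lemma measurable_condScale (n : ℕ) (γ h w : ℝ) : Measurable (condScale n γ h w) := by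
  unfold condScale; fun_prop

lemma sqrt_rpow_le_condScale (n : ℕ) (γ h w y : ℝ) :
    √((n : ℝ) ^ (-γ)) ≤ condScale n γ h w y :=
  Real.sqrt_le_sqrt (le_max_left _ _)

lemma sqrt_rpow_pos (hn : 3 ≤ n) (γ : ℝ) : 0 < √((n : ℝ) ^ (-γ)) := by
  have h3 := three_le_cast hn
  exact Real.sqrt_pos.2 (Real.rpow_pos_of_pos (by linarith) _)

lemma condScale_pos (hn : 3 ≤ n) (γ h w y : ℝ) : 0 < condScale n γ h w y :=
  (sqrt_rpow_pos hn γ).trans_le (sqrt_rpow_le_condScale n γ h w y)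

lemma condScale_le (hn : 3 ≤ n) {γ : ℝ} (hγ : 0 < γ) (h : ℝ) {w y : ℝ} (hw : w ∈ Ioo (0 : ℝ) 1)
    (hy : 0 < y) : condScale n γ h w y ≤ 1 + √|coefOne n h| * (√y)⁻¹ := by
  have h3 := three_le_cast hn
  have hn1 : (n : ℝ) ^ (-γ) ≤ 1 := Real.rpow_le_one_of_one_le_of_nonpos (by linarith) (by linarith)
  have hc : 0 ≤ √|coefOne n h| * (√y)⁻¹ := by positivity
  refine Real.sqrt_le_iff.2 ⟨by positivity, ?_⟩
  have hsq : (√|coefOne n h| * (√y)⁻¹) ^ 2 = |coefOne n h| / y := by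
    rw [mul_pow, Real.sq_sqrt (abs_nonneg _), inv_pow, Real.sq_sqrt hy.le, div_eq_mul_inv]
  have hle : -(coefOne n h * w / y) ≤ |coefOne n h| / y := by
    rw [← neg_div]
    gcongr
    calc -(coefOne n h * w) ≤ |coefOne n h * w| := neg_le_abs _
      _ = |coefOne n h| * w := by rw [abs_mul, abs_of_pos hw.1]
      _ ≤ |coefOne n h| := mul_le_of_le_one_right (abs_nonneg _) hw.2.le
  have h0 : 0 ≤ |coefOne n h| / y := by positivity
  refine max_le ?_ ?_ <;> nlinarith

lemma abs_condShift_le (hn : 3 ≤ n) (h : ℝ) {w y : ℝ} (hw : w ∈ Ioo (0 : ℝ) 1) :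
    |condShift n h w y| ≤ |coefTwo n h| * (√y + coefThree n * (√y)⁻¹) := by
  have h3 := three_le_cast hn
  have hc3 : 0 ≤ coefThree n := div_nonneg (by linarith) (by linarith)
  have hw1 : √w ≤ 1 := Real.sqrt_le_one.2 hw.2.le
  rw [condShift, abs_mul, abs_mul, abs_of_nonneg (Real.sqrt_nonneg w), mul_assoc]
  refine mul_le_mul_of_nonneg_left ?_ (abs_nonneg _)
  have h1 : |√y - coefThree n / √y| ≤ √y + coefThree n * (√y)⁻¹ := by
    refine (abs_sub _ _).trans ?_
    rw [abs_of_nonneg (Real.sqrt_nonneg y), abs_of_nonneg (by positivity), div_eq_mul_inv]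
  calc √w * |√y - coefThree n / √y| ≤ 1 * |√y - coefThree n / √y| := by gcongr
    _ ≤ _ := by rw [one_mul]; exact h1

lemma residVar_bounds (hn : 3 ≤ n) {w : ℝ} (hw : w ∈ Ioo (0 : ℝ) 1) :
    1 / (n : ℝ) ≤ 1 - w * ((n : ℝ) - 1) / n ∧ 1 - w * ((n : ℝ) - 1) / n ≤ 1 := by
  have h3 := three_le_cast hn
  have hn0 : (0 : ℝ) < n := by linarith
  have hp : (0 : ℝ) ≤ n - 1 := by linarith
  constructor
  · rw [le_sub_iff_add_le, ← add_div, div_le_one hn0]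
    nlinarith [mul_le_mul_of_nonneg_right hw.2.le hp]
  · have : 0 ≤ w * ((n : ℝ) - 1) / n := div_nonneg (mul_nonneg hw.1.le hp) hn0.le
    linarith

lemma residVar_pos (hn : 3 ≤ n) {w : ℝ} (hw : w ∈ Ioo (0 : ℝ) 1) :
    0 < 1 - w * ((n : ℝ) - 1) / n := by
  have h3 := three_le_cast hn
  exact (show (0 : ℝ) < 1 / n by positivity).trans_le (residVar_bounds hn hw).1

lemma inv_sqrt_residVar_bounds (hn : 3 ≤ n) {w : ℝ} (hw : w ∈ Ioo (0 : ℝ) 1) :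
    1 ≤ (√(1 - w * ((n : ℝ) - 1) / n))⁻¹ ∧ (√(1 - w * ((n : ℝ) - 1) / n))⁻¹ ≤ √(n : ℝ) := by
  have h3 := three_le_cast hn
  have hn0 : (0 : ℝ) < n := by linarith
  have hv := Real.sqrt_pos.2 (residVar_pos hn hw)
  constructor
  · exact (one_le_inv₀ hv).2 (Real.sqrt_le_one.2 (residVar_bounds hn hw).2)
  · rw [inv_le_comm₀ hv (Real.sqrt_pos.2 hn0), ← Real.sqrt_inv, ← one_div]
    exact Real.sqrt_le_sqrt (residVar_bounds hn hw).1

/-- The slopes are at least `n ^ (-γ / 2)`, because the variance estimate is truncated and the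
residual standard deviation is at most `1`; the latter is at least `n ^ (-1 / 2)`, which bounds
slopes and shifts uniformly in `w`. -/
lemma isUniformFamily_explicitCDF (hn : 3 ≤ n) {γ : ℝ} (hγ : 0 < γ) (h : ℝ) :
    IsUniformFamily fun (w : Ioo (0 : ℝ) 1) s => explicitCDF n γ h w s := by
  have h3 := three_le_cast hn
  have := isProbabilityMeasure_scaledChiSq (show (0 : ℝ) < n - 1 by linarith)
  have hi1 := integrable_sqrt_scaledChiSq (show (0 : ℝ) < n - 1 by linarith)
  have hi2 := integrable_inv_sqrt_scaledChiSq (show (1 : ℝ) < n - 1 by linarith)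
  have hmain := isUniformFamily_mixture (ν := scaledChiSq ((n : ℝ) - 1)) (ι := Ioo (0 : ℝ) 1)
    (a := fun w y => condScale n γ h w y * (√(1 - w * ((n : ℝ) - 1) / n))⁻¹)
    (b := fun w y => condShift n h w y * (√(1 - w * ((n : ℝ) - 1) / n))⁻¹)
    (U := fun y => (1 + √|coefOne n h| * (√y)⁻¹) * √(n : ℝ))
    (B := fun y => |coefTwo n h| * (√y + coefThree n * (√y)⁻¹) * √(n : ℝ))
    (sqrt_rpow_pos hn γ) (fun w => (measurable_condScale n γ h w).mul_const _)
    (fun w => (measurable_condShift n h w).mul_const _)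
    (((integrable_const 1).add (hi2.const_mul _)).mul_const _)
    (((hi1.add (hi2.const_mul _)).const_mul _).mul_const _) (by
      intro w
      filter_upwards [ae_pos_gammaMeasure (((n : ℝ) - 1) / 2) (((n : ℝ) - 1) / 2)] with y hy
      obtain ⟨hd1, hd2⟩ := inv_sqrt_residVar_bounds hn w.2
      have hs := condScale_pos hn γ h w y
      refine ⟨?_, ?_, ?_⟩
      · exact (sqrt_rpow_le_condScale n γ h w y).trans (le_mul_of_one_le_right hs.le hd1)
      · exact mul_le_mul (condScale_le hn hγ h w.2 hy) hd2 (by positivity) (by positivity)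
      · rw [abs_mul, abs_of_nonneg (zero_le_one.trans hd1)]
        exact mul_le_mul (abs_condShift_le hn h w.2) hd2 (by positivity)
          ((abs_nonneg _).trans (abs_condShift_le hn h w.2)))
  convert! hmain using 5 with w s
  rw [explicitCDF_eq hn]
  refine integral_congr_ae (ae_of_all _ fun y => ?_)
  simp only [div_eq_mul_inv, sub_mul, mul_assoc]

instance nonempty_Ioo_zero_one : Nonempty (Ioo (0 : ℝ) 1) := ⟨⟨1 / 2, by norm_num⟩⟩

lemma isStrictCDF_explicitCDF (hn : 3 ≤ n) {γ : ℝ} (hγ : 0 < γ) (h : ℝ) {w : ℝ}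
    (hw : w ∈ Ioo (0 : ℝ) 1) : IsStrictCDF (explicitCDF n γ h w) :=
  (isUniformFamily_explicitCDF hn hγ h).isStrictCDF ⟨w, hw⟩

lemma isStrictCDF_lowerCDF (hn : 3 ≤ n) {γ : ℝ} (hγ : 0 < γ) (h : ℝ) :
    IsStrictCDF (lowerCDF n γ h) :=
  (isUniformFamily_explicitCDF hn hγ h).isStrictCDF_iInf

lemma isStrictCDF_upperCDF (hn : 3 ≤ n) {γ : ℝ} (hγ : 0 < γ) (h : ℝ) :
    IsStrictCDF (upperCDF n γ h) :=
  (isUniformFamily_explicitCDF hn hγ h).isStrictCDF_iSup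

lemma lowerCDF_le_explicitCDF (hn : 3 ≤ n) {γ : ℝ} (hγ : 0 < γ) (h s : ℝ) {w : ℝ}
    (hw : w ∈ Ioo (0 : ℝ) 1) : lowerCDF n γ h s ≤ explicitCDF n γ h w s :=
  ciInf_le ((isUniformFamily_explicitCDF hn hγ h).bddBelow s) ⟨w, hw⟩

lemma explicitCDF_le_upperCDF (hn : 3 ≤ n) {γ : ℝ} (hγ : 0 < γ) (h s : ℝ) {w : ℝ}
    (hw : w ∈ Ioo (0 : ℝ) 1) : explicitCDF n γ h w s ≤ upperCDF n γ h s :=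
  le_ciSup ((isUniformFamily_explicitCDF hn hγ h).bddAbove s) ⟨w, hw⟩

lemma lowerCDF_le_upperCDF (hn : 3 ≤ n) {γ : ℝ} (hγ : 0 < γ) (h s : ℝ) :
    lowerCDF n γ h s ≤ upperCDF n γ h s :=
  have hw : (1 / 2 : ℝ) ∈ Ioo (0 : ℝ) 1 := by norm_num
  (lowerCDF_le_explicitCDF hn hγ h s hw).trans (explicitCDF_le_upperCDF hn hγ h s hw)

lemma starCDF_eq_starOf (n : ℕ) (γ h : ℝ) :
    starCDF n γ h = starOf (lowerCDF n γ h) (upperCDF n γ h) := rfl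

/-- Joint continuity in `h` and `s`; it makes the envelopes semicontinuous, hence measurable. -/
lemma continuous_explicitCDF (hn : 3 ≤ n) (γ w : ℝ) :
    Continuous fun q : ℝ × ℝ => explicitCDF n γ q.1 w q.2 := by
  have h3 := three_le_cast hn
  have := isProbabilityMeasure_scaledChiSq (show (0 : ℝ) < n - 1 by linarith)
  have hK : ∀ h : ℝ, h ^ 2 + (n : ℝ) - 2 ≠ 0 := fun h => by nlinarith [sq_nonneg h]
  have hn0 : (n : ℝ) ≠ 0 := by linarith
  have hK2 : ∀ h : ℝ, √((n : ℝ) * (h ^ 2 + n - 2)) ≠ 0 := fun h =>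
    (Real.sqrt_pos.2 (mul_pos (by linarith) (by nlinarith [sq_nonneg h]))).ne'
  have hc1 : Continuous (coefOne n) := by
    unfold coefOne
    exact Continuous.div (by fun_prop) (by fun_prop) fun h => mul_ne_zero hn0 (hK h)
  have hc2 : Continuous (coefTwo n) := by
    unfold coefTwo
    exact Continuous.div (by fun_prop) (by fun_prop) hK2
  simp_rw [explicitCDF_eq hn]
  refine continuous_of_dominated (bound := fun _ => 1) (fun q => ?_)
    (fun q => ae_of_all _ fun y => norm_Phi_le_one _) (integrable_const 1)
    (ae_of_all _ fun y => ?_)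
  · exact (measurable_Phi.comp ((((measurable_condScale n γ q.1 w).const_mul q.2).sub
      (measurable_condShift n q.1 w)).div_const _)).aestronglyMeasurable
  · refine continuous_Phi.comp (Continuous.div_const ?_ _)
    unfold condScale condShift
    fun_prop

lemma measurable_explicitCDF (hn : 3 ≤ n) (γ w : ℝ) :
    Measurable fun q : ℝ × ℝ => explicitCDF n γ q.1 w q.2 :=
  (continuous_explicitCDF hn γ w).measurable

lemma measurable_upperCDF (hn : 3 ≤ n) {γ : ℝ} (hγ : 0 < γ) :
    Measurable fun q : ℝ × ℝ => upperCDF n γ q.1 q.2 :=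
  (lowerSemicontinuous_ciSup
    (fun q : ℝ × ℝ => (isUniformFamily_explicitCDF hn hγ q.1).bddAbove q.2)
    fun w : Ioo (0 : ℝ) 1 => (continuous_explicitCDF hn γ w).lowerSemicontinuous).measurable

lemma measurable_lowerCDF (hn : 3 ≤ n) {γ : ℝ} (hγ : 0 < γ) :
    Measurable fun q : ℝ × ℝ => lowerCDF n γ q.1 q.2 :=
  (upperSemicontinuous_ciInf
    (fun q : ℝ × ℝ => (isUniformFamily_explicitCDF hn hγ q.1).bddBelow q.2)
    fun w : Ioo (0 : ℝ) 1 => (continuous_explicitCDF hn γ w).upperSemicontinuous).measurable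

end Explicit

/-! ### Asymptotic normality of the explicit distribution functions -/

section Limit

lemma tendsto_const_div_cast (c : ℝ) : Tendsto (fun n : ℕ => c / (n : ℝ)) atTop (𝓝 0) :=
  tendsto_const_nhds.div_atTop tendsto_natCast_atTop_atTop

lemma tendsto_coefOne (h : ℝ) : Tendsto (fun n : ℕ => coefOne n h) atTop (𝓝 1) := by
  have h1 : Tendsto (fun n : ℕ => (1 - 2 / (n : ℝ)) * (1 - (3 + h ^ 2) / n) /
      (1 + (h ^ 2 - 2) / n)) atTop (𝓝 ((1 - 0) * (1 - 0) / (1 + 0))) :=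
    (((tendsto_const_div_cast 2).const_sub 1).mul
      ((tendsto_const_div_cast (3 + h ^ 2)).const_sub 1)).div
      ((tendsto_const_div_cast (h ^ 2 - 2)).const_add 1) (by norm_num)
  norm_num at h1
  refine h1.congr' ?_
  filter_upwards [eventually_ge_atTop 3] with n hn
  have h3 := three_le_cast hn
  have hK : h ^ 2 + (n : ℝ) - 2 ≠ 0 := by nlinarith [sq_nonneg h]
  have hn0 : (n : ℝ) ≠ 0 := by linarith
  have hK' : 1 + (h ^ 2 - 2) / (n : ℝ) = (h ^ 2 + n - 2) / n := by field_simp; ring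
  rw [coefOne, hK']
  field_simp
  ring

lemma tendsto_coefTwo (h : ℝ) : Tendsto (fun n : ℕ => coefTwo n h) atTop (𝓝 h) := by
  have h1 : Tendsto (fun n : ℕ => (1 - 1 / (n : ℝ)) * h / √(1 + (h ^ 2 - 2) / n)) atTop
      (𝓝 ((1 - 0) * h / √(1 + 0))) :=
    (((tendsto_const_div_cast 1).const_sub 1).mul_const h).div
      (((tendsto_const_div_cast (h ^ 2 - 2)).const_add 1).sqrt) (by norm_num)
  norm_num at h1
  refine h1.congr' ?_
  filter_upwards [eventually_ge_atTop 3] with n hn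
  have h3 := three_le_cast hn
  have hn0 : (0 : ℝ) < n := by linarith
  have hK : 0 < h ^ 2 + (n : ℝ) - 2 := by nlinarith [sq_nonneg h]
  have hK' : 1 + (h ^ 2 - 2) / (n : ℝ) = (n * (h ^ 2 + n - 2)) / n ^ 2 := by field_simp; ring
  have hs : √((n : ℝ) * (h ^ 2 + n - 2)) ≠ 0 := (Real.sqrt_pos.2 (mul_pos hn0 hK)).ne'
  rw [coefTwo, hK', Real.sqrt_div (by positivity), Real.sqrt_sq hn0.le]
  field_simp

lemma tendsto_coefThree : Tendsto coefThree atTop (𝓝 1) := by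
  have h1 : Tendsto (fun n : ℕ => (1 - 2 / (n : ℝ)) / (1 - 1 / (n : ℝ))) atTop
      (𝓝 ((1 - 0) / (1 - 0))) :=
    ((tendsto_const_div_cast 2).const_sub 1).div ((tendsto_const_div_cast 1).const_sub 1)
      (by norm_num)
  norm_num at h1
  refine h1.congr' ?_
  filter_upwards [eventually_ge_atTop 3] with n hn
  have h3 := three_le_cast hn
  have hn0 : (n : ℝ) ≠ 0 := by linarith
  have hp : (n : ℝ) - 1 ≠ 0 := by linarith
  have hp' : 1 - (n : ℝ)⁻¹ = (n - 1) / n := by field_simp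
  rw [coefThree, hp']
  field_simp

/-- As `n → ∞` and `y → 1`, the argument of `Φ` in the explicit distribution function tends to
`s`. -/
lemma tendsto_condArg {γ w : ℝ} (hγ : 0 < γ) (hw : w ∈ Ioo (0 : ℝ) 1) (h s : ℝ) :
    Tendsto (fun q : ℕ × ℝ => (s * condScale q.1 γ h w q.2 - condShift q.1 h w q.2) /
      √(1 - w * ((q.1 : ℝ) - 1) / q.1)) (atTop ×ˢ 𝓝 1) (𝓝 s) := by
  have hfst : Tendsto (fun q : ℕ × ℝ => q.1) (atTop ×ˢ 𝓝 (1 : ℝ)) atTop := tendsto_fst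
  have hy : Tendsto (fun q : ℕ × ℝ => q.2) (atTop ×ˢ 𝓝 (1 : ℝ)) (𝓝 1) := tendsto_snd
  have hpow : Tendsto (fun n : ℕ => (n : ℝ) ^ (-γ)) atTop (𝓝 0) :=
    (tendsto_rpow_neg_atTop hγ).comp tendsto_natCast_atTop_atTop
  have hscale : Tendsto (fun q : ℕ × ℝ => condScale q.1 γ h w q.2) (atTop ×ˢ 𝓝 (1 : ℝ))
      (𝓝 √(max 0 (1 - 1 * w / 1))) :=
    ((hpow.comp hfst).max ((((tendsto_coefOne h).comp hfst).mul_const w).div hy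
      one_ne_zero |>.const_sub 1)).sqrt
  have hsq : Tendsto (fun q : ℕ × ℝ => √q.2) (atTop ×ˢ 𝓝 (1 : ℝ)) (𝓝 1) := by
    simpa using hy.sqrt
  have hshift : Tendsto (fun q : ℕ × ℝ => condShift q.1 h w q.2) (atTop ×ˢ 𝓝 (1 : ℝ))
      (𝓝 (h * √w * (1 - 1 / 1))) :=
    (((tendsto_coefTwo h).comp hfst).mul_const √w).mul
      (hsq.sub ((tendsto_coefThree.comp hfst).div hsq one_ne_zero))
  have hden : Tendsto (fun n : ℕ => √(1 - w * ((n : ℝ) - 1) / n)) atTop (𝓝 √(1 - w)) := by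
    have h1 : Tendsto (fun n : ℕ => √(1 - (w - w / (n : ℝ)))) atTop (𝓝 √(1 - (w - 0))) :=
      (((tendsto_const_div_cast w).const_sub w).const_sub 1).sqrt
    rw [sub_zero] at h1
    refine h1.congr' ?_
    filter_upwards [eventually_ge_atTop 1] with n hn
    have hn0 : (n : ℝ) ≠ 0 := by positivity
    congr 2
    field_simp
  have hpos : 0 < √(1 - w) := Real.sqrt_pos.2 (by linarith [hw.2])
  have hlim := ((hscale.const_mul s).sub hshift).div (hden.comp hfst) hpos.ne'
  have hval : (s * √(max 0 (1 - 1 * w / 1)) - h * √w * (1 - 1 / 1)) / √(1 - w) = s := by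
    rw [one_mul, div_one, max_eq_right (by linarith [hw.2])]
    field_simp
    ring
  rw [hval] at hlim
  exact hlim

/-- A quantitative form of the law of large numbers: a `[0, 1]`-valued function which is close to
`c` near `1` has a mean close to `c` under a distribution with small second moment about `1`. -/
lemma abs_integral_sub_le_of_close_near_one {ν : Measure ℝ} [IsProbabilityMeasure ν] {f : ℝ → ℝ}
    (hfm : Measurable f) (hf01 : ∀ y, f y ∈ Icc (0 : ℝ) 1) {c : ℝ} (hc : c ∈ Icc (0 : ℝ) 1)
    (hsq : Integrable (fun y => (y - 1) ^ 2) ν) {δ η : ℝ} (hδ : 0 < δ) (hη : 0 ≤ η)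
    (hclose : ∀ y, |y - 1| < δ → |f y - c| ≤ η) :
    |∫ y, f y ∂ν - c| ≤ η + (∫ y, (y - 1) ^ 2 ∂ν) / δ ^ 2 := by
  have hfint : Integrable f ν :=
    Integrable.of_bound hfm.aestronglyMeasurable 1 (ae_of_all _ fun y => by
      rw [Real.norm_eq_abs, abs_of_nonneg (hf01 y).1]; exact (hf01 y).2)
  have hpt : ∀ y, |f y - c| ≤ η + (y - 1) ^ 2 / δ ^ 2 := by
    intro y
    have h5 : 0 ≤ (y - 1) ^ 2 / δ ^ 2 := by positivity
    by_cases hy : |y - 1| < δ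
    · linarith [hclose y hy]
    · have h6 : 1 ≤ (y - 1) ^ 2 / δ ^ 2 := by
        rw [le_div_iff₀ (by positivity), one_mul, ← sq_abs (y - 1)]
        exact pow_le_pow_left₀ hδ.le (not_lt.1 hy) 2
      have h7 : |f y - c| ≤ 1 := by
        have h8 := hf01 y
        rw [abs_le]
        constructor <;> linarith [h8.1, h8.2, hc.1, hc.2]
      linarith
  have hE : ∫ y, f y ∂ν - c = ∫ y, (f y - c) ∂ν := by
    rw [integral_sub hfint (integrable_const _)]
    simp
  rw [hE]
  calc |∫ y, (f y - c) ∂ν| ≤ ∫ y, |f y - c| ∂ν := abs_integral_le_integral_abs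
    _ ≤ ∫ y, (η + (y - 1) ^ 2 / δ ^ 2) ∂ν :=
        integral_mono (hfint.sub (integrable_const _)).abs
          ((integrable_const _).add (hsq.div_const _)) hpt
    _ = η + (∫ y, (y - 1) ^ 2 ∂ν) / δ ^ 2 := by
        rw [integral_add (integrable_const _) (hsq.div_const _), integral_div]
        simp

/-- Chebyshev's inequality for the rescaled chi-square variable, which has mean `1` and variance
`2 / (n - 1)`, applied to the mixture of normal distribution functions. -/
lemma abs_explicitCDF_sub_le {n : ℕ} (hn : 3 ≤ n) {γ w h s δ η : ℝ} (hδ : 0 < δ) (hη : 0 ≤ η)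
    (hclose : ∀ y, |y - 1| < δ → |Phi ((s * condScale n γ h w y - condShift n h w y) /
      √(1 - w * ((n : ℝ) - 1) / n)) - Phi s| ≤ η) :
    |explicitCDF n γ h w s - Phi s| ≤ η + 2 / ((n : ℝ) - 1) / δ ^ 2 := by
  have hp : (0 : ℝ) < n - 1 := by linarith [three_le_cast hn]
  have := isProbabilityMeasure_scaledChiSq hp
  have harg : Measurable fun y => (s * condScale n γ h w y - condShift n h w y) /
      √(1 - w * ((n : ℝ) - 1) / n) :=
    (((measurable_condScale n γ h w).const_mul s).sub (measurable_condShift n h w)).div_const _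
  rw [explicitCDF_eq hn, ← integral_sub_one_sq_scaledChiSq hp]
  exact abs_integral_sub_le_of_close_near_one (measurable_Phi.comp harg)
    (fun y => Phi_mem_Icc _) (Phi_mem_Icc s) (integrable_sub_one_sq_scaledChiSq hp) hδ hη hclose

lemma tendsto_explicitCDF {γ w : ℝ} (hγ : 0 < γ) (hw : w ∈ Ioo (0 : ℝ) 1) (h s : ℝ) :
    Tendsto (fun n : ℕ => explicitCDF n γ h w s) atTop (𝓝 (Phi s)) := by
  rw [Metric.tendsto_nhds]
  intro η hη
  have h1 := (continuous_Phi.tendsto s).comp (tendsto_condArg hγ hw h s)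
  have h2 := Metric.tendsto_nhds.1 h1 (η / 2) (by positivity)
  obtain ⟨pa, hpa, pb, hpb, hab⟩ := eventually_prod_iff.1 h2
  obtain ⟨δ, hδ, hδb⟩ := Metric.eventually_nhds_iff.1 hpb
  have h4 : Tendsto (fun n : ℕ => 2 / ((n : ℝ) - 1) / δ ^ 2) atTop (𝓝 0) := by
    have h5 : Tendsto (fun n : ℕ => (n : ℝ) - 1) atTop atTop :=
      tendsto_atTop_add_const_right _ (-1) tendsto_natCast_atTop_atTop
    have h6 : Tendsto (fun n : ℕ => 2 / ((n : ℝ) - 1)) atTop (𝓝 0) := h5.const_div_atTop 2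
    have h7 := h6.div_const (δ ^ 2)
    rwa [zero_div] at h7
  filter_upwards [hpa, eventually_ge_atTop 3,
    h4.eventually_lt_const (show (0 : ℝ) < η / 2 by positivity)] with n hna hn hsmall
  rw [Real.dist_eq]
  have h8 := abs_explicitCDF_sub_le hn (γ := γ) (w := w) (h := h) (s := s) hδ
    (show 0 ≤ η / 2 by positivity) fun y hy =>
      (show dist _ _ < η / 2 from hab hna (hδb (show dist y 1 < δ from hy))).le
  linarith

end Limit

/-! ### The plausibility function and the interval -/

section Plausibility

variable {n : ℕ} {γ : ℝ}

lemma cpl_eq (hn : 3 ≤ n) (hγ : 0 < γ) (x : ℕ → ℝ) (η : ℝ) : cpl n γ x η =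
    min 1 (min (2 * (1 - lowerCDF n γ (statH n x) (bFun n γ (statH n x) (statT n x) η)))
      (2 * upperCDF n γ (statH n x) (bFun n γ (statH n x) (statT n x) η))) := by
  rw [cpl, starCDF_eq_starOf]
  exact plausibility_starOf (isStrictCDF_lowerCDF hn hγ _) (isStrictCDF_upperCDF hn hγ _)
    (fun z => lowerCDF_le_upperCDF hn hγ _ z) _ η

lemma mem_plausInterval_iff (hn : 3 ≤ n) (hγ : 0 < γ) {α : ℝ} (hα : α ∈ Ioo (0 : ℝ) 1)
    (x : ℕ → ℝ) (η : ℝ) : η ∈ plausInterval n γ α x ↔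
      lowerCDF n γ (statH n x) (bFun n γ (statH n x) (statT n x) η) ≤ 1 - α / 2 ∧
      α / 2 ≤ upperCDF n γ (statH n x) (bFun n γ (statH n x) (statT n x) η) := by
  change α ≤ cpl n γ x η ↔ _
  rw [cpl_eq hn hγ, le_min_iff, le_min_iff]
  constructor
  · rintro ⟨-, h1, h2⟩
    constructor <;> linarith
  · rintro ⟨h1, h2⟩
    refine ⟨hα.2.le, ?_, ?_⟩ <;> linarith

lemma sigmaTilde_pos (hn : 3 ≤ n) (γ h S : ℝ) : 0 < sigmaTilde n γ h S := by
  have h3 := three_le_cast hn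
  exact Real.sqrt_pos.2 (lt_max_of_lt_left (Real.rpow_pos_of_pos (by linarith) _))

lemma plausInterval_eq_Icc (hn : 3 ≤ n) (hγ : 0 < γ) {α : ℝ} (hα : α ∈ Ioo (0 : ℝ) 1)
    (x : ℕ → ℝ) : plausInterval n γ α x =
      Icc (restMean n x - muTilde n (statH n x) √(restVar n x) -
          genInv (lowerCDF n γ (statH n x)) (1 - α / 2) *
            sigmaTilde n γ (statH n x) √(restVar n x))
        (restMean n x - muTilde n (statH n x) √(restVar n x) -
          genInv (upperCDF n γ (statH n x)) (α / 2) *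
            sigmaTilde n γ (statH n x) √(restVar n x)) := by
  have hs := sigmaTilde_pos hn γ (statH n x) √(restVar n x)
  ext η
  rw [mem_plausInterval_iff hn hγ hα,
    ← (isStrictCDF_lowerCDF hn hγ _).le_genInv_iff ⟨by linarith [hα.2], by linarith [hα.1]⟩,
    ← (isStrictCDF_upperCDF hn hγ _).genInv_le_iff ⟨by linarith [hα.1], by linarith [hα.2]⟩,
    bFun, statT, div_le_iff₀ hs, le_div_iff₀ hs, mem_Icc]
  constructor <;> rintro ⟨h1, h2⟩ <;> constructor <;> linarith

end Plausibility

/-! ### Conditional laws given `W_H` -/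

section Conditional

variable {Ω : Type*} [MeasurableSpace Ω] {P : Measure Ω} {ε e : ℕ → Ω → ℝ} {n : ℕ}

lemma inv_one_add_sq_mem {τ : ℝ} (hτ : 0 < τ) : (1 + τ ^ 2)⁻¹ ∈ Ioo (0 : ℝ) 1 :=
  ⟨by positivity, inv_lt_one_of_one_lt₀ (by linarith [pow_pos hτ 2])⟩

lemma one_sub_inv_diffVar (hn : 3 ≤ n) (τ : ℝ) :
    1 - (diffVar n τ)⁻¹ = 1 - (1 + τ ^ 2)⁻¹ * ((n : ℝ) - 1) / n := by
  have h3 := three_le_cast hn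
  have hp : (n : ℝ) - 1 ≠ 0 := by linarith
  rw [diffVar, add_comm (τ ^ 2) 1]
  field_simp

/-- The law of the rescaled sum of squares and the regression residual. -/
noncomputable abbrev residLaw (n : ℕ) (τ : ℝ) : Measure (ℝ × ℝ) :=
  (scaledChiSq ((n : ℝ) - 1)).prod (gaussianReal 0 (1 - (diffVar n τ)⁻¹).toNNReal)

lemma isProbabilityMeasure_residLaw (hn : 3 ≤ n) (τ : ℝ) :
    IsProbabilityMeasure (residLaw n τ) := by
  have h3 := three_le_cast hn
  have := isProbabilityMeasure_scaledChiSq (show (0 : ℝ) < n - 1 by linarith)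
  infer_instance

/-- The centered difference as a function of `h`, the rescaled sum of squares and the residual. -/
noncomputable def centeredFun (n : ℕ) (w : ℝ) (q : ℝ × ℝ × ℝ) : ℝ :=
  condShift n q.1 w q.2.1 + q.2.2

/-- `W_b` as a function of `h`, the rescaled sum of squares and the residual. -/
noncomputable def pivotFun (n : ℕ) (γ w : ℝ) (q : ℝ × ℝ × ℝ) : ℝ :=
  (condShift n q.1 w q.2.1 + q.2.2) / condScale n γ q.1 w q.2.1

lemma measurable_centeredFun (n : ℕ) (w : ℝ) : Measurable (centeredFun n w) := by
  unfold centeredFun condShift coefTwo; fun_prop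

lemma measurable_pivotFun (n : ℕ) (γ w : ℝ) : Measurable (pivotFun n γ w) := by
  unfold pivotFun condShift condScale coefOne coefTwo; fun_prop

lemma aemeasurable_auxY_auxR (h : IsStdNormalNoise n P ε e) (hn : 3 ≤ n) (τ : ℝ) :
    AEMeasurable (fun o => (auxY n τ ε e o, auxR n τ ε e o)) P :=
  (aemeasurable_auxY h hn τ).prodMk (hasLaw_auxR h hn τ).aemeasurable

lemma condDistrib_centeredDiff [IsFiniteMeasure P] (h : IsStdNormalNoise n P ε e) (hn : 3 ≤ n)
    (μ τ : ℝ) : ∀ᵐ x ∂(P.map (auxWH n τ ε e)),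
      condDistrib (centeredDiff n μ τ ε e) (auxWH n τ ε e) P x =
        (residLaw n τ).map fun v => centeredFun n (1 + τ ^ 2)⁻¹ (x, v) := by
  have := isProbabilityMeasure_residLaw hn τ
  refine condDistrib_ae_eq_map_of_indep (aemeasurable_auxWH h hn τ) (aemeasurable_auxY_auxR h hn τ)
    (map_auxWH_auxY_auxR h hn τ) (measurable_centeredFun n _) ?_
  filter_upwards [ae_auxMSq_pos h hn τ] with o ho using centeredDiff_eq hn μ ho

lemma auxWb_ae_eq (h : IsStdNormalNoise n P ε e) (hn : 3 ≤ n) (γ μ τ : ℝ) :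
    auxWb n γ μ τ ε e =ᵐ[P] fun o =>
      pivotFun n γ (1 + τ ^ 2)⁻¹ (auxWH n τ ε e o, (auxY n τ ε e o, auxR n τ ε e o)) := by
  filter_upwards [ae_auxMSq_pos h hn τ] with o ho using auxWb_eq hn γ μ ho

lemma aemeasurable_auxWb (h : IsStdNormalNoise n P ε e) (hn : 3 ≤ n) (γ μ τ : ℝ) :
    AEMeasurable (auxWb n γ μ τ ε e) P :=
  ((measurable_pivotFun n γ _).comp_aemeasurable
    ((aemeasurable_auxWH h hn τ).prodMk (aemeasurable_auxY_auxR h hn τ))).congr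
    (auxWb_ae_eq h hn γ μ τ).symm

lemma condDistrib_auxWb [IsFiniteMeasure P] (h : IsStdNormalNoise n P ε e) (hn : 3 ≤ n)
    (γ μ τ : ℝ) : ∀ᵐ x ∂(P.map (auxWH n τ ε e)),
      condDistrib (auxWb n γ μ τ ε e) (auxWH n τ ε e) P x =
        (residLaw n τ).map fun v => pivotFun n γ (1 + τ ^ 2)⁻¹ (x, v) := by
  have := isProbabilityMeasure_residLaw hn τ
  exact condDistrib_ae_eq_map_of_indep (aemeasurable_auxWH h hn τ) (aemeasurable_auxY_auxR h hn τ)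
    (map_auxWH_auxY_auxR h hn τ) (measurable_pivotFun n γ _) (auxWb_ae_eq h hn γ μ τ)

lemma cdf_map_pivotFun (hn : 3 ≤ n) (γ : ℝ) {τ : ℝ} (hτ : 0 < τ) (x s : ℝ) :
    cdf ((residLaw n τ).map fun v => pivotFun n γ (1 + τ ^ 2)⁻¹ (x, v)) s =
      explicitCDF n γ x (1 + τ ^ 2)⁻¹ s := by
  have h3 := three_le_cast hn
  have := isProbabilityMeasure_residLaw hn τ
  have := isProbabilityMeasure_scaledChiSq (show (0 : ℝ) < n - 1 by linarith)
  have hm : Measurable fun v => pivotFun n γ (1 + τ ^ 2)⁻¹ (x, v) :=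
    (measurable_pivotFun n γ _).comp measurable_prodMk_left
  have := Measure.isProbabilityMeasure_map (μ := residLaw n τ) hm.aemeasurable
  have hv := residVar_pos hn (inv_one_add_sq_mem hτ)
  rw [cdf_eq_real, map_measureReal_apply hm measurableSet_Iic, explicitCDF_eq hn, measureReal_def,
    Measure.prod_apply (hm measurableSet_Iic), ← integral_toReal]
  · refine integral_congr_ae (ae_of_all _ fun y => ?_)
    have hset : (Prod.mk y ⁻¹' ((fun v => pivotFun n γ (1 + τ ^ 2)⁻¹ (x, v)) ⁻¹' Iic s)) =
        Iic (s * condScale n γ x (1 + τ ^ 2)⁻¹ y - condShift n x (1 + τ ^ 2)⁻¹ y) := by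
      ext r
      simp only [mem_preimage, mem_Iic, pivotFun]
      rw [div_le_iff₀ (condScale_pos hn γ x _ y), le_sub_iff_add_le, add_comm r]
    simp only [hset]
    rw [one_sub_inv_diffVar hn, ← measureReal_def, cdf_gaussianReal_eq_Phi hv]
  · exact (measurable_measure_prodMk_left (hm measurableSet_Iic)).aemeasurable
  · exact ae_of_all _ fun y => measure_lt_top _ _

lemma cdf_condDistrib_auxWb [IsFiniteMeasure P] (h : IsStdNormalNoise n P ε e) (hn : 3 ≤ n)
    (γ μ : ℝ) {τ : ℝ} (hτ : 0 < τ) : ∀ᵐ x ∂(P.map (auxWH n τ ε e)), ∀ s,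
      cdf (condDistrib (auxWb n γ μ τ ε e) (auxWH n τ ε e) P x) s =
        explicitCDF n γ x (1 + τ ^ 2)⁻¹ s := by
  filter_upwards [condDistrib_auxWb h hn γ μ τ] with x hx s
  rw [hx, cdf_map_pivotFun hn γ hτ]

/-! ### The conditional mean -/

lemma abs_coefTwo_le (hn : 3 ≤ n) (h : ℝ) : |coefTwo n h| ≤ n - 1 := by
  have h3 := three_le_cast hn
  have hp : (0 : ℝ) ≤ n - 1 := by linarith
  have hpos : 0 < (n : ℝ) * (h ^ 2 + n - 2) := mul_pos (by linarith) (by nlinarith [sq_nonneg h])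
  rw [coefTwo, abs_div, abs_mul, abs_of_nonneg hp, abs_of_nonneg (Real.sqrt_nonneg _),
    div_le_iff₀ (Real.sqrt_pos.2 hpos)]
  refine mul_le_mul_of_nonneg_left (Real.abs_le_sqrt ?_) hp
  nlinarith [sq_nonneg h]

lemma integrable_condShift (hn : 3 ≤ n) (h w : ℝ) :
    Integrable (condShift n h w) (scaledChiSq ((n : ℝ) - 1)) := by
  have h3 := three_le_cast hn
  have hi1 := integrable_sqrt_scaledChiSq (show (0 : ℝ) < n - 1 by linarith)
  have hi2 := integrable_inv_sqrt_scaledChiSq (show (1 : ℝ) < n - 1 by linarith)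
  exact (hi1.sub (hi2.const_mul (coefThree n))).const_mul (coefTwo n h * √w)

/-- The conditional bias vanishes on average: this is what the centering `μ̃` is made for. -/
lemma integral_condShift (hn : 3 ≤ n) (h w : ℝ) :
    ∫ y, condShift n h w y ∂(scaledChiSq ((n : ℝ) - 1)) = 0 := by
  have h3 := three_le_cast hn
  have hi1 := integrable_sqrt_scaledChiSq (show (0 : ℝ) < n - 1 by linarith)
  have hi2 := integrable_inv_sqrt_scaledChiSq (show (1 : ℝ) < n - 1 by linarith)
  simp only [condShift, div_eq_mul_inv]
  rw [integral_const_mul, integral_sub hi1 (hi2.const_mul _), integral_const_mul,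
    integral_sqrt_scaledChiSq (by linarith), coefThree, show (n : ℝ) - 1 - 1 = n - 2 by ring,
    sub_self, mul_zero]

lemma integrable_id_gaussianReal (v : NNReal) : Integrable (fun x : ℝ => x) (gaussianReal 0 v) :=
  IsGaussian.integrable_id

lemma integrable_centeredFun (hn : 3 ≤ n) (τ x : ℝ) :
    Integrable (fun v => centeredFun n (1 + τ ^ 2)⁻¹ (x, v)) (residLaw n τ) := by
  have h3 := three_le_cast hn
  have := isProbabilityMeasure_scaledChiSq (show (0 : ℝ) < n - 1 by linarith)
  exact ((integrable_condShift hn x _).comp_fst _).add ((integrable_id_gaussianReal _).comp_snd _)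

lemma integral_centeredFun (hn : 3 ≤ n) (τ x : ℝ) :
    ∫ v, centeredFun n (1 + τ ^ 2)⁻¹ (x, v) ∂(residLaw n τ) = 0 := by
  have h3 := three_le_cast hn
  have := isProbabilityMeasure_scaledChiSq (show (0 : ℝ) < n - 1 by linarith)
  simp only [centeredFun]
  rw [integral_add ((integrable_condShift hn x _).comp_fst _)
    ((integrable_id_gaussianReal _).comp_snd _), integral_fun_fst,
    integral_fun_snd (f := fun r : ℝ => r),
    integral_condShift hn, integral_id_gaussianReal]
  simp

lemma integrable_centeredDiff [IsFiniteMeasure P] (h : IsStdNormalNoise n P ε e) (hn : 3 ≤ n)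
    (μ : ℝ) {τ : ℝ} (hτ : 0 < τ) : Integrable (centeredDiff n μ τ ε e) P := by
  have h3 := three_le_cast hn
  have := h.indep.isProbabilityMeasure
  have hH := hasLaw_auxWH h hn τ
  have : IsProbabilityMeasure (studentTMeasure ((n : ℝ) - 2)) := by
    rw [← hH.map_eq]; exact Measure.isProbabilityMeasure_map hH.aemeasurable
  have := isProbabilityMeasure_scaledChiSq (show (0 : ℝ) < n - 1 by linarith)
  have := isProbabilityMeasure_residLaw hn τ
  have hi1 := integrable_sqrt_scaledChiSq (show (0 : ℝ) < n - 1 by linarith)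
  have hi2 := integrable_inv_sqrt_scaledChiSq (show (1 : ℝ) < n - 1 by linarith)
  have hdom : Integrable (fun q : ℝ × ℝ × ℝ =>
      ((n : ℝ) - 1) * (√q.2.1 + coefThree n * (√q.2.1)⁻¹) + |q.2.2|)
      ((studentTMeasure ((n : ℝ) - 2)).prod (residLaw n τ)) := by
    have h1 : Integrable (fun v : ℝ × ℝ =>
        ((n : ℝ) - 1) * (√v.1 + coefThree n * (√v.1)⁻¹) + |v.2|) (residLaw n τ) :=
      (((hi1.add (hi2.const_mul (coefThree n))).const_mul ((n : ℝ) - 1)).comp_fst _).add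
        ((integrable_id_gaussianReal _).abs.comp_snd _)
    exact h1.comp_snd _
  have hint : Integrable (centeredFun n (1 + τ ^ 2)⁻¹)
      ((studentTMeasure ((n : ℝ) - 2)).prod (residLaw n τ)) := by
    refine hdom.mono' (measurable_centeredFun n _).aestronglyMeasurable (ae_of_all _ fun q => ?_)
    have hc3 : 0 ≤ coefThree n := div_nonneg (by linarith) (by linarith)
    have h1 := abs_condShift_le hn q.1 (y := q.2.1) (inv_one_add_sq_mem hτ)
    have h2 : |coefTwo n q.1| * (√q.2.1 + coefThree n * (√q.2.1)⁻¹) ≤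
        ((n : ℝ) - 1) * (√q.2.1 + coefThree n * (√q.2.1)⁻¹) :=
      mul_le_mul_of_nonneg_right (abs_coefTwo_le hn q.1) (by positivity)
    exact (abs_add_le _ _).trans (add_le_add (h1.trans h2) le_rfl)
  rw [← map_auxWH_auxY_auxR h hn τ] at hint
  refine (hint.comp_aemeasurable
    ((aemeasurable_auxWH h hn τ).prodMk (aemeasurable_auxY_auxR h hn τ))).congr ?_
  filter_upwards [ae_auxMSq_pos h hn τ] with o ho using (centeredDiff_eq hn μ ho).symm

lemma condDistrib_centeredDiff_mean [IsFiniteMeasure P] (h : IsStdNormalNoise n P ε e)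
    (hn : 3 ≤ n) (μ τ : ℝ) : ∀ᵐ x ∂(P.map (auxWH n τ ε e)),
      Integrable (fun y : ℝ => y)
        (condDistrib (centeredDiff n μ τ ε e) (auxWH n τ ε e) P x) ∧
      ∫ y, y ∂(condDistrib (centeredDiff n μ τ ε e) (auxWH n τ ε e) P x) = 0 := by
  filter_upwards [condDistrib_centeredDiff h hn μ τ] with x hx
  have hm : Measurable fun v => centeredFun n (1 + τ ^ 2)⁻¹ (x, v) :=
    (measurable_centeredFun n _).comp measurable_prodMk_left
  rw [hx]
  constructor
  · rw [integrable_map_measure (by fun_prop) hm.aemeasurable]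
    exact integrable_centeredFun hn τ x
  · rw [integral_map hm.aemeasurable (by fun_prop)]
    exact integral_centeredFun hn τ x

/-! ### Conditional coverage -/

lemma measurable_linComb_noise (h : IsStdNormalNoise n P ε e)
    (a : Finset.Icc 1 n ⊕ Finset.Icc 1 n → ℝ) : Measurable (linComb (noise n ε e) a) := by
  unfold linComb
  refine Finset.measurable_fun_sum _ fun j _ => Measurable.const_mul ?_ _
  rcases j with i | i
  · exact h.measurable_ε i i.2
  · exact h.measurable_e i i.2

lemma measurable_auxWH (h : IsStdNormalNoise n P ε e) (hn : 3 ≤ n) (τ : ℝ) :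
    Measurable (auxWH n τ ε e) := by
  have h3 := three_le_cast hn
  have hZ : Measurable (auxZ n τ ε e) := by
    rw [auxZ_eq_linComb hn]; exact measurable_linComb_noise h _
  have hM : Measurable (auxMSq n τ ε e) := by
    have h1 : auxMSq n τ ε e =
        fun o => ((n : ℝ) - 2)⁻¹ * sumSqDev (noise n ε e) (restCoef n τ) o := by
      funext o
      rw [← auxMSq_eq_sumSqDev hn, inv_mul_cancel_left₀ (by linarith)]
    rw [h1]
    exact (Finset.measurable_fun_sum _ fun k _ =>
      (measurable_linComb_noise h _).pow_const 2).const_mul _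
  have h1 := h.measurable_ε 1 (one_mem_Icc hn)
  have h2 := h.measurable_e 1 (one_mem_Icc hn)
  unfold auxWH
  fun_prop

/-- A distribution with continuous strictly increasing distribution function `F` gives the set
where `F` lies between `α / 2` and `1 - α / 2` mass at least `1 - α`. -/
lemma one_sub_le_measureReal_of_cdf {F : ℝ → ℝ} (hF : IsStrictCDF F) {ρ : Measure ℝ}
    [IsProbabilityMeasure ρ] (hρ : ∀ s, cdf ρ s = F s) {α : ℝ} (hα : α ∈ Ioo (0 : ℝ) 1) :
    1 - α ≤ ρ.real {y | α / 2 ≤ F y ∧ F y ≤ 1 - α / 2} := by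
  obtain ⟨a, ha⟩ := hF.exists_eq (u := α / 2) ⟨by linarith [hα.1], by linarith [hα.2]⟩
  obtain ⟨b, hb⟩ := hF.exists_eq (u := 1 - α / 2) ⟨by linarith [hα.2], by linarith [hα.1]⟩
  have hab : a ≤ b := by
    rw [← hF.strictMono.le_iff_le, ha, hb]; linarith [hα.2]
  have h1 : ρ.real (Ioc a b) = 1 - α := by
    have h2 := measureReal_sdiff (μ := ρ) (Iic_subset_Iic.2 hab) measurableSet_Iic
    rw [Iic_sdiff_Iic] at h2
    rw [h2, ← cdf_eq_real, ← cdf_eq_real, hρ, hρ, ha, hb]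
    ring
  rw [← h1]
  refine measureReal_mono fun y hy => ⟨?_, ?_⟩
  · rw [← ha]; exact hF.strictMono.monotone hy.1.le
  · rw [← hb]; exact hF.strictMono.monotone hy.2

/-- Given `H(X)`, the interval contains `μ₁` as soon as the exact conditional distribution
function at `W_b`, which lies between the envelopes, is between `α / 2` and `1 - α / 2`. -/
lemma one_sub_le_condExp_plausInterval [IsProbabilityMeasure P] (h : IsStdNormalNoise n P ε e)
    (hn : 3 ≤ n) (μ : ℝ) {τ γ α : ℝ} (hτ : 0 < τ) (hγ : 0 < γ) (hα : α ∈ Ioo (0 : ℝ) 1) :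
    ∀ᵐ o ∂P, 1 - α ≤ (P⟦{o' | firstMean μ τ ε o' ∈ plausInterval n γ α (obs μ τ ε e o')} |
      MeasurableSpace.comap (fun o' => statH n (obs μ τ ε e o')) inferInstance⟧) o := by
  have hHfun : (fun o' => statH n (obs μ τ ε e o')) = auxWH n τ ε e := by
    funext o; exact statH_obs_eq hn μ τ ε e o
  rw [hHfun]
  have hX := measurable_auxWH h hn τ
  have hW := aemeasurable_auxWb h hn γ μ τ
  have hw := inv_one_add_sq_mem hτ
  set X := auxWH n τ ε e with hXdef
  set W := auxWb n γ μ τ ε e with hWdef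
  let E : Set (ℝ × ℝ) := {q | α / 2 ≤ explicitCDF n γ q.1 (1 + τ ^ 2)⁻¹ q.2 ∧
    explicitCDF n γ q.1 (1 + τ ^ 2)⁻¹ q.2 ≤ 1 - α / 2}
  let E' : Set (ℝ × ℝ) := {q | lowerCDF n γ q.1 q.2 ≤ 1 - α / 2 ∧ α / 2 ≤ upperCDF n γ q.1 q.2}
  have hE : MeasurableSet E :=
    (measurableSet_le measurable_const (measurable_explicitCDF hn γ _)).inter
      (measurableSet_le (measurable_explicitCDF hn γ _) measurable_const)
  have hE' : MeasurableSet E' :=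
    (measurableSet_le (measurable_lowerCDF hn hγ) measurable_const).inter
      (measurableSet_le measurable_const (measurable_upperCDF hn hγ))
  have hEE' : E ⊆ E' := fun q hq =>
    ⟨(lowerCDF_le_explicitCDF hn hγ q.1 q.2 hw).trans hq.2,
      hq.1.trans (explicitCDF_le_upperCDF hn hγ q.1 q.2 hw)⟩
  have hA : {o' | firstMean μ τ ε o' ∈ plausInterval n γ α (obs μ τ ε e o')} =
      (fun o => (X o, W o)) ⁻¹' E' := by
    ext o
    change firstMean μ τ ε o ∈ plausInterval n γ α (obs μ τ ε e o) ↔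
      lowerCDF n γ (X o) (W o) ≤ 1 - α / 2 ∧ α / 2 ≤ upperCDF n γ (X o) (W o)
    rw [mem_plausInterval_iff hn hγ hα, hXdef, hWdef, auxWb, statH_obs_eq hn]
  have hXW : AEMeasurable (fun o => (X o, W o)) P := hX.aemeasurable.prodMk hW
  have hindint : ∀ {D : Set (ℝ × ℝ)}, MeasurableSet D →
      Integrable (fun o => D.indicator (fun _ => (1 : ℝ)) (X o, W o)) P := fun {D} hD =>
    Integrable.of_bound (((measurable_const.indicator hD).comp_aemeasurable
      hXW).aestronglyMeasurable) 1 (ae_of_all _ fun o => by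
        by_cases hq : (X o, W o) ∈ D <;> simp [indicator, hq])
  have hmono : P[fun o => E.indicator (fun _ => (1 : ℝ)) (X o, W o) |
        MeasurableSpace.comap X inferInstance] ≤ᵐ[P]
      P[fun o => E'.indicator (fun _ => (1 : ℝ)) (X o, W o) |
        MeasurableSpace.comap X inferInstance] :=
    condExp_mono (hindint hE) (hindint hE') (ae_of_all _ fun o =>
      indicator_le_indicator_of_subset hEE' (fun _ => zero_le_one) _)
  have hdis := condExp_prod_ae_eq_integral_condDistrib hX hW
    (f := E.indicator fun _ => (1 : ℝ)) (stronglyMeasurable_const.indicator hE) (hindint hE)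
  have hcdf := ae_of_ae_map hX.aemeasurable (cdf_condDistrib_auxWb h hn γ μ hτ)
  rw [hA]
  filter_upwards [hmono, hdis, hcdf] with o h1 h2 h3
  refine le_trans ?_ h1
  rw [h2]
  have h4 : (fun y => E.indicator (fun _ => (1 : ℝ)) (X o, y)) =
      {y | α / 2 ≤ explicitCDF n γ (X o) (1 + τ ^ 2)⁻¹ y ∧
        explicitCDF n γ (X o) (1 + τ ^ 2)⁻¹ y ≤ 1 - α / 2}.indicator 1 := rfl
  have h5 : MeasurableSet {y | α / 2 ≤ explicitCDF n γ (X o) (1 + τ ^ 2)⁻¹ y ∧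
        explicitCDF n γ (X o) (1 + τ ^ 2)⁻¹ y ≤ 1 - α / 2} :=
    hE.preimage measurable_prodMk_left
  rw [h4, integral_indicator_one h5]
  exact one_sub_le_measureReal_of_cdf (isStrictCDF_explicitCDF hn hγ _ hw) h3 hα

end Conditional

end PartialBayes

theorem mainTheorem5 {Ω : ℕ → Type*} [∀ n, MeasurableSpace (Ω n)]
    (P : ∀ n, Measure (Ω n)) [∀ n, IsProbabilityMeasure (P n)]
    (ε e : ∀ n, ℕ → Ω n → ℝ)
    (hnoise : ∀ n, 3 ≤ n → IsStdNormalNoise n (P n) (ε n) (e n))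
    (μ τ γ : ℝ) (hτ : 0 < τ) (hγ : γ ∈ Ioo (0 : ℝ) (1 / 2)) :
    (∀ n : ℕ, 3 ≤ n →
      -- the associations, the law of the auxiliary variables and of `H(X) = W_H`
      ((∀ o, restMean n (obs μ τ (ε n) (e n) o) = μ + tauTilde n τ * auxZ n τ (ε n) (e n) o) ∧
        (∀ o, restVar n (obs μ τ (ε n) (e n) o) = (τ ^ 2 + 1) * auxMSq n τ (ε n) (e n) o) ∧
        (∀ o, statH n (obs μ τ (ε n) (e n) o) = auxWH n τ (ε n) (e n) o) ∧
        HasLaw (auxZ n τ (ε n) (e n)) (gaussianReal 0 1) (P n) ∧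
        HasLaw (fun o => ((n : ℝ) - 2) * auxMSq n τ (ε n) (e n) o)
          (chiSqMeasure ((n : ℝ) - 2)) (P n) ∧
        iIndepFun ![ε n 1, e n 1, auxZ n τ (ε n) (e n), auxMSq n τ (ε n) (e n)] (P n) ∧
        HasLaw (auxWH n τ (ε n) (e n)) (studentTMeasure ((n : ℝ) - 2)) (P n)) ∧
      -- the conditional mean given `W_H = h`
      (Integrable (centeredDiff n μ τ (ε n) (e n)) (P n) ∧
        ∀ᵐ h : ℝ,
          Integrable (fun y : ℝ => y)
            (condDistrib (centeredDiff n μ τ (ε n) (e n)) (auxWH n τ (ε n) (e n)) (P n) h) ∧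
          ∫ y, y ∂(condDistrib (centeredDiff n μ τ (ε n) (e n))
            (auxWH n τ (ε n) (e n)) (P n) h) = 0) ∧
      -- the conditional c.d.f. given `W_H = h`
      (∀ᵐ h : ℝ, ∀ s : ℝ,
        cdf (condDistrib (auxWb n γ μ τ (ε n) (e n)) (auxWH n τ (ε n) (e n)) (P n) h) s =
          explicitCDF n γ h (1 + τ ^ 2)⁻¹ s) ∧
      -- the bounding c.d.f.
      (∀ h : ℝ, (∃ ν : Measure ℝ, IsProbabilityMeasure ν ∧ ∀ z, cdf ν z = starCDF n γ h z) ∧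
        ∀ w ∈ Ioo (0 : ℝ) 1, StochBoundedInTails (explicitCDF n γ h w) (starCDF n γ h)) ∧
      -- the plausibility function and the interval
      (∀ x : ℕ → ℝ, 0 < restVar n x →
        (∀ η : ℝ, cpl n γ x η =
          min 1 (min
            (2 * (1 - lowerCDF n γ (statH n x) (bFun n γ (statH n x) (statT n x) η)))
            (2 * upperCDF n γ (statH n x) (bFun n γ (statH n x) (statT n x) η)))) ∧
        ∀ α ∈ Ioo (0 : ℝ) 1, plausInterval n γ α x =
          Icc
            (restMean n x - muTilde n (statH n x) √(restVar n x) -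
              genInv (lowerCDF n γ (statH n x)) (1 - α / 2) *
                sigmaTilde n γ (statH n x) √(restVar n x))
            (restMean n x - muTilde n (statH n x) √(restVar n x) -
              genInv (upperCDF n γ (statH n x)) (α / 2) *
                sigmaTilde n γ (statH n x) √(restVar n x))) ∧
      -- its conditional coverage given `H(X)`
      (∀ α ∈ Ioo (0 : ℝ) 1, ∀ᵐ o ∂(P n),
        1 - α ≤ ((P n)⟦{o' | firstMean μ τ (ε n) o' ∈ plausInterval n γ α (obs μ τ (ε n) (e n) o')} |
          MeasurableSpace.comap (fun o' => statH n (obs μ τ (ε n) (e n) o')) inferInstance⟧) o)) ∧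
    -- convergence in distribution to `N(0,1)` given `W_H = h`, as `n → ∞`
    (∀ᵐ h : ℝ, ∀ s : ℝ,
      Tendsto (fun n : ℕ =>
        cdf (condDistrib (auxWb n γ μ τ (ε n) (e n)) (auxWH n τ (ε n) (e n)) (P n) h) s)
        atTop (𝓝 (Phi s))) ∧
    (∀ h s : ℝ, Tendsto (fun n : ℕ => explicitCDF n γ h (1 + τ ^ 2)⁻¹ s) atTop (𝓝 (Phi s))) := by
  have hw := inv_one_add_sq_mem hτ
  have hcdf : ∀ n, 3 ≤ n → ∀ᵐ h : ℝ, ∀ s : ℝ,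
      cdf (condDistrib (auxWb n γ μ τ (ε n) (e n)) (auxWH n τ (ε n) (e n)) (P n) h) s =
        explicitCDF n γ h (1 + τ ^ 2)⁻¹ s := fun n hn =>
    ae_volume_of_ae_map_auxWH (hnoise n hn) hn τ (cdf_condDistrib_auxWb (hnoise n hn) hn γ μ hτ)
  refine ⟨fun n hn => ?_, ?_, fun h s => tendsto_explicitCDF hγ.1 hw h s⟩
  · have hN := hnoise n hn
    refine ⟨⟨restMean_obs_eq hn μ τ (ε n) (e n), restVar_obs_eq hn μ τ (ε n) (e n),
      statH_obs_eq hn μ τ (ε n) (e n), hasLaw_auxZ hN hn τ, hasLaw_auxMSq hN hn τ,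
      iIndepFun_aux hN hn τ, hasLaw_auxWH hN hn τ⟩,
      ⟨integrable_centeredDiff hN hn μ hτ,
        ae_volume_of_ae_map_auxWH hN hn τ (condDistrib_centeredDiff_mean hN hn μ τ)⟩,
      hcdf n hn, fun h => ⟨?_, fun w hw' => ?_⟩,
      fun x _ => ⟨cpl_eq hn hγ.1 x, fun α hα => plausInterval_eq_Icc hn hγ.1 hα x⟩,
      fun α hα => one_sub_le_condExp_plausInterval hN hn μ hτ hγ.1 hα⟩
    · exact exists_measure_cdf_eq_starOf (isStrictCDF_lowerCDF hn hγ.1 h)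
        (isStrictCDF_upperCDF hn hγ.1 h) (lowerCDF_le_upperCDF hn hγ.1 h)
    · exact stochBoundedInTails_starOf (isStrictCDF_explicitCDF hn hγ.1 h hw')
        (fun z => lowerCDF_le_explicitCDF hn hγ.1 h z hw')
        (fun z => explicitCDF_le_upperCDF hn hγ.1 h z hw')
  · have hall : ∀ᵐ h : ℝ, ∀ n, 3 ≤ n → ∀ s : ℝ,
        cdf (condDistrib (auxWb n γ μ τ (ε n) (e n)) (auxWH n τ (ε n) (e n)) (P n) h) s =
          explicitCDF n γ h (1 + τ ^ 2)⁻¹ s :=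
      ae_all_iff.2 fun n => by
        by_cases hn : 3 ≤ n
        · exact (hcdf n hn).mono fun h hh _ => hh
        · exact ae_of_all _ fun h h' => absurd h' hn
    filter_upwards [hall] with h hh s
    refine (tendsto_explicitCDF hγ.1 hw h s).congr' ?_
    filter_upwards [eventually_ge_atTop 3] with n hn using (hh n hn s).symm
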